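/- **Setting.** Let $\Omega=(0,1)^2$ and let $b,c,\beta,C^*$ be positive constants with $b\ge\beta$. Let $N$ be a positive multiple of $6$ and $0<\varepsilon\le N^{-1}$. With $\rho=5/2$ put $$\lambda_x=\min\{\tfrac12,\ \rho\tfrac{\varepsilon}{\beta}\ln N\},\qquad \lambda_y=\min\{\tfrac13,\ \rho\sqrt{\varepsilon}\ln N\},$$ and assume $\lambda_x=\rho\varepsilon\beta^{-1}\ln N$ and $\lambda_y=\rho\sqrt\varepsilon\ln N$. The mesh points $0=x_0<\dots<x_N=1$ divide each of $[0,1-\lambda_x]$ and $[1-\lambda_x,1]$ into $N/2$ equal intervals; the points $0=y_0<\dots<y_N=1$ divide each of $[0,\lambda_y]$, $[\lambda_y,1-\lambda_y]$ and $[1-\lambda_y,1]$ into $N/3$ equal intervals. The triangulation $\mathcal T_N$ consists of the triangles $K^1_{i,j}$ with vertices $(x_i,y_j),(x_{i+1},y_j),(x_i,y_{j+1})$ and $K^2_{i,j}$ with vertices $(x_i,y_{j+1}),(x_{i+1},y_j),(x_{i+1},y_{j+1})$, $0\le i,j<N$. Let $V^N$ be the space of continuous functions on $\overline\Omega$ that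 are affine on every $K\in\mathcal T_N$ and vanish on $\partial\Omega$; $w^I$ is the continuous piecewise affine function that agrees with $w$ at all mesh points. Write $(\cdot,\cdot)_D$ and $\|\cdot\|_D$ for the inner product and norm of $L^2(D)$ and omit $D=\Omega$. Put $\delta_K=C^*N^{-1}$ if $K\subset[0,1-\lambda_x]\times[0,1]$ and $\delta_K=0$ otherwise, and, for continuous $u,v$ that are smooth on each $K$, $$a_{SD}(u,v)=\varepsilon(\nabla u,\nabla v)+(bu_x+cu,v)+\sum_{K\in\mathcal T_N}(-\varepsilon\Delta u+bu_x+cu,\ \delta_K b v_x)_K .$$ Let $\boldsymbol x^*=(x^*,y^*)$ be a mesh point, and let $G\in V^N$ be the discrete Green's function at $\boldsymbol x^*$: $a_{SD}(v,G)=v(\boldsymbol x^*)$ for all $v\in V^N$. For $k>0$ let $$\sigma_x=k\max\{N^{-1},\varepsilon\ln^2N\},\qquad \sigma_y=\begin{cases}kN^{-1/2}&\text{if }\varepsilon\le N^{-2},\\ k\max\{N^{-3/2}\varepsilon^{-1/2},\varepsilon^{1/2}\}&\text{if }N^{-2}\le\varepsilon\le N^{-1},\end{cases}$$ and, with $g(r)=2/(1+e^r)$,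 $$\omega(x,y)=g\Big(\frac{x-x^*}{\sigma_x}\Big)\,g\Big(\frac{y-y^*}{\sigma_y}\Big)\,g\Big(-\frac{y-y^*}{\sigma_y}\Big).$$ Finally let $$|||G|||_\omega^2=\varepsilon\|\omega^{-1/2}G_x\|^2+\varepsilon\|\omega^{-1/2}G_y\|^2+\frac b2\big\|\big((\omega^{-1})_x\big)^{1/2}G\big\|^2+c\|\omega^{-1/2}G\|^2+\sum_{K\in\mathcal T_N}b^2\delta_K\|\omega^{-1/2}G_x\|_K^2 .$$ **Lemma.** There is $k_0>1$, depending only on $b,c,\beta,C^*$ (in particular independent of $N$, $\varepsilon$ and $\boldsymbol x^*$), such that for every $k\ge k_0$, every $N$ and $\varepsilon$ as above, every mesh point $\boldsymbol x^*$ and the discrete Green's function $G$ at $\boldsymbol x^*$, $$a_{SD}\big((\omega^{-1}G)^I-\omega^{-1}G,\ G\big)\le\frac1{16}\,|||G|||_\omega^2 .$$ -/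

import Mathlib

open MeasureTheory

noncomputable section

namespace ShishkinSDFEM

/-- The domain `Ω = (0,1)²`. Its closure is the closed unit square. -/
def Omega : Set (ℝ × ℝ) := Set.Ioo (0 : ℝ) 1 ×ˢ Set.Ioo (0 : ℝ) 1

/-- Partial derivative in `x`. -/
def dx (u : ℝ × ℝ → ℝ) (z : ℝ × ℝ) : ℝ := deriv (fun t => u (t, z.2)) z.1

/-- Partial derivative in `y`. -/
def dy (u : ℝ × ℝ → ℝ) (z : ℝ × ℝ) : ℝ := deriv (fun t => u (z.1, t)) z.2

/-- The `L²(D)` inner product `(u, v)_D`. -/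
def ip (D : Set (ℝ × ℝ)) (u v : ℝ × ℝ → ℝ) : ℝ := ∫ z in D, u z * v z

/-- The squared `L²(D)` norm `‖u‖²_D`. -/
def normSq (D : Set (ℝ × ℝ)) (u : ℝ × ℝ → ℝ) : ℝ := ∫ z in D, u z ^ 2

/-! ### The Shishkin mesh -/

/-- The mesh transition constant. -/
def rho : ℝ := 5 / 2

/-- Mesh transition parameter in the `x` direction. -/
def lambdaX (β ε : ℝ) (N : ℕ) : ℝ := min (1 / 2) (rho * (ε / β) * Real.log N)

/-- Mesh transition parameter in the `y` direction. -/
def lambdaY (ε : ℝ) (N : ℕ) : ℝ := min (1 / 3) (rho * √ε * Real.log N)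

/-- Mesh points in `x`: `N/2` uniform intervals on each of `[0, 1-λ_x]` and `[1-λ_x, 1]`. -/
def meshX (β ε : ℝ) (N i : ℕ) : ℝ :=
  if 2 * i ≤ N then (i : ℝ) * ((1 - lambdaX β ε N) / ((N : ℝ) / 2))
  else (1 - lambdaX β ε N) + ((i : ℝ) - (N : ℝ) / 2) * (lambdaX β ε N / ((N : ℝ) / 2))

/-- Mesh points in `y`: `N/3` uniform intervals on each of `[0, λ_y]`, `[λ_y, 1-λ_y]` and
`[1-λ_y, 1]`. -/
def meshY (ε : ℝ) (N j : ℕ) : ℝ :=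
  if 3 * j ≤ N then (j : ℝ) * (lambdaY ε N / ((N : ℝ) / 3))
  else if 3 * j ≤ 2 * N then
    lambdaY ε N + ((j : ℝ) - (N : ℝ) / 3) * ((1 - 2 * lambdaY ε N) / ((N : ℝ) / 3))
  else (1 - lambdaY ε N) + ((j : ℝ) - 2 * (N : ℝ) / 3) * (lambdaY ε N / ((N : ℝ) / 3))

/-- The mesh point `(x_i, y_j)`. -/
def node (β ε : ℝ) (N i j : ℕ) : ℝ × ℝ := (meshX β ε N i, meshY ε N j)

/-- Labels of the triangles: `(i, j, false)` stands for `K¹_{i,j}` and `(i, j, true)` for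
`K²_{i,j}`. -/
abbrev Elt (N : ℕ) : Type := Fin N × Fin N × Bool

/-- The (closed) triangle with a given label: `K¹_{i,j}` has vertices `(x_i, y_j)`,
`(x_{i+1}, y_j)`, `(x_i, y_{j+1})`, and `K²_{i,j}` has vertices `(x_i, y_{j+1})`,
`(x_{i+1}, y_j)`, `(x_{i+1}, y_{j+1})`. -/
def tri (β ε : ℝ) (N : ℕ) : Elt N → Set (ℝ × ℝ)
  | (i, j, false) =>
      convexHull ℝ {node β ε N i j, node β ε N (i + 1) j, node β ε N i (j + 1)}
  | (i, j, true) =>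
      convexHull ℝ {node β ε N i (j + 1), node β ε N (i + 1) j, node β ε N (i + 1) (j + 1)}

/-! ### The finite element space and the nodal interpolant -/

/-- `v` belongs to `V^N`: it is continuous on the closed square, affine on every triangle and
vanishes on `∂Ω`. (Values outside the closed square are irrelevant.) -/
structure MemVN (β ε : ℝ) (N : ℕ) (v : ℝ × ℝ → ℝ) : Prop where
  continuousOn : ContinuousOn v (closure Omega)
  affine : ∀ K : Elt N, ∃ p q r : ℝ, ∀ z ∈ tri β ε N K, v z = p + q * z.1 + r * z.2
  boundary : ∀ z ∈ frontier Omega, v z = 0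

/-- The affine function that agrees with `w` at the three vertices of a triangle. -/
def localInterp (β ε : ℝ) (N : ℕ) (w : ℝ × ℝ → ℝ) : Elt N → ℝ × ℝ → ℝ
  | (i, j, false), z =>
      w (node β ε N i j)
        + (z.1 - meshX β ε N i) / (meshX β ε N (i + 1) - meshX β ε N i)
            * (w (node β ε N (i + 1) j) - w (node β ε N i j))
        + (z.2 - meshY ε N j) / (meshY ε N (j + 1) - meshY ε N j)
            * (w (node β ε N i (j + 1)) - w (node β ε N i j))
  | (i, j, true), z =>
      w (node β ε N (i + 1) (j + 1))
        + (z.1 - meshX β ε N (i + 1)) / (meshX β ε N (i + 1) - meshX β ε N i)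
            * (w (node β ε N (i + 1) (j + 1)) - w (node β ε N i (j + 1)))
        + (z.2 - meshY ε N (j + 1)) / (meshY ε N (j + 1) - meshY ε N j)
            * (w (node β ε N (i + 1) (j + 1)) - w (node β ε N (i + 1) j))

open Classical in
/-- The piecewise linear nodal interpolant `w^I`. On the common part of two triangles the two
local interpolants agree, so that the choice of a triangle containing `z` is immaterial. -/
def interp (β ε : ℝ) (N : ℕ) (w : ℝ × ℝ → ℝ) (z : ℝ × ℝ) : ℝ :=
  if h : ∃ K : Elt N, z ∈ tri β ε N K then localInterp β ε N w h.choose z else 0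

/-! ### The streamline diffusion bilinear form -/

/-- The stabilization parameter `δ_K`: it is `C⋆ N⁻¹` for the triangles in
`Ω_s ∪ Ω_y = [0, 1-λ_x] × [0,1]`, that is for `i < N/2`, and `0` for those in `Ω_x ∪ Ω_xy`. -/
def delta (Cs : ℝ) (N : ℕ) (K : Elt N) : ℝ := if 2 * (K.1 : ℕ) < N then Cs / N else 0

/-- The Galerkin form `ε (∇u, ∇v) + (b u_x + c u, v)`. -/
def aGal (b c ε : ℝ) (u v : ℝ × ℝ → ℝ) : ℝ :=
  ε * (ip Omega (dx u) (dx v) + ip Omega (dy u) (dy v))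
    + ip Omega (fun z => b * dx u z + c * u z) v

/-- The stabilization form `∑_K (-ε Δu + b u_x + c u, δ_K b v_x)_K`; the derivatives are the
elementwise ones. -/
def aStab (b c β Cs ε : ℝ) (N : ℕ) (u v : ℝ × ℝ → ℝ) : ℝ :=
  ∑ K : Elt N, ip (tri β ε N K)
    (fun z => -ε * (dx (dx u) z + dy (dy u) z) + b * dx u z + c * u z)
    (fun z => delta Cs N K * b * dx v z)

/-- The bilinear form `a_SD` of the streamline diffusion method. -/
def aSD (b c β Cs ε : ℝ) (N : ℕ) (u v : ℝ × ℝ → ℝ) : ℝ :=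
  aGal b c ε u v + aStab b c β Cs ε N u v

/-- `G` is the discrete Green's function associated with the point `p`. -/
def IsDiscreteGreen (b c β Cs ε : ℝ) (N : ℕ) (p : ℝ × ℝ) (G : ℝ × ℝ → ℝ) : Prop :=
  MemVN β ε N G ∧ ∀ v : ℝ × ℝ → ℝ, MemVN β ε N v → aSD b c β Cs ε N v G = v p

/-! ### The weight function and the weighted norm -/

/-- The logistic-type function `g(r) = 2 / (1 + e^r)`. -/
def g (r : ℝ) : ℝ := 2 / (1 + Real.exp r)

/-- The parameter `σ_x`. -/
def sigmaX (k ε : ℝ) (N : ℕ) : ℝ := k * max ((N : ℝ) ^ (-1 : ℝ)) (ε * Real.log N ^ 2)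

/-- The parameter `σ_y`; it is used for `ε ≤ N⁻¹` only, and both formulas give the same value
for `ε = N⁻²`. -/
def sigmaY (k ε : ℝ) (N : ℕ) : ℝ :=
  if ε ≤ (N : ℝ) ^ (-2 : ℝ) then k * (N : ℝ) ^ (-(1 / 2) : ℝ)
  else k * max ((N : ℝ) ^ (-(3 / 2) : ℝ) * ε ^ (-(1 / 2) : ℝ)) (ε ^ (1 / 2 : ℝ))

/-- The weight function `ω` centred at `p = (x⋆, y⋆)`. -/
def omega (k ε : ℝ) (N : ℕ) (p z : ℝ × ℝ) : ℝ :=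
  g ((z.1 - p.1) / sigmaX k ε N) * g ((z.2 - p.2) / sigmaY k ε N)
    * g (-((z.2 - p.2) / sigmaY k ε N))

/-- The squared weighted energy norm `|||G|||²_ω`. -/
def wNormSq (b c β Cs ε : ℝ) (N : ℕ) (ω G : ℝ × ℝ → ℝ) : ℝ :=
  ε * normSq Omega (fun z => √((ω z)⁻¹) * dx G z)
    + ε * normSq Omega (fun z => √((ω z)⁻¹) * dy G z)
    + b / 2 * normSq Omega (fun z => √(dx (fun z' => (ω z')⁻¹) z) * G z)
    + c * normSq Omega (fun z => √((ω z)⁻¹) * G z)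
    + ∑ K : Elt N, b ^ 2 * delta Cs N K * normSq (tri β ε N K) (fun z => √((ω z)⁻¹) * dx G z)

end ShishkinSDFEM

end

noncomputable section

namespace ShishkinSDFEM

/-! ### Triangles of a tensor-product mesh -/

/-! Write `E = (ω⁻¹G)^I - ω⁻¹G`. On a triangle `G` is affine, so every second derivative of `ω⁻¹G`
contains at least one derivative of `ω⁻¹`, and each of these costs a factor `1/σ_x` or `1/σ_y`. Both
scales are at least `k` times the lengths they compete with (`N⁻¹` and `ε` for `σ_x`, `N⁻¹` and `√ε`
for `σ_y`), so `E` and its derivatives are small for large `k`. The outcome is `a_SD(E, G) ≤ C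
k^(-1/2) |||G|||_ω²` with `C` depending on `b, c, β, C⋆` only; `k₀` makes the factor at most `1/16`.

The mechanism is elementwise. A mesh step is at most `σ`, so the weights vary by a factor of at most
3 per direction on a cell, and all errors are bounded by vertex values `W` of `ω⁻¹` and `V` of
`(ω⁻¹)_x` (`error_bounds`). Conversely, each triangle contains a rectangle with sides 1/16 of the
cell on which the affine function is comparable to its maximum (`exists_rectangle_affine_large`), so
the pointwise bounds turn into integrals over the same triangle (`le_integral_normDensity`).

The delicate term is convection. Since `E` is continuous and `G = 0` at `x = 0` and `x = 1`, `b(E_x,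
G) = -b(E, G_x)` (`sum_integral_E_mul_G`). On stabilized triangles the norm contains `N⁻¹ ω⁻¹ G_x²`,
and `E G_x` is absorbed by weighted Young inequalities (`bE_mul_q_le`); the two regimes of `σ_y` are
what this requires. The power `k^(-1/2)` comes from interpolating between `V G²` and `N⁻¹ W G_x²` by
means of `V ≤ W/σ_x`.

In the layer at `x = 1` there is no stabilization. There the relative size of `E` times the layer
width `λ_x` is `O(ε/k)` (`layer_ratio_le`), so `E G_x` is bounded by `k⁻¹(ε λ_x⁻² ω⁻¹G² + ε
ω⁻¹G_x²)`. A weighted Poincaré inequality (`poincare_layer`), valid because `G = 0` at `x = 1` and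
`ω⁻¹` increases in `x`, absorbs the first part. -/

/-- The abscissa at height `y` of the diagonal of the cell `(i, j)`. -/
def diag (xs ys : ℕ → ℝ) (i j : ℕ) (y : ℝ) : ℝ :=
  xs i + (xs (i + 1) - xs i) * ((ys (j + 1) - y) / (ys (j + 1) - ys j))

/-- The left boundary of a triangle. -/
def leftEdge (xs ys : ℕ → ℝ) (i j : ℕ) : Bool → ℝ → ℝ
  | false => fun _ => xs i
  | true => diag xs ys i j

/-- The right boundary of a triangle. -/
def rightEdge (xs ys : ℕ → ℝ) (i j : ℕ) : Bool → ℝ → ℝ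
  | false => diag xs ys i j
  | true => fun _ => xs (i + 1)

/-- The open triangle. -/
def openTri (xs ys : ℕ → ℝ) (i j : ℕ) (t : Bool) : Set (ℝ × ℝ) :=
  {z | (ys j < z.2 ∧ z.2 < ys (j + 1)) ∧
    leftEdge xs ys i j t z.2 < z.1 ∧ z.1 < rightEdge xs ys i j t z.2}

/-- The closed triangle. -/
def closedTri (xs ys : ℕ → ℝ) (i j : ℕ) (t : Bool) : Set (ℝ × ℝ) :=
  {z | (ys j ≤ z.2 ∧ z.2 ≤ ys (j + 1)) ∧
    leftEdge xs ys i j t z.2 ≤ z.1 ∧ z.1 ≤ rightEdge xs ys i j t z.2}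

/-- The triangle as the convex hull of its vertices. -/
def hullTri (xs ys : ℕ → ℝ) (i j : ℕ) : Bool → Set (ℝ × ℝ)
  | false => convexHull ℝ {(xs i, ys j), (xs (i + 1), ys j), (xs i, ys (j + 1))}
  | true => convexHull ℝ {(xs i, ys (j + 1)), (xs (i + 1), ys j), (xs (i + 1), ys (j + 1))}

section Mesh

variable {xs ys : ℕ → ℝ} (hxs : StrictMono xs) (hys : StrictMono ys)

@[fun_prop]
lemma continuous_diag (xs ys : ℕ → ℝ) (i j : ℕ) : Continuous (diag xs ys i j) := by
  unfold diag; fun_prop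

@[fun_prop]
lemma continuous_leftEdge (xs ys : ℕ → ℝ) (i j : ℕ) (t : Bool) :
    Continuous (leftEdge xs ys i j t) := by
  cases t <;> simp only [leftEdge] <;> fun_prop

@[fun_prop]
lemma continuous_rightEdge (xs ys : ℕ → ℝ) (i j : ℕ) (t : Bool) :
    Continuous (rightEdge xs ys i j t) := by
  cases t <;> simp only [rightEdge] <;> fun_prop

lemma isOpen_openTri (xs ys : ℕ → ℝ) (i j : ℕ) (t : Bool) : IsOpen (openTri xs ys i j t) := by
  have h1 : IsOpen {z : ℝ × ℝ | ys j < z.2} := isOpen_lt (by fun_prop) (by fun_prop)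
  have h2 : IsOpen {z : ℝ × ℝ | z.2 < ys (j + 1)} := isOpen_lt (by fun_prop) (by fun_prop)
  have h3 : IsOpen {z : ℝ × ℝ | leftEdge xs ys i j t z.2 < z.1} :=
    isOpen_lt (by fun_prop) (by fun_prop)
  have h4 : IsOpen {z : ℝ × ℝ | z.1 < rightEdge xs ys i j t z.2} :=
    isOpen_lt (by fun_prop) (by fun_prop)
  exact (h1.inter h2).inter (h3.inter h4)

include hxs hys

lemma le_diag {i j : ℕ} {y : ℝ} (hy : y ≤ ys (j + 1)) : xs i ≤ diag xs ys i j y := by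
  have h1 := hxs i.lt_succ_self
  have h2 := hys j.lt_succ_self
  simp only [Nat.succ_eq_add_one] at h1 h2
  have : 0 ≤ (xs (i + 1) - xs i) * ((ys (j + 1) - y) / (ys (j + 1) - ys j)) :=
    mul_nonneg (by linarith) (div_nonneg (by linarith) (by linarith))
  unfold diag; linarith

lemma diag_le {i j : ℕ} {y : ℝ} (hy : ys j ≤ y) : diag xs ys i j y ≤ xs (i + 1) := by
  have h1 := hxs i.lt_succ_self
  have h2 := hys j.lt_succ_self
  simp only [Nat.succ_eq_add_one] at h1 h2
  have : (ys (j + 1) - y) / (ys (j + 1) - ys j) ≤ 1 := by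
    rw [div_le_one (by linarith)]; linarith
  unfold diag; nlinarith

lemma closedTri_subset_cell (i j : ℕ) (t : Bool) :
    closedTri xs ys i j t ⊆ Set.Icc (xs i) (xs (i + 1)) ×ˢ Set.Icc (ys j) (ys (j + 1)) := by
  rintro ⟨u, v⟩ ⟨⟨h1, h2⟩, h3, h4⟩
  simp only at h1 h2 h3 h4
  cases t
  · exact ⟨⟨h3, h4.trans (diag_le hxs hys h1)⟩, h1, h2⟩
  · exact ⟨⟨(le_diag hxs hys h2).trans h3, h4⟩, h1, h2⟩

lemma openTri_subset_cell (i j : ℕ) (t : Bool) :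
    openTri xs ys i j t ⊆ Set.Ioo (xs i) (xs (i + 1)) ×ˢ Set.Ioo (ys j) (ys (j + 1)) := by
  rintro ⟨u, v⟩ ⟨⟨h1, h2⟩, h3, h4⟩
  simp only at h1 h2 h3 h4
  cases t
  · exact ⟨⟨h3, h4.trans_le (diag_le hxs hys h1.le)⟩, h1, h2⟩
  · exact ⟨⟨(le_diag hxs hys h2.le).trans_lt h3, h4⟩, h1, h2⟩

omit hxs in
lemma diag_left (i j : ℕ) : diag xs ys i j (ys j) = xs (i + 1) := by
  have h2 := hys j.lt_succ_self
  simp only [Nat.succ_eq_add_one] at h2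
  rw [diag, div_self (by linarith)]; ring

omit hxs hys in
lemma diag_right (i j : ℕ) : diag xs ys i j (ys (j + 1)) = xs i := by
  simp [diag]

/-- The slanted edge is affine in `y`, so the region between the edges is convex and only the three
vertices need checking. -/
lemma hullTri_subset_closedTri (i j : ℕ) (t : Bool) :
    hullTri xs ys i j t ⊆ closedTri xs ys i j t := by
  have h1 := (hxs i.lt_succ_self).le
  have h2 := (hys j.lt_succ_self).le
  simp only [Nat.succ_eq_add_one] at h1 h2
  have hd := diag_left (xs := xs) hys i j
  have hd' := diag_right (xs := xs) (ys := ys) i j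
  have hL : ∀ u v s : ℝ, 0 ≤ s → s ≤ 1 → diag xs ys i j ((1 - s) * u + s * v)
      = (1 - s) * diag xs ys i j u + s * diag xs ys i j v := by
    intro u v s _ _; unfold diag; ring
  have hconv : Convex ℝ (closedTri xs ys i j t) := by
    rw [convex_iff_forall_pos]
    rintro ⟨u, v⟩ ⟨⟨a1, a2⟩, a3, a4⟩ ⟨u', v'⟩ ⟨⟨b1, b2⟩, b3, b4⟩ s s' hs hs' hss
    simp only at a1 a2 a3 a4 b1 b2 b3 b4
    obtain rfl : s = 1 - s' := by linarith
    have := hL v v' s' hs'.le (by linarith)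
    refine ⟨⟨?_, ?_⟩, ?_, ?_⟩
    · simp; nlinarith
    · simp; nlinarith
    · cases t <;> simp only [leftEdge, Prod.smul_mk, Prod.mk_add_mk, smul_eq_mul, this] at * <;>
        nlinarith
    · cases t <;> simp only [rightEdge, Prod.smul_mk, Prod.mk_add_mk, smul_eq_mul, this] at * <;>
        nlinarith
  cases t
  · refine convexHull_min ?_ hconv
    rintro z (rfl | rfl | rfl) <;>
      simp [closedTri, leftEdge, rightEdge, hd, hd', h1, h2]
  · refine convexHull_min ?_ hconv
    rintro z (rfl | rfl | rfl) <;>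
      simp [closedTri, leftEdge, rightEdge, hd, hd', h1, h2]

/-- The barycentric coordinates are explicit in the normalized cell coordinates; the inequality for
the diagonal is the nonnegativity of the third one. -/
lemma closedTri_subset_hullTri (i j : ℕ) (t : Bool) :
    closedTri xs ys i j t ⊆ hullTri xs ys i j t := by
  have h1 := (hxs i.lt_succ_self)
  have h2 := (hys j.lt_succ_self)
  simp only [Nat.succ_eq_add_one] at h1 h2
  have key : ∀ (s : Set (ℝ × ℝ)) (p q r : ℝ × ℝ), p ∈ s → q ∈ s → r ∈ s → ∀ a b c : ℝ,
      0 ≤ a → 0 ≤ b → 0 ≤ c → a + b + c = 1 → a • p + b • q + c • r ∈ convexHull ℝ s := by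
    intro s p q r hp hq hr a b c ha hb hc habc
    have := (convex_convexHull ℝ s).sum_mem (t := Finset.univ) (w := ![a, b, c])
      (z := ![p, q, r]) (by intro i _; fin_cases i <;> simpa)
      (by simp [Fin.sum_univ_succ]; linarith)
      (by intro i _; fin_cases i <;> simp <;> apply subset_convexHull <;> assumption)
    simpa [Fin.sum_univ_succ, add_assoc] using this
  have e1 : xs (i + 1) - xs i ≠ 0 := by linarith
  have e2 : ys (j + 1) - ys j ≠ 0 := by linarith
  rintro ⟨u, v⟩ ⟨⟨a1, a2⟩, a3, a4⟩
  simp only at a1 a2 a3 a4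
  have hdd : (diag xs ys i j v - xs i) / (xs (i + 1) - xs i)
      = (ys (j + 1) - v) / (ys (j + 1) - ys j) := by
    unfold diag; field_simp; ring
  have hs : (ys (j + 1) - v) / (ys (j + 1) - ys j) = 1 - (v - ys j) / (ys (j + 1) - ys j) := by
    field_simp; ring
  cases t
  · simp only [leftEdge, rightEdge] at a3 a4
    have := key {(xs i, ys j), (xs (i + 1), ys j), (xs i, ys (j + 1))} (xs i, ys j)
      (xs (i + 1), ys j) (xs i, ys (j + 1)) (by simp) (by simp) (by simp)
      (1 - (u - xs i) / (xs (i + 1) - xs i) - (v - ys j) / (ys (j + 1) - ys j))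
      ((u - xs i) / (xs (i + 1) - xs i)) ((v - ys j) / (ys (j + 1) - ys j))
      (by
        have := div_le_div_of_nonneg_right (sub_le_sub_right a4 (xs i)) (sub_nonneg.2 h1.le)
        linarith) (div_nonneg (by linarith) (by linarith))
      (div_nonneg (by linarith) (by linarith)) (by ring)
    simp only [hullTri]
    convert this using 1
    ext <;> simp <;> field_simp <;> ring
  · simp only [leftEdge, rightEdge] at a3 a4
    have hs' : (xs (i + 1) - u) / (xs (i + 1) - xs i) = 1 - (u - xs i) / (xs (i + 1) - xs i) := by
      field_simp; ring
    have := key {(xs i, ys (j + 1)), (xs (i + 1), ys j), (xs (i + 1), ys (j + 1))}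
      (xs i, ys (j + 1)) (xs (i + 1), ys j) (xs (i + 1), ys (j + 1)) (by simp) (by simp) (by simp)
      ((xs (i + 1) - u) / (xs (i + 1) - xs i)) ((ys (j + 1) - v) / (ys (j + 1) - ys j))
      (1 - (xs (i + 1) - u) / (xs (i + 1) - xs i) - (ys (j + 1) - v) / (ys (j + 1) - ys j))
      (div_nonneg (by linarith) (by linarith)) (div_nonneg (by linarith) (by linarith))
      (by
        have := div_le_div_of_nonneg_right (sub_le_sub_right a3 (xs i)) (sub_nonneg.2 h1.le)
        linarith)
      (by ring)
    simp only [hullTri]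
    convert this using 1
    ext <;> simp <;> field_simp <;> ring

lemma hullTri_eq_closedTri (i j : ℕ) (t : Bool) :
    hullTri xs ys i j t = closedTri xs ys i j t :=
  (hullTri_subset_closedTri hxs hys i j t).antisymm (closedTri_subset_hullTri hxs hys i j t)

omit hxs hys in
lemma openTri_subset_closedTri (i j : ℕ) (t : Bool) :
    openTri xs ys i j t ⊆ closedTri xs ys i j t :=
  fun _ hz => ⟨⟨hz.1.1.le, hz.1.2.le⟩, hz.2.1.le, hz.2.2.le⟩

omit hxs hys in
lemma volume_graph_eq_zero {φ : ℝ → ℝ} (hφ : Continuous φ) :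
    volume {z : ℝ × ℝ | z.1 = φ z.2} = 0 := by
  have hm : MeasurableSet {z : ℝ × ℝ | z.1 = φ z.2} :=
    (isClosed_eq continuous_fst (hφ.comp continuous_snd)).measurableSet
  rw [Measure.volume_eq_prod, Measure.prod_apply_symm hm]
  simp

omit hxs hys in
lemma volume_horizontal_eq_zero (a : ℝ) : volume {z : ℝ × ℝ | z.2 = a} = 0 := by
  have hm : MeasurableSet {z : ℝ × ℝ | z.2 = a} :=
    (isClosed_eq continuous_snd continuous_const).measurableSet
  rw [Measure.volume_eq_prod, Measure.prod_apply hm]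
  simp

omit hxs hys in
-- The boundary lies on two graphs over the `y`-axis and two horizontal lines, all null. Elementwise
-- identities, in particular for `deriv`, are therefore needed only on open triangles, where a
-- single formula is in force.
lemma closedTri_ae_eq_openTri (i j : ℕ) (t : Bool) :
    closedTri xs ys i j t =ᵐ[volume] openTri xs ys i j t := by
  have n1 := volume_graph_eq_zero (continuous_leftEdge xs ys i j t)
  have n2 := volume_graph_eq_zero (continuous_rightEdge xs ys i j t)
  have n3 := volume_horizontal_eq_zero (ys j)
  have n4 := volume_horizontal_eq_zero (ys (j + 1))
  refine Filter.EventuallyLE.antisymm ?_ (openTri_subset_closedTri i j t).eventuallyLE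
  rw [ae_le_set]
  refine measure_mono_null ?_
    (measure_union_null (measure_union_null n1 n2) (measure_union_null n3 n4))
  rintro z ⟨⟨⟨h1, h2⟩, h3, h4⟩, hn⟩
  by_contra hc
  simp only [Set.mem_union, Set.mem_ofPred_eq, not_or] at hc
  exact hn ⟨⟨lt_of_le_of_ne h1 (Ne.symm hc.2.1), lt_of_le_of_ne h2 hc.2.2⟩,
    lt_of_le_of_ne h3 (Ne.symm hc.1.1), lt_of_le_of_ne h4 hc.1.2⟩

omit hys in
lemma index_unique {i i' : ℕ} {u : ℝ} (h : xs i < u ∧ u < xs (i + 1))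
    (h' : xs i' ≤ u ∧ u ≤ xs (i' + 1)) : i = i' := by
  have h1 : i < i' + 1 := hxs.lt_iff_lt.1 (h.1.trans_le h'.2)
  have h2 : i' < i + 1 := hxs.lt_iff_lt.1 (h'.1.trans_lt h.2)
  omega

/-- Besides disjointness of the open triangles, this determines the triangle that the arbitrary
choice in `interp` selects at an interior point. -/
lemma openTri_unique {i j i' j' : ℕ} {t t' : Bool} {z : ℝ × ℝ} (hz : z ∈ openTri xs ys i j t)
    (hz' : z ∈ closedTri xs ys i' j' t') : i = i' ∧ j = j' ∧ t = t' := by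
  have c := openTri_subset_cell hxs hys _ _ _ hz
  have c' := closedTri_subset_cell hxs hys _ _ _ hz'
  obtain rfl := index_unique hxs c.1 c'.1
  obtain rfl := index_unique hys c.2 c'.2
  refine ⟨rfl, rfl, ?_⟩
  have a := hz.2
  have a' := hz'.2
  cases t <;> cases t' <;> simp only [leftEdge, rightEdge] at a a' <;> first | rfl | (exfalso; linarith)

omit hxs hys in
lemma exists_index {N : ℕ} {u : ℝ} (h0 : xs 0 < u) (hN : u < xs N) (hne : ∀ i, u ≠ xs i) :
    ∃ i < N, xs i < u ∧ u < xs (i + 1) := by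
  induction N with
  | zero => exact absurd (h0.trans hN) (lt_irrefl _)
  | succ n ih =>
    rcases lt_or_gt_of_ne (hne n) with h | h
    · obtain ⟨i, hi, h'⟩ := ih h
      exact ⟨i, by omega, h'⟩
    · exact ⟨n, by omega, h, hN⟩

/-- The open unit square is the union of the open triangles up to a null set. -/
lemma iUnion_openTri_ae_eq {N : ℕ} (hx0 : xs 0 = 0) (hxN : xs N = 1) (hy0 : ys 0 = 0)
    (hyN : ys N = 1) :
    (⋃ K : Elt N, openTri xs ys K.1 K.2.1 K.2.2) =ᵐ[volume] Omega := by
  refine Filter.EventuallyLE.antisymm ?_ ?_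
  · refine LE.le.eventuallyLE (Set.iUnion_subset ?_)
    rintro ⟨i, j, t⟩ z hz
    obtain ⟨⟨a1, a2⟩, a3, a4⟩ := openTri_subset_cell hxs hys _ _ _ hz
    have b1 : xs 0 ≤ xs i := hxs.monotone (Nat.zero_le _)
    have b2 : xs (i + 1) ≤ xs N := hxs.monotone i.2
    have b3 : ys 0 ≤ ys j := hys.monotone (Nat.zero_le _)
    have b4 : ys (j + 1) ≤ ys N := hys.monotone j.2
    simp only at *
    refine ⟨⟨?_, ?_⟩, ?_, ?_⟩ <;> linarith
  · rw [ae_le_set]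
    have n1 : volume (⋃ i : ℕ, {z : ℝ × ℝ | z.1 = (fun _ => xs i) z.2}) = 0 :=
      measure_iUnion_null fun i => volume_graph_eq_zero continuous_const
    have n2 : volume (⋃ j : ℕ, {z : ℝ × ℝ | z.2 = ys j}) = 0 :=
      measure_iUnion_null fun j => volume_horizontal_eq_zero _
    have n3 : volume (⋃ p : ℕ × ℕ, {z : ℝ × ℝ | z.1 = diag xs ys p.1 p.2 z.2}) = 0 :=
      measure_iUnion_null fun p => volume_graph_eq_zero (continuous_diag _ _ _ _)
    refine measure_mono_null ?_ (measure_union_null (measure_union_null n1 n2) n3)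
    rintro z ⟨⟨⟨a1, a2⟩, a3, a4⟩, hn⟩
    by_contra hc
    simp only [Set.mem_union, Set.mem_iUnion, Set.mem_ofPred_eq, not_or, not_exists] at hc hn
    obtain ⟨⟨c1, c2⟩, c3⟩ := hc
    obtain ⟨i, hi, i1, i2⟩ := exists_index (N := N) (by rwa [hx0]) (by rwa [hxN]) c1
    obtain ⟨j, hj, j1, j2⟩ := exists_index (N := N) (by rwa [hy0]) (by rwa [hyN]) c2
    rcases lt_or_gt_of_ne (c3 (i, j)) with h | h
    · exact hn (⟨i, hi⟩, ⟨j, hj⟩, false) ⟨⟨j1, j2⟩, i1, h⟩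
    · exact hn (⟨i, hi⟩, ⟨j, hj⟩, true) ⟨⟨j1, j2⟩, h, i2⟩

/-- Elementwise decomposition of integrals. -/
lemma setIntegral_Omega_eq_sum {N : ℕ} (hx0 : xs 0 = 0) (hxN : xs N = 1) (hy0 : ys 0 = 0)
    (hyN : ys N = 1) {f : ℝ × ℝ → ℝ} {F : Elt N → ℝ × ℝ → ℝ} (hF : ∀ K, Continuous (F K))
    (hf : ∀ K : Elt N, Set.EqOn f (F K) (openTri xs ys K.1 K.2.1 K.2.2)) :
    ∫ z in Omega, f z = ∑ K : Elt N, ∫ z in openTri xs ys K.1 K.2.1 K.2.2, F K z := by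
  have hm : ∀ K : Elt N, MeasurableSet (openTri xs ys K.1 K.2.1 K.2.2) := fun K =>
    (isOpen_openTri _ _ _ _ _).measurableSet
  rw [← setIntegral_congr_set (iUnion_openTri_ae_eq hxs hys hx0 hxN hy0 hyN),
    integral_iUnion_fintype hm]
  · exact Finset.sum_congr rfl fun K _ => setIntegral_congr_fun (hm K) (hf K)
  · rintro ⟨i, j, t⟩ ⟨i', j', t'⟩ hne
    rw [Function.onFun, Set.disjoint_left]
    intro z hz hz'
    obtain ⟨h1, h2, h3⟩ := openTri_unique hxs hys hz (openTri_subset_closedTri _ _ _ hz')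
    exact hne (Prod.ext (Fin.ext h1) (Prod.ext (Fin.ext h2) h3))
  · intro K
    refine IntegrableOn.congr_fun ?_ (fun z hz => (hf K hz).symm) (hm K)
    refine ((hF K).continuousOn.integrableOn_compact
      (isCompact_Icc.prod isCompact_Icc)).mono_set
      ((openTri_subset_closedTri _ _ _).trans (closedTri_subset_cell hxs hys K.1 K.2.1 K.2.2))

omit hxs hys in
lemma setIntegral_closedTri_eq {i j : ℕ} {t : Bool} {f F : ℝ × ℝ → ℝ}
    (hf : Set.EqOn f F (openTri xs ys i j t)) :
    ∫ z in closedTri xs ys i j t, f z = ∫ z in openTri xs ys i j t, F z := by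
  rw [setIntegral_congr_set (closedTri_ae_eq_openTri i j t)]
  exact setIntegral_congr_fun (isOpen_openTri _ _ _ _ _).measurableSet hf

end Mesh

/-! ### Locality of the partial derivatives -/

lemma dx_congr_of_isOpen {S : Set (ℝ × ℝ)} (hS : IsOpen S) {u v : ℝ × ℝ → ℝ}
    (h : Set.EqOn u v S) : Set.EqOn (dx u) (dx v) S := by
  intro z hz
  refine Filter.EventuallyEq.deriv_eq ?_
  have : Continuous fun t : ℝ => (t, z.2) := by fun_prop
  filter_upwards [(hS.preimage this).mem_nhds (show z.1 ∈ _ from hz)] with t ht using h ht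

lemma dy_congr_of_isOpen {S : Set (ℝ × ℝ)} (hS : IsOpen S) {u v : ℝ × ℝ → ℝ}
    (h : Set.EqOn u v S) : Set.EqOn (dy u) (dy v) S := by
  intro z hz
  refine Filter.EventuallyEq.deriv_eq ?_
  have : Continuous fun t : ℝ => (z.1, t) := by fun_prop
  filter_upwards [(hS.preimage this).mem_nhds (show z.2 ∈ _ from hz)] with t ht using h ht

/-! ### Integration by parts in `x` over the mesh -/

section Slices

variable {xs ys : ℕ → ℝ} (hxs : StrictMono xs) (hys : StrictMono ys)

include hxs hys

lemma leftEdge_le_rightEdge {i j : ℕ} (t : Bool) {y : ℝ} (hy : y ∈ Set.Ioo (ys j) (ys (j + 1))) :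
    leftEdge xs ys i j t y ≤ rightEdge xs ys i j t y := by
  cases t
  · exact le_diag hxs hys hy.2.le
  · exact diag_le hxs hys hy.1.le

lemma integrableOn_openTri {f : ℝ × ℝ → ℝ} (hf : Continuous f) (i j : ℕ) (t : Bool) :
    IntegrableOn f (openTri xs ys i j t) :=
  (hf.continuousOn.integrableOn_compact (isCompact_Icc.prod isCompact_Icc)).mono_set
    ((openTri_subset_closedTri _ _ _).trans (closedTri_subset_cell hxs hys i j t))

lemma setIntegral_openTri_eq_iterated {f : ℝ × ℝ → ℝ} (hf : Continuous f) (i j : ℕ) (t : Bool) :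
    ∫ z in openTri xs ys i j t, f z = ∫ y in Set.Ioo (ys j) (ys (j + 1)),
      ∫ x in Set.Ioo (leftEdge xs ys i j t y) (rightEdge xs ys i j t y), f (x, y) := by
  have hm := (isOpen_openTri xs ys i j t).measurableSet
  have hint := integrableOn_openTri hxs hys hf i j t
  rw [← integral_indicator hm, Measure.volume_eq_prod, integral_prod_symm _
    (by rw [← Measure.volume_eq_prod]; exact (integrable_indicator_iff hm).2 hint),
    ← integral_indicator measurableSet_Ioo]
  congr 1
  ext y
  by_cases hy : y ∈ Set.Ioo (ys j) (ys (j + 1))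
  · rw [Set.indicator_of_mem hy, ← integral_indicator measurableSet_Ioo]
    congr 1
    ext x
    by_cases hx : x ∈ Set.Ioo (leftEdge xs ys i j t y) (rightEdge xs ys i j t y)
    · rw [Set.indicator_of_mem hx, Set.indicator_of_mem]
      exact ⟨hy, hx⟩
    · rw [Set.indicator_of_notMem hx, Set.indicator_of_notMem]
      exact fun h => hx h.2
  · rw [Set.indicator_of_notMem hy]
    have : ∀ x, (openTri xs ys i j t).indicator f (x, y) = 0 := fun x =>
      Set.indicator_of_notMem (fun h => hy h.1) _
    simp [this]

/-- Fubini followed by the fundamental theorem of calculus on horizontal slices; this is why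
triangles are described by left and right edges over `y`. -/
lemma setIntegral_openTri_deriv {Φ Φ' : ℝ × ℝ → ℝ} (hΦ' : Continuous Φ')
    (hd : ∀ x y, HasDerivAt (fun s => Φ (s, y)) (Φ' (x, y)) x) (i j : ℕ) (t : Bool) :
    ∫ z in openTri xs ys i j t, Φ' z = ∫ y in Set.Ioo (ys j) (ys (j + 1)),
      (Φ (rightEdge xs ys i j t y, y) - Φ (leftEdge xs ys i j t y, y)) := by
  rw [setIntegral_openTri_eq_iterated hxs hys hΦ']
  refine setIntegral_congr_fun measurableSet_Ioo fun y hy => ?_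
  have hle := leftEdge_le_rightEdge hxs hys (i := i) t hy
  rw [← integral_Ioc_eq_integral_Ioo, ← intervalIntegral.integral_of_le hle]
  refine intervalIntegral.integral_eq_sub_of_hasDerivAt (fun x _ => hd x y) ?_
  exact Continuous.intervalIntegrable (by fun_prop) _ _

/-- The integral of the elementwise `x`-derivative of a function that is continuous across the
edges and vanishes on the left and on the right boundary is zero. -/
lemma sum_setIntegral_deriv_eq_zero {N : ℕ} {Φ Φ' : ℕ → ℕ → Bool → ℝ × ℝ → ℝ}
    {τ : ℕ → ℕ → ℝ → ℝ} (hΦ : ∀ i j t, Continuous (Φ i j t)) (hΦ' : ∀ i j t, Continuous (Φ' i j t))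
    (hd : ∀ i j t x y, HasDerivAt (fun s => Φ i j t (s, y)) (Φ' i j t (x, y)) x)
    (hdiag : ∀ i < N, ∀ j < N, ∀ y ∈ Set.Ioo (ys j) (ys (j + 1)),
      Φ i j false (diag xs ys i j y, y) = Φ i j true (diag xs ys i j y, y))
    (hleft : ∀ i < N, ∀ j < N, ∀ y ∈ Set.Ioo (ys j) (ys (j + 1)),
      Φ i j false (xs i, y) = τ i j y)
    (hright : ∀ i < N, ∀ j < N, ∀ y ∈ Set.Ioo (ys j) (ys (j + 1)),
      Φ i j true (xs (i + 1), y) = τ (i + 1) j y)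
    (h0 : ∀ j < N, ∀ y ∈ Set.Ioo (ys j) (ys (j + 1)), τ 0 j y = 0)
    (hN : ∀ j < N, ∀ y ∈ Set.Ioo (ys j) (ys (j + 1)), τ N j y = 0) :
    ∑ K : Elt N, ∫ z in openTri xs ys K.1 K.2.1 K.2.2, Φ' K.1 K.2.1 K.2.2 z = 0 := by
  have hint : ∀ {h : ℝ → ℝ} (_ : Continuous h) (j : ℕ),
      IntegrableOn h (Set.Ioo (ys j) (ys (j + 1))) := fun hh j =>
    (hh.continuousOn.integrableOn_compact isCompact_Icc).mono_set Set.Ioo_subset_Icc_self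
  -- In one cell the two contributions of the diagonal cancel, leaving the difference of the traces
  -- on the two vertical sides.
  have key : ∀ j < N, ∀ i < N, (∫ z in openTri xs ys i j true, Φ' i j true z)
      + ∫ z in openTri xs ys i j false, Φ' i j false z
      = (∫ y in Set.Ioo (ys j) (ys (j + 1)), τ (i + 1) j y)
        - ∫ y in Set.Ioo (ys j) (ys (j + 1)), τ i j y := by
    intro j hj i hi
    rw [setIntegral_openTri_deriv hxs hys (hΦ' i j true) (hd i j true),
      setIntegral_openTri_deriv hxs hys (hΦ' i j false) (hd i j false)]
    have hc : ∀ t (φ : ℝ → ℝ), Continuous φ → Continuous fun y => Φ i j t (φ y, y) :=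
      fun t φ hφ => (hΦ i j t).comp (hφ.prodMk continuous_id)
    rw [integral_sub (hint (hc _ _ (continuous_rightEdge xs ys i j true)) j)
        (hint (hc _ _ (continuous_leftEdge xs ys i j true)) j),
      integral_sub (hint (hc _ _ (continuous_rightEdge xs ys i j false)) j)
        (hint (hc _ _ (continuous_leftEdge xs ys i j false)) j)]
    simp only [leftEdge, rightEdge]
    rw [setIntegral_congr_fun measurableSet_Ioo (hright i hi j hj),
      setIntegral_congr_fun measurableSet_Ioo (hleft i hi j hj),
      setIntegral_congr_fun measurableSet_Ioo (hdiag i hi j hj)]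
    ring
  simp only [Fintype.sum_prod_type, Fintype.sum_bool]
  rw [Finset.sum_comm]
  refine Finset.sum_eq_zero fun j _ => ?_
  have key' := Finset.sum_congr (rfl : (Finset.univ : Finset (Fin N)) = _)
    fun i _ => key j j.2 i i.2
  -- Along a row of cells the traces telescope, and the two that remain lie on `x = 0` and `x = 1`.
  rw [key', Fin.sum_univ_eq_sum_range (fun i => (∫ y in Set.Ioo (ys j) (ys (j + 1)), τ (i + 1) j y)
        - ∫ y in Set.Ioo (ys j) (ys (j + 1)), τ i j y) N, Finset.sum_range_sub
        (fun i => ∫ y in Set.Ioo (ys j) (ys (j + 1)), τ i j y),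
    setIntegral_congr_fun measurableSet_Ioo (h0 j j.2),
    setIntegral_congr_fun measurableSet_Ioo (hN j j.2)]
  simp

/-! ### Upper and lower bounds for integrals over one triangle -/

lemma volume_openTri_le (i j : ℕ) (t : Bool) :
    volume.real (openTri xs ys i j t) ≤ (xs (i + 1) - xs i) * (ys (j + 1) - ys j) := by
  have h1 := (hxs i.lt_succ_self).le
  have h2 := (hys j.lt_succ_self).le
  simp only [Nat.succ_eq_add_one] at h1 h2
  have : volume.real (Set.Icc (xs i) (xs (i + 1)) ×ˢ Set.Icc (ys j) (ys (j + 1)))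
      = (xs (i + 1) - xs i) * (ys (j + 1) - ys j) := by
    rw [Measure.volume_eq_prod, measureReal_prod_prod, Real.volume_real_Icc_of_le h1,
      Real.volume_real_Icc_of_le h2]
  rw [← this]
  exact measureReal_mono
    ((openTri_subset_closedTri _ _ _).trans (closedTri_subset_cell hxs hys i j t))
    (isCompact_Icc.prod isCompact_Icc).measure_lt_top.ne

lemma setIntegral_openTri_le {f : ℝ × ℝ → ℝ} {i j : ℕ} {t : Bool} {B : ℝ} (hB : 0 ≤ B)
    (h : ∀ z ∈ Set.Icc (xs i) (xs (i + 1)) ×ˢ Set.Icc (ys j) (ys (j + 1)), |f z| ≤ B) :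
    ∫ z in openTri xs ys i j t, f z
      ≤ (xs (i + 1) - xs i) * (ys (j + 1) - ys j) * B := by
  have hfin : volume (openTri xs ys i j t) < ⊤ :=
    (measure_mono ((openTri_subset_closedTri _ _ _).trans
      (closedTri_subset_cell hxs hys i j t))).trans_lt
      (isCompact_Icc.prod isCompact_Icc).measure_lt_top
  have := norm_setIntegral_le_of_norm_le_const hfin (f := f) (C := B) fun z hz =>
    h z (closedTri_subset_cell hxs hys i j t (openTri_subset_closedTri _ _ _ hz))
  refine (le_abs_self _).trans (this.trans ?_)
  rw [mul_comm]
  exact mul_le_mul_of_nonneg_right (volume_openTri_le hxs hys i j t) hB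

/-- On a part of the triangle of comparable size an affine function is bounded below by its
maximum over the cell. -/
lemma exists_rectangle_affine_large (i j : ℕ) (t : Bool) (p q r : ℝ) :
    ∃ u v : ℝ, Set.Icc u (u + (xs (i + 1) - xs i) / 16) ×ˢ Set.Icc v (v + (ys (j + 1) - ys j) / 16)
        ⊆ openTri xs ys i j t ∧
      ∀ z ∈ Set.Icc u (u + (xs (i + 1) - xs i) / 16) ×ˢ Set.Icc v (v + (ys (j + 1) - ys j) / 16),
        |p + q * xs i + r * ys j| + |q| * (xs (i + 1) - xs i) + |r| * (ys (j + 1) - ys j)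
          ≤ 20 * |p + q * z.1 + r * z.2| := by
  have h1 := (hxs i.lt_succ_self)
  have h2 := (hys j.lt_succ_self)
  simp only [Nat.succ_eq_add_one] at h1 h2
  obtain ⟨h, hh⟩ : ∃ h, h = xs (i + 1) - xs i := ⟨_, rfl⟩
  obtain ⟨k, hk⟩ : ∃ k, k = ys (j + 1) - ys j := ⟨_, rfl⟩
  have hpos : 0 < h := by linarith
  have kpos : 0 < k := by linarith
  have hmem : ∀ θ μ : ℝ, (t = false → 0 < θ ∧ 0 < μ ∧ θ + μ < 1) →
      (t = true → θ < 1 ∧ μ < 1 ∧ 1 < θ + μ) →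
      (xs i + θ * h, ys j + μ * k) ∈ openTri xs ys i j t := by
    intro θ μ hf ht
    have hdg : diag xs ys i j (ys j + μ * k) = xs i + h * (1 - μ) := by
      rw [diag, ← hh, ← hk]
      congr 2
      rw [div_eq_iff kpos.ne', hk]; ring
    cases t
    · obtain ⟨a, b, c⟩ := hf rfl
      refine ⟨⟨?_, ?_⟩, ?_, ?_⟩ <;> simp only [leftEdge, rightEdge, hdg] <;> nlinarith
    · obtain ⟨a, b, c⟩ := ht rfl
      refine ⟨⟨?_, ?_⟩, ?_, ?_⟩ <;> simp only [leftEdge, rightEdge, hdg] <;> nlinarith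
  -- the centre of the square of half size
  obtain ⟨θ₀, hθf, hθt⟩ : ∃ θ₀ : ℝ, (t = false → θ₀ = 1 / 4) ∧ (t = true → θ₀ = 3 / 4) := by
    cases t <;> simp
  have hθ : 1 / 4 ≤ θ₀ ∧ θ₀ ≤ 3 / 4 := by
    cases t <;> simp at hθf hθt <;> norm_num [*]
  obtain ⟨m, hm⟩ : ∃ m, m = p + q * (xs i + θ₀ * h) + r * (ys j + θ₀ * k) := ⟨_, rfl⟩
  -- a direction in which the affine function moves away from zero
  have dir : ∀ s : ℝ, ∃ α : ℝ, (α = 1 / 8 ∨ α = -(3 / 16)) ∧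
      ∀ e ∈ Set.Icc (0 : ℝ) (1 / 16), |s| / 8 ≤ |s * (α + e)| ∧
        (0 ≤ m → 0 ≤ s * (α + e)) ∧ (m < 0 → s * (α + e) ≤ 0) ∧ |α + e| ≤ 3 / 16 := by
    intro s
    -- The test asks whether moving to the right gives the increment the sign of `m`. The two values
    -- of `α` place `α + e` in `[1/8, 3/16]` or in `[-3/16, -1/8]`, so every admissible point moves
    -- by at least 1/8 and stays inside the triangle.
    rcases le_or_gt 0 (if 0 ≤ m then s else -s) with hs | hs
    · refine ⟨1 / 8, Or.inl rfl, fun e he => ?_⟩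
      have h3 : |1 / 8 + e| = 1 / 8 + e := abs_of_nonneg (by linarith [he.1])
      refine ⟨by rw [abs_mul, h3]; nlinarith [abs_nonneg s, he.1], fun hm0 => ?_, fun hm0 => ?_,
        by rw [h3]; linarith [he.2]⟩
      · rw [if_pos hm0] at hs; nlinarith [he.1]
      · rw [if_neg (not_le.2 hm0)] at hs; nlinarith [he.1]
    · refine ⟨-(3 / 16), Or.inr rfl, fun e he => ?_⟩
      have h3 : |-(3 / 16) + e| = 3 / 16 - e := by
        rw [abs_of_nonpos (by linarith [he.2])]; ring
      refine ⟨by rw [abs_mul, h3]; nlinarith [abs_nonneg s, he.2], fun hm0 => ?_, fun hm0 => ?_,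
        by rw [h3]; linarith [he.1]⟩
      · rw [if_pos hm0] at hs; nlinarith [he.2]
      · rw [if_neg (not_le.2 hm0)] at hs; nlinarith [he.2]
  obtain ⟨α, hα, hα'⟩ := dir (q * h)
  obtain ⟨γ, hγ, hγ'⟩ := dir (r * k)
  have main : ∀ z ∈ Set.Icc (xs i + (θ₀ + α) * h) (xs i + (θ₀ + α) * h + h / 16)
      ×ˢ Set.Icc (ys j + (θ₀ + γ) * k) (ys j + (θ₀ + γ) * k + k / 16),
      ∃ e ∈ Set.Icc (0 : ℝ) (1 / 16), ∃ e' ∈ Set.Icc (0 : ℝ) (1 / 16),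
        z = (xs i + (θ₀ + α + e) * h, ys j + (θ₀ + γ + e') * k) := by
    rintro ⟨z1, z2⟩ ⟨⟨a1, a2⟩, a3, a4⟩
    simp only at a1 a2 a3 a4
    refine ⟨(z1 - (xs i + (θ₀ + α) * h)) / h, ⟨div_nonneg (by linarith) hpos.le, ?_⟩,
      (z2 - (ys j + (θ₀ + γ) * k)) / k, ⟨div_nonneg (by linarith) kpos.le, ?_⟩, ?_⟩
    · rw [div_le_iff₀ hpos]; linarith
    · rw [div_le_iff₀ kpos]; linarith
    · ext <;> simp <;> field_simp <;> ring
  rw [← hh, ← hk]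
  refine ⟨xs i + (θ₀ + α) * h, ys j + (θ₀ + γ) * k, ?_, ?_⟩
  · intro z hz
    obtain ⟨e, he, e', he', rfl⟩ := main z hz
    have b1 := abs_le.1 (hα' e he).2.2.2
    have b2 := abs_le.1 (hγ' e' he').2.2.2
    apply hmem
    · intro ht
      have := hθf ht
      refine ⟨?_, ?_, ?_⟩ <;> linarith
    · intro ht
      have := hθt ht
      refine ⟨?_, ?_, ?_⟩ <;> linarith
  · intro z hz
    obtain ⟨e, he, e', he', rfl⟩ := main z hz
    obtain ⟨b1, b2, b3, b4⟩ := hα' e he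
    obtain ⟨c1, c2, c3, c4⟩ := hγ' e' he'
    have e1 : p + q * (xs i + (θ₀ + α + e) * h) + r * (ys j + (θ₀ + γ + e') * k)
        = m + q * h * (α + e) + r * k * (γ + e') := by rw [hm]; ring
    -- Both increments have the sign of the central value `m`, so no cancellation occurs.
    have e2 : |m + q * h * (α + e) + r * k * (γ + e')|
        = |m| + |q * h * (α + e)| + |r * k * (γ + e')| := by
      rcases le_or_gt 0 m with h0 | h0
      · have := b2 h0; have := c2 h0
        rw [abs_of_nonneg h0, abs_of_nonneg (b2 h0), abs_of_nonneg (c2 h0), abs_of_nonneg]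
        linarith
      · have := b3 h0; have := c3 h0
        rw [abs_of_neg h0, abs_of_nonpos (b3 h0), abs_of_nonpos (c3 h0), abs_of_nonpos] <;>
          linarith
    have e3 : |p + q * xs i + r * ys j| ≤ |m| + 3 / 4 * |q * h| + 3 / 4 * |r * k| := by
      have : p + q * xs i + r * ys j = m - θ₀ * (q * h) - θ₀ * (r * k) := by rw [hm]; ring
      rw [this]
      have t1 : |θ₀ * (q * h)| ≤ 3 / 4 * |q * h| := by
        rw [abs_mul, abs_of_nonneg (by linarith : 0 ≤ θ₀)]
        exact mul_le_mul_of_nonneg_right hθ.2 (abs_nonneg _)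
      have t2 : |θ₀ * (r * k)| ≤ 3 / 4 * |r * k| := by
        rw [abs_mul, abs_of_nonneg (by linarith : 0 ≤ θ₀)]
        exact mul_le_mul_of_nonneg_right hθ.2 (abs_nonneg _)
      have t3 := abs_sub (m - θ₀ * (q * h)) (θ₀ * (r * k))
      have t4 := abs_sub m (θ₀ * (q * h))
      linarith
    have e4 : |q| * h = |q * h| := by rw [abs_mul, abs_of_pos hpos]
    have e5 : |r| * k = |r * k| := by rw [abs_mul, abs_of_pos kpos]
    simp only
    rw [e1, e2, e4, e5]
    -- The coefficients on the left are at most `1 + 3/4`, those on the right `20/8`.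
    linarith [abs_nonneg m, abs_nonneg (q * h), abs_nonneg (r * k)]

/-- Lower bound for the integral over a triangle. -/
lemma le_setIntegral_openTri {f : ℝ × ℝ → ℝ} (hf : Continuous f) {i j : ℕ} {t : Bool} {u v m : ℝ}
    (hsub : Set.Icc u (u + (xs (i + 1) - xs i) / 16) ×ˢ Set.Icc v (v + (ys (j + 1) - ys j) / 16)
      ⊆ openTri xs ys i j t)
    (h0 : ∀ z ∈ openTri xs ys i j t, 0 ≤ f z)
    (hm : ∀ z ∈ Set.Icc u (u + (xs (i + 1) - xs i) / 16)
      ×ˢ Set.Icc v (v + (ys (j + 1) - ys j) / 16), m ≤ f z) :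
    (xs (i + 1) - xs i) * (ys (j + 1) - ys j) * (m / 256) ≤ ∫ z in openTri xs ys i j t, f z := by
  have h1 := (hxs i.lt_succ_self).le
  have h2 := (hys j.lt_succ_self).le
  simp only [Nat.succ_eq_add_one] at h1 h2
  set R := Set.Icc u (u + (xs (i + 1) - xs i) / 16) ×ˢ Set.Icc v (v + (ys (j + 1) - ys j) / 16)
    with hR
  have hRm : MeasurableSet R := measurableSet_Icc.prod measurableSet_Icc
  have hcomp : IsCompact R := isCompact_Icc.prod isCompact_Icc
  have hvol : volume.real R = (xs (i + 1) - xs i) / 16 * ((ys (j + 1) - ys j) / 16) := by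
    rw [hR, Measure.volume_eq_prod, measureReal_prod_prod, Real.volume_real_Icc_of_le (by linarith),
      Real.volume_real_Icc_of_le (by linarith)]
    ring
  have a1 : ∫ z in R, f z ≤ ∫ z in openTri xs ys i j t, f z :=
    setIntegral_mono_set (integrableOn_openTri hxs hys hf i j t)
      ((ae_restrict_iff' (isOpen_openTri _ _ _ _ _).measurableSet).2 (Filter.Eventually.of_forall h0))
      hsub.eventuallyLE
  have a2 : ∫ _ in R, m ≤ ∫ z in R, f z :=
    setIntegral_mono_on (integrableOn_const hcomp.measure_lt_top.ne)
      (hf.continuousOn.integrableOn_compact hcomp) hRm hm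
  rw [setIntegral_const, hvol, smul_eq_mul] at a2
  calc _ = (xs (i + 1) - xs i) / 16 * ((ys (j + 1) - ys j) / 16) * m := by ring
    _ ≤ _ := a2.trans a1

end Slices

/-! ### The factors of the inverse weight -/

/-- The factor of `ω⁻¹` that depends on `x`. -/
def wP (a σ x : ℝ) : ℝ := (1 + Real.exp ((x - a) / σ)) / 2

/-- The derivative of `wP`. -/
def wP1 (a σ x : ℝ) : ℝ := Real.exp ((x - a) / σ) / (2 * σ)

/-- The factor of `ω⁻¹` that depends on `y`. -/
def wQ (a σ y : ℝ) : ℝ := (2 + Real.exp ((y - a) / σ) + Real.exp (-((y - a) / σ))) / 4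

/-- The derivative of `wQ`. -/
def wQ1 (a σ y : ℝ) : ℝ := (Real.exp ((y - a) / σ) - Real.exp (-((y - a) / σ))) / (4 * σ)

/-- The second derivative of `wQ`. -/
def wQ2 (a σ y : ℝ) : ℝ := (Real.exp ((y - a) / σ) + Real.exp (-((y - a) / σ))) / (4 * σ ^ 2)

@[fun_prop] lemma continuous_wP (a σ : ℝ) : Continuous (wP a σ) := by unfold wP; fun_prop
@[fun_prop] lemma continuous_wP1 (a σ : ℝ) : Continuous (wP1 a σ) := by unfold wP1; fun_prop
@[fun_prop] lemma continuous_wQ (a σ : ℝ) : Continuous (wQ a σ) := by unfold wQ; fun_prop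
@[fun_prop] lemma continuous_wQ1 (a σ : ℝ) : Continuous (wQ1 a σ) := by unfold wQ1; fun_prop
@[fun_prop] lemma continuous_wQ2 (a σ : ℝ) : Continuous (wQ2 a σ) := by unfold wQ2; fun_prop

lemma hasDerivAt_exp_shift (a σ x : ℝ) : HasDerivAt (fun x => Real.exp ((x - a) / σ))
    (Real.exp ((x - a) / σ) * (1 / σ)) x :=
  (((hasDerivAt_id x).sub_const a).div_const σ).exp

lemma hasDerivAt_exp_neg_shift (a σ x : ℝ) : HasDerivAt (fun x => Real.exp (-((x - a) / σ)))
    (Real.exp (-((x - a) / σ)) * (-(1 / σ))) x :=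
  (((hasDerivAt_id x).sub_const a).div_const σ).neg.exp

lemma hasDerivAt_wP (a σ x : ℝ) : HasDerivAt (wP a σ) (wP1 a σ x) x := by
  refine HasDerivAt.congr_deriv (((hasDerivAt_exp_shift a σ x).const_add 1).div_const 2) ?_
  rw [wP1]; ring

/-- Only the exponential survives differentiation, so higher `x`-derivatives of the weight remain
multiples of `wP1`, the density that the norm controls. -/
lemma hasDerivAt_wP1 (a σ x : ℝ) : HasDerivAt (wP1 a σ) (wP1 a σ x * σ⁻¹) x := by
  refine HasDerivAt.congr_deriv ((hasDerivAt_exp_shift a σ x).div_const (2 * σ)) ?_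
  rw [wP1]; ring

lemma hasDerivAt_wQ (a σ y : ℝ) : HasDerivAt (wQ a σ) (wQ1 a σ y) y := by
  refine HasDerivAt.congr_deriv ((((hasDerivAt_exp_shift a σ y).const_add 2).add
    (hasDerivAt_exp_neg_shift a σ y)).div_const 4) ?_
  rw [wQ1]; ring

lemma hasDerivAt_wQ1 (a σ y : ℝ) : HasDerivAt (wQ1 a σ) (wQ2 a σ y) y := by
  refine HasDerivAt.congr_deriv (((hasDerivAt_exp_shift a σ y).sub
    (hasDerivAt_exp_neg_shift a σ y)).div_const (4 * σ)) ?_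
  rw [wQ2]; ring

/-! ### Sizes of the weight factors and their variation over one scale -/

section Positivity

variable {σ : ℝ} (hσ : 0 < σ)

lemma wP_pos (a σ x : ℝ) : 0 < wP a σ x := by unfold wP; positivity

lemma wQ_pos (a σ y : ℝ) : 0 < wQ a σ y := by unfold wQ; positivity

include hσ

lemma wP1_pos (a x : ℝ) : 0 < wP1 a σ x := by unfold wP1; positivity

lemma wQ2_pos (a y : ℝ) : 0 < wQ2 a σ y := by unfold wQ2; positivity

/-- The constant term in `wP` is dropped. No converse holds: far to the left of `a` the derivative
decays exponentially while `wP` stays above 1/2. Hence `W` and `V` must be tracked separately. -/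
lemma wP1_le (a x : ℝ) : wP1 a σ x ≤ wP a σ x * σ⁻¹ := by
  unfold wP1 wP
  have : Real.exp ((x - a) / σ) / (2 * σ) = Real.exp ((x - a) / σ) / 2 * σ⁻¹ := by
    field_simp
  rw [this]
  gcongr; linarith

lemma abs_wQ1_le (a y : ℝ) : |wQ1 a σ y| ≤ wQ a σ y * σ⁻¹ := by
  have h : wQ1 a σ y
      = (Real.exp ((y - a) / σ) - Real.exp (-((y - a) / σ))) / 4 * σ⁻¹ := by
    unfold wQ1; field_simp
  have h1 := Real.exp_pos ((y - a) / σ)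
  have h2 := Real.exp_pos (-((y - a) / σ))
  rw [h, abs_mul, abs_of_pos (inv_pos.2 hσ)]
  refine mul_le_mul_of_nonneg_right ?_ (inv_pos.2 hσ).le
  unfold wQ
  rw [abs_le]; constructor <;> linarith

lemma wQ2_le (a y : ℝ) : wQ2 a σ y ≤ wQ a σ y * σ⁻¹ * σ⁻¹ := by
  have h : wQ2 a σ y
      = (Real.exp ((y - a) / σ) + Real.exp (-((y - a) / σ))) / 4 * σ⁻¹ * σ⁻¹ := by
    unfold wQ2; field_simp
  rw [h]
  unfold wQ
  gcongr; linarith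

/-- A shift by at most `σ` changes the exponent by at most 1, and `e ≤ 3`. This makes all weight
factors comparable on a cell. -/
lemma exp_shift_le {a x x' : ℝ} (h : |x - x'| ≤ σ) :
    Real.exp ((x - a) / σ) ≤ 3 * Real.exp ((x' - a) / σ) ∧
    Real.exp (-((x - a) / σ)) ≤ 3 * Real.exp (-((x' - a) / σ)) := by
  have h3 : Real.exp 1 ≤ 3 := by linarith [Real.exp_one_lt_d9]
  have hle := abs_le.1 h
  have e1 : (x - a) / σ ≤ 1 + (x' - a) / σ := by
    rw [add_comm, div_add' _ _ _ hσ.ne', div_le_div_iff_of_pos_right hσ]; linarith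
  have e2 : -((x - a) / σ) ≤ 1 + -((x' - a) / σ) := by
    have : (x' - a) / σ ≤ 1 + (x - a) / σ := by
      rw [add_comm, div_add' _ _ _ hσ.ne', div_le_div_iff_of_pos_right hσ]; linarith
    linarith
  constructor
  · refine (Real.exp_le_exp.2 e1).trans ?_
    rw [Real.exp_add]
    exact mul_le_mul_of_nonneg_right h3 (Real.exp_pos _).le
  · refine (Real.exp_le_exp.2 e2).trans ?_
    rw [Real.exp_add]
    exact mul_le_mul_of_nonneg_right h3 (Real.exp_pos _).le

lemma wP_le_three_mul {a x x' : ℝ} (h : |x - x'| ≤ σ) : wP a σ x ≤ 3 * wP a σ x' := by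
  have := (exp_shift_le hσ (a := a) h).1
  unfold wP; linarith

lemma wP1_le_three_mul {a x x' : ℝ} (h : |x - x'| ≤ σ) : wP1 a σ x ≤ 3 * wP1 a σ x' := by
  have := (exp_shift_le hσ (a := a) h).1
  unfold wP1
  rw [← mul_div_assoc]
  gcongr

lemma wQ_le_three_mul {a y y' : ℝ} (h : |y - y'| ≤ σ) : wQ a σ y ≤ 3 * wQ a σ y' := by
  have := exp_shift_le hσ (a := a) h
  unfold wQ; linarith [this.1, this.2]

end Positivity

lemma abs_sub_le_of_hasDerivAt {f f' : ℝ → ℝ} (hf : ∀ x, HasDerivAt f (f' x) x) {a b B u v : ℝ}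
    (hB : ∀ x ∈ Set.Icc a b, |f' x| ≤ B) (hu : u ∈ Set.Icc a b) (hv : v ∈ Set.Icc a b) :
    |f u - f v| ≤ (b - a) * B := by
  have h := (convex_Icc a b).norm_image_sub_le_of_norm_hasDerivWithin_le
    (fun x _ => (hf x).hasDerivWithinAt) hB hv hu
  simp only [Real.norm_eq_abs] at h
  have : |u - v| ≤ b - a := by
    rw [abs_le]; constructor <;> linarith [hu.1, hu.2, hv.1, hv.2]
  have hB0 : 0 ≤ B := (abs_nonneg _).trans (hB u hu)
  nlinarith

lemma abs_mul_le_mul {a b A B : ℝ} (ha : |a| ≤ A) (hb : |b| ≤ B) : |a * b| ≤ A * B := by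
  rw [abs_mul]
  exact mul_le_mul ha hb (abs_nonneg _) ((abs_nonneg _).trans ha)

/-! ### The interpolation error on a cell -/

section Cell

variable (xa σx ya σy p q r : ℝ)

/-- The product of the inverse weight and an affine function. -/
def wG (z : ℝ × ℝ) : ℝ := wP xa σx z.1 * wQ ya σy z.2 * (p + q * z.1 + r * z.2)

/-- The `x`-derivative of `wG`. -/
def wGx (z : ℝ × ℝ) : ℝ :=
  wP1 xa σx z.1 * wQ ya σy z.2 * (p + q * z.1 + r * z.2) + wP xa σx z.1 * wQ ya σy z.2 * q

/-- The `y`-derivative of `wG`. -/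
def wGy (z : ℝ × ℝ) : ℝ :=
  wP xa σx z.1 * wQ1 ya σy z.2 * (p + q * z.1 + r * z.2) + wP xa σx z.1 * wQ ya σy z.2 * r

/-- The Laplacian of `wG`. -/
def wGlap (z : ℝ × ℝ) : ℝ :=
  (wP1 xa σx z.1 * σx⁻¹ * wQ ya σy z.2 + wP xa σx z.1 * wQ2 ya σy z.2) * (p + q * z.1 + r * z.2)
    + 2 * (wP1 xa σx z.1 * wQ ya σy z.2 * q) + 2 * (wP xa σx z.1 * wQ1 ya σy z.2 * r)

@[fun_prop] lemma continuous_wG : Continuous (wG xa σx ya σy p q r) := by unfold wG; fun_prop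
@[fun_prop] lemma continuous_wGx : Continuous (wGx xa σx ya σy p q r) := by unfold wGx; fun_prop
@[fun_prop] lemma continuous_wGy : Continuous (wGy xa σx ya σy p q r) := by unfold wGy; fun_prop
@[fun_prop] lemma continuous_wGlap : Continuous (wGlap xa σx ya σy p q r) := by
  unfold wGlap; fun_prop

lemma hasDerivAt_affine_fst (x y : ℝ) : HasDerivAt (fun s => p + q * s + r * y) q x := by
  simpa using (((hasDerivAt_id x).const_mul q).const_add p).add_const (r * y)

lemma hasDerivAt_affine_snd (x y : ℝ) : HasDerivAt (fun s => p + q * x + r * s) r y := by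
  simpa using (((hasDerivAt_id y).const_mul r).const_add (p + q * x))

lemma hasDerivAt_wG_fst (x y : ℝ) :
    HasDerivAt (fun s => wG xa σx ya σy p q r (s, y)) (wGx xa σx ya σy p q r (x, y)) x := by
  exact ((hasDerivAt_wP xa σx x).mul_const (wQ ya σy y)).mul (hasDerivAt_affine_fst p q r x y)

lemma hasDerivAt_wG_snd (x y : ℝ) :
    HasDerivAt (fun s => wG xa σx ya σy p q r (x, s)) (wGy xa σx ya σy p q r (x, y)) y := by
  exact ((hasDerivAt_wQ ya σy y).const_mul (wP xa σx x)).mul (hasDerivAt_affine_snd p q r x y)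

lemma hasDerivAt_wGx_fst (x y : ℝ) :
    HasDerivAt (fun s => wGx xa σx ya σy p q r (s, y))
      (wP1 xa σx x * σx⁻¹ * wQ ya σy y * (p + q * x + r * y)
        + 2 * (wP1 xa σx x * wQ ya σy y * q)) x := by
  refine HasDerivAt.congr_deriv ((((hasDerivAt_wP1 xa σx x).mul_const (wQ ya σy y)).mul
    (hasDerivAt_affine_fst p q r x y)).add
      (((hasDerivAt_wP xa σx x).mul_const (wQ ya σy y)).mul_const q)) ?_
  ring

lemma hasDerivAt_wGy_snd (x y : ℝ) :
    HasDerivAt (fun s => wGy xa σx ya σy p q r (x, s))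
      (wP xa σx x * wQ2 ya σy y * (p + q * x + r * y)
        + 2 * (wP xa σx x * wQ1 ya σy y * r)) y := by
  refine HasDerivAt.congr_deriv ((((hasDerivAt_wQ1 ya σy y).const_mul (wP xa σx x)).mul
    (hasDerivAt_affine_snd p q r x y)).add
      (((hasDerivAt_wQ ya σy y).const_mul (wP xa σx x)).mul_const r)) ?_
  ring

/-- Bound for the `x`-derivative of the interpolation error. -/
def bX (hx hy ux uy W V g q r : ℝ) : ℝ :=
  9 * V * (hx * ux + hy * uy) * g + 9 * V * (hx * q + hy * r) + 9 * q * (hx * V + hy * uy * W)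

/-- Bound for the `y`-derivative of the interpolation error. -/
def bY (hx hy uy W V g q r : ℝ) : ℝ :=
  9 * (hx * V + hy * uy * W) * uy * g + 9 * (W * uy) * (hx * q + hy * r)
    + 9 * r * (hx * V + hy * uy * W)

/-- Bound for the Laplacian of the interpolation error. -/
def bL (ux uy W V g q r : ℝ) : ℝ :=
  9 * (V * ux + W * uy * uy) * g + 18 * V * q + 18 * (W * uy) * r

variable {xa σx ya σy p q r} {x0 x1 y0 y1 : ℝ}

lemma cell_weight_bounds (hσx : 0 < σx) (hσy : 0 < σy) (hx : x1 - x0 ≤ σx) (hy : y1 - y0 ≤ σy)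
    {x y : ℝ} (hxm : x ∈ Set.Icc x0 x1) (hym : y ∈ Set.Icc y0 y1) :
    (wP xa σx x ≤ 3 * wP xa σx x0 ∧ wP xa σx x0 ≤ 3 * wP xa σx x) ∧
    (wP1 xa σx x ≤ 3 * wP1 xa σx x0 ∧ wP1 xa σx x0 ≤ 3 * wP1 xa σx x) ∧
    (wQ ya σy y ≤ 3 * wQ ya σy y0 ∧ wQ ya σy y0 ≤ 3 * wQ ya σy y) := by
  have h1 : |x - x0| ≤ σx := by rw [abs_le]; constructor <;> linarith [hxm.1, hxm.2]
  have h2 : |y - y0| ≤ σy := by rw [abs_le]; constructor <;> linarith [hym.1, hym.2]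
  have h1' : |x0 - x| ≤ σx := by rwa [abs_sub_comm]
  have h2' : |y0 - y| ≤ σy := by rwa [abs_sub_comm]
  exact ⟨⟨wP_le_three_mul hσx h1, wP_le_three_mul hσx h1'⟩,
    ⟨wP1_le_three_mul hσx h1, wP1_le_three_mul hσx h1'⟩,
    wQ_le_three_mul hσy h2, wQ_le_three_mul hσy h2'⟩

lemma cell_affine_bound {x y : ℝ} (hxm : x ∈ Set.Icc x0 x1) (hym : y ∈ Set.Icc y0 y1) :
    |p + q * x + r * y|
      ≤ |p + q * x0 + r * y0| + |q| * (x1 - x0) + |r| * (y1 - y0) := by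
  have h1 : |q * (x - x0)| ≤ |q| * (x1 - x0) :=
    abs_mul_le_mul le_rfl (by rw [abs_of_nonneg] <;> linarith [hxm.1, hxm.2])
  have h2 : |r * (y - y0)| ≤ |r| * (y1 - y0) :=
    abs_mul_le_mul le_rfl (by rw [abs_of_nonneg] <;> linarith [hym.1, hym.2])
  have e : p + q * x + r * y = (p + q * x0 + r * y0) + q * (x - x0) + r * (y - y0) := by ring
  rw [e]
  refine (abs_add_three _ _ _).trans ?_
  linarith

lemma cell_lipschitz_bounds (hσx : 0 < σx) (hσy : 0 < σy) (hx : x1 - x0 ≤ σx)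
    (hy : y1 - y0 ≤ σy) {x x' y y' : ℝ} (hxm : x ∈ Set.Icc x0 x1) (hxm' : x' ∈ Set.Icc x0 x1)
    (hym : y ∈ Set.Icc y0 y1) (hym' : y' ∈ Set.Icc y0 y1) :
    |wP xa σx x - wP xa σx x'| ≤ (x1 - x0) * (3 * wP1 xa σx x0) ∧
    |wP1 xa σx x - wP1 xa σx x'| ≤ (x1 - x0) * (3 * wP1 xa σx x0 * σx⁻¹) ∧
    |wQ ya σy y - wQ ya σy y'| ≤ (y1 - y0) * (3 * wQ ya σy y0 * σy⁻¹) ∧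
    |wQ1 ya σy y - wQ1 ya σy y'| ≤ (y1 - y0) * (3 * wQ ya σy y0 * σy⁻¹ * σy⁻¹) := by
  have ux := inv_pos.2 hσx
  have uy := inv_pos.2 hσy
  have B := fun s hs t ht => cell_weight_bounds (xa := xa) (ya := ya) hσx hσy hx hy
    (x := s) (y := t) hs ht
  refine ⟨abs_sub_le_of_hasDerivAt (hasDerivAt_wP xa σx) (fun s hs => ?_) hxm hxm',
    abs_sub_le_of_hasDerivAt (hasDerivAt_wP1 xa σx) (fun s hs => ?_) hxm hxm',
    abs_sub_le_of_hasDerivAt (hasDerivAt_wQ ya σy) (fun s hs => ?_) hym hym',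
    abs_sub_le_of_hasDerivAt (hasDerivAt_wQ1 ya σy) (fun s hs => ?_) hym hym'⟩
  · rw [abs_of_pos (wP1_pos hσx _ _)]
    exact (B s hs y hym).2.1.1
  · rw [abs_of_pos (mul_pos (wP1_pos hσx _ _) ux)]
    exact mul_le_mul_of_nonneg_right (B s hs y hym).2.1.1 ux.le
  · exact (abs_wQ1_le hσy _ _).trans (mul_le_mul_of_nonneg_right (B x hxm s hs).2.2.1 uy.le)
  · rw [abs_of_pos (wQ2_pos hσy _ _)]
    exact (wQ2_le hσy _ _).trans (mul_le_mul_of_nonneg_right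
      (mul_le_mul_of_nonneg_right (B x hxm s hs).2.2.1 uy.le) uy.le)

/-- By the mean value theorem the slope of the interpolant is the `x`-derivative at some `(ξ, b)`,
so the error is an oscillation of `wGx` over the cell. Weights are replaced by three times their
vertex values, whence the factors 9; the affine factor varies only through `q` and `r`. -/
lemma abs_slope_sub_wGx_le (hσx : 0 < σx) (hσy : 0 < σy) (hx0 : x0 < x1)
    (hx : x1 - x0 ≤ σx) (hy : y1 - y0 ≤ σy) {x y b : ℝ} (hxm : x ∈ Set.Icc x0 x1)
    (hym : y ∈ Set.Icc y0 y1) (hb : b ∈ Set.Icc y0 y1) :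
    |(wG xa σx ya σy p q r (x1, b) - wG xa σx ya σy p q r (x0, b)) / (x1 - x0)
        - wGx xa σx ya σy p q r (x, y)|
      ≤ bX (x1 - x0) (y1 - y0) σx⁻¹ σy⁻¹ (wP xa σx x0 * wQ ya σy y0) (wP1 xa σx x0 * wQ ya σy y0)
        (|p + q * x0 + r * y0| + |q| * (x1 - x0) + |r| * (y1 - y0)) |q| |r| := by
  obtain ⟨ξ, hξ, hξ'⟩ := exists_hasDerivAt_eq_slope
    (fun s => wG xa σx ya σy p q r (s, b)) (fun s => wGx xa σx ya σy p q r (s, b)) hx0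
    (by fun_prop) (fun s _ => hasDerivAt_wG_fst xa σx ya σy p q r s b)
  rw [← hξ']
  replace hξ : ξ ∈ Set.Icc x0 x1 := ⟨hξ.1.le, hξ.2.le⟩
  obtain ⟨l1, l2, l3, l4⟩ := cell_lipschitz_bounds (xa := xa) (ya := ya) hσx hσy hx hy hξ hxm hb hym
  obtain ⟨⟨B1, -⟩, ⟨B2, -⟩, B3, -⟩ := cell_weight_bounds (xa := xa) (ya := ya) hσx hσy hx hy hxm hym
  obtain ⟨-, -, B3', -⟩ := cell_weight_bounds (xa := xa) (ya := ya) hσx hσy hx hy hxm hb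
  have hg := cell_affine_bound (p := p) (q := q) (r := r) hξ hb
  set gg := |p + q * x0 + r * y0| + |q| * (x1 - x0) + |r| * (y1 - y0)
  have A1 : |wP xa σx x| ≤ 3 * wP xa σx x0 := by rwa [abs_of_pos (wP_pos _ _ _)]
  have A2 : |wP1 xa σx x| ≤ 3 * wP1 xa σx x0 := by rwa [abs_of_pos (wP1_pos hσx _ _)]
  have A3 : |wQ ya σy y| ≤ 3 * wQ ya σy y0 := by rwa [abs_of_pos (wQ_pos _ _ _)]
  have A4 : |wQ ya σy b| ≤ 3 * wQ ya σy y0 := by rwa [abs_of_pos (wQ_pos _ _ _)]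
  have A5 : |ξ - x| ≤ x1 - x0 := by
    rw [abs_le]; constructor <;> linarith [hξ.1, hξ.2, hxm.1, hxm.2]
  have A6 : |b - y| ≤ y1 - y0 := by
    rw [abs_le]; constructor <;> linarith [hb.1, hb.2, hym.1, hym.2]
  have T1 := abs_mul_le_mul (abs_mul_le_mul l2 A4) hg
  have T2 := abs_mul_le_mul (abs_mul_le_mul A2 l3) hg
  have T3 : |wP1 xa σx x * wQ ya σy y * (q * (ξ - x) + r * (b - y))| ≤ _ :=
    abs_mul_le_mul (abs_mul_le_mul A2 A3) ((abs_add_le _ _).trans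
      (add_le_add (abs_mul_le_mul le_rfl A5) (abs_mul_le_mul le_rfl A6)))
  have T4 := abs_mul_le_mul (abs_mul_le_mul l1 A4) (le_refl |q|)
  have T5 := abs_mul_le_mul (abs_mul_le_mul A1 l3) (le_refl |q|)
  -- The difference of products is telescoped, changing one factor at a time.
  have e : wGx xa σx ya σy p q r (ξ, b) - wGx xa σx ya σy p q r (x, y)
      = (wP1 xa σx ξ - wP1 xa σx x) * wQ ya σy b * (p + q * ξ + r * b)
        + wP1 xa σx x * (wQ ya σy b - wQ ya σy y) * (p + q * ξ + r * b)
        + wP1 xa σx x * wQ ya σy y * (q * (ξ - x) + r * (b - y))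
        + (wP xa σx ξ - wP xa σx x) * wQ ya σy b * q
        + wP xa σx x * (wQ ya σy b - wQ ya σy y) * q := by
    simp only [wGx]; ring
  rw [e]
  refine (abs_add_le _ _).trans ((add_le_add ((abs_add_le _ _).trans
    (add_le_add ((abs_add_three _ _ _).trans (add_le_add (add_le_add T1 T2) T3)) T4)) T5).trans
    (le_of_eq ?_))
  rw [bX]; ring

/-- The same argument in `y`. As `wQ1` has no sign, it is bounded by `wQ/σ_y`; variation of the
weight in `x` still yields the better quantity `V`. -/
lemma abs_slope_sub_wGy_le (hσx : 0 < σx) (hσy : 0 < σy) (hy0 : y0 < y1)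
    (hx : x1 - x0 ≤ σx) (hy : y1 - y0 ≤ σy) {x y a : ℝ} (hxm : x ∈ Set.Icc x0 x1)
    (hym : y ∈ Set.Icc y0 y1) (ha : a ∈ Set.Icc x0 x1) :
    |(wG xa σx ya σy p q r (a, y1) - wG xa σx ya σy p q r (a, y0)) / (y1 - y0)
        - wGy xa σx ya σy p q r (x, y)|
      ≤ bY (x1 - x0) (y1 - y0) σy⁻¹ (wP xa σx x0 * wQ ya σy y0) (wP1 xa σx x0 * wQ ya σy y0)
        (|p + q * x0 + r * y0| + |q| * (x1 - x0) + |r| * (y1 - y0)) |q| |r| := by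
  obtain ⟨ξ, hξ, hξ'⟩ := exists_hasDerivAt_eq_slope
    (fun s => wG xa σx ya σy p q r (a, s)) (fun s => wGy xa σx ya σy p q r (a, s)) hy0
    (by fun_prop) (fun s _ => hasDerivAt_wG_snd xa σx ya σy p q r a s)
  rw [← hξ']
  replace hξ : ξ ∈ Set.Icc y0 y1 := ⟨hξ.1.le, hξ.2.le⟩
  obtain ⟨l1, l2, l3, l4⟩ := cell_lipschitz_bounds (xa := xa) (ya := ya) hσx hσy hx hy ha hxm hξ hym
  obtain ⟨⟨B1, -⟩, ⟨B2, -⟩, B3, -⟩ := cell_weight_bounds (xa := xa) (ya := ya) hσx hσy hx hy hxm hym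
  obtain ⟨⟨B1', -⟩, -, B3', -⟩ := cell_weight_bounds (xa := xa) (ya := ya) hσx hσy hx hy ha hξ
  have uy := inv_pos.2 hσy
  have hg := cell_affine_bound (p := p) (q := q) (r := r) ha hξ
  set gg := |p + q * x0 + r * y0| + |q| * (x1 - x0) + |r| * (y1 - y0)
  have A1 : |wP xa σx x| ≤ 3 * wP xa σx x0 := by rwa [abs_of_pos (wP_pos _ _ _)]
  have A3 : |wQ1 ya σy y| ≤ 3 * wQ ya σy y0 * σy⁻¹ :=
    (abs_wQ1_le hσy _ _).trans (mul_le_mul_of_nonneg_right B3 uy.le)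
  have A3' : |wQ1 ya σy ξ| ≤ 3 * wQ ya σy y0 * σy⁻¹ :=
    (abs_wQ1_le hσy _ _).trans (mul_le_mul_of_nonneg_right B3' uy.le)
  have A4 : |wQ ya σy ξ| ≤ 3 * wQ ya σy y0 := by rwa [abs_of_pos (wQ_pos _ _ _)]
  have A5 : |a - x| ≤ x1 - x0 := by
    rw [abs_le]; constructor <;> linarith [ha.1, ha.2, hxm.1, hxm.2]
  have A6 : |ξ - y| ≤ y1 - y0 := by
    rw [abs_le]; constructor <;> linarith [hξ.1, hξ.2, hym.1, hym.2]
  have T1 := abs_mul_le_mul (abs_mul_le_mul l1 A3') hg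
  have T2 := abs_mul_le_mul (abs_mul_le_mul A1 l4) hg
  have T3 : |wP xa σx x * wQ1 ya σy y * (q * (a - x) + r * (ξ - y))| ≤ _ :=
    abs_mul_le_mul (abs_mul_le_mul A1 A3) ((abs_add_le _ _).trans
      (add_le_add (abs_mul_le_mul le_rfl A5) (abs_mul_le_mul le_rfl A6)))
  have T4 := abs_mul_le_mul (abs_mul_le_mul l1 A4) (le_refl |r|)
  have T5 := abs_mul_le_mul (abs_mul_le_mul A1 l3) (le_refl |r|)
  have e : wGy xa σx ya σy p q r (a, ξ) - wGy xa σx ya σy p q r (x, y)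
      = (wP xa σx a - wP xa σx x) * wQ1 ya σy ξ * (p + q * a + r * ξ)
        + wP xa σx x * (wQ1 ya σy ξ - wQ1 ya σy y) * (p + q * a + r * ξ)
        + wP xa σx x * wQ1 ya σy y * (q * (a - x) + r * (ξ - y))
        + (wP xa σx a - wP xa σx x) * wQ ya σy ξ * r
        + wP xa σx x * (wQ ya σy ξ - wQ ya σy y) * r := by
    simp only [wGy]; ring
  rw [e]
  refine (abs_add_le _ _).trans ((add_le_add ((abs_add_le _ _).trans
    (add_le_add ((abs_add_three _ _ _).trans (add_le_add (add_le_add T1 T2) T3)) T4)) T5).trans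
    (le_of_eq ?_))
  rw [bY]; ring

/-- The interpolant is affine, so up to sign this is the Laplacian of the error. Each of its terms
carries a derivative of the weight because `G` is affine. -/
lemma abs_wGlap_le (hσx : 0 < σx) (hσy : 0 < σy)
    (hx : x1 - x0 ≤ σx) (hy : y1 - y0 ≤ σy) {x y : ℝ} (hxm : x ∈ Set.Icc x0 x1)
    (hym : y ∈ Set.Icc y0 y1) :
    |wGlap xa σx ya σy p q r (x, y)|
      ≤ bL σx⁻¹ σy⁻¹ (wP xa σx x0 * wQ ya σy y0) (wP1 xa σx x0 * wQ ya σy y0)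
        (|p + q * x0 + r * y0| + |q| * (x1 - x0) + |r| * (y1 - y0)) |q| |r| := by
  obtain ⟨⟨B1, -⟩, ⟨B2, -⟩, B3, -⟩ := cell_weight_bounds (xa := xa) (ya := ya) hσx hσy hx hy hxm hym
  have uy := inv_pos.2 hσy
  have ux := inv_pos.2 hσx
  have hg := cell_affine_bound (p := p) (q := q) (r := r) hxm hym
  set gg := |p + q * x0 + r * y0| + |q| * (x1 - x0) + |r| * (y1 - y0)
  have A1 : |wP xa σx x| ≤ 3 * wP xa σx x0 := by rwa [abs_of_pos (wP_pos _ _ _)]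
  have A2 : |wP1 xa σx x| ≤ 3 * wP1 xa σx x0 := by rwa [abs_of_pos (wP1_pos hσx _ _)]
  have A2' : |σx⁻¹| ≤ σx⁻¹ := by rw [abs_of_pos ux]
  have A3 : |wQ1 ya σy y| ≤ 3 * wQ ya σy y0 * σy⁻¹ :=
    (abs_wQ1_le hσy _ _).trans (mul_le_mul_of_nonneg_right B3 uy.le)
  have A3' : |wQ2 ya σy y| ≤ 3 * wQ ya σy y0 * σy⁻¹ * σy⁻¹ := by
    rw [abs_of_pos (wQ2_pos hσy _ _)]
    exact (wQ2_le hσy _ _).trans (mul_le_mul_of_nonneg_right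
      (mul_le_mul_of_nonneg_right B3 uy.le) uy.le)
  have A4 : |wQ ya σy y| ≤ 3 * wQ ya σy y0 := by rwa [abs_of_pos (wQ_pos _ _ _)]
  have T1 := abs_mul_le_mul ((abs_add_le _ _).trans (add_le_add
    (abs_mul_le_mul (abs_mul_le_mul A2 A2') A4) (abs_mul_le_mul A1 A3'))) hg
  have T2 := abs_mul_le_mul (le_of_eq (abs_two (α := ℝ)))
    (abs_mul_le_mul (abs_mul_le_mul A2 A4) (le_refl |q|))
  have T3 := abs_mul_le_mul (le_of_eq (abs_two (α := ℝ)))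
    (abs_mul_le_mul (abs_mul_le_mul A1 A3) (le_refl |r|))
  refine (abs_add_three _ _ _).trans ((add_le_add (add_le_add T1 T2) T3).trans (le_of_eq ?_))
  rw [bL]; ring

/-- The interpolation error itself is controlled by its derivatives. -/
lemma abs_interp_error_le {BX BY α γ a b x y : ℝ} (ha : a ∈ Set.Icc x0 x1)
    (hb : b ∈ Set.Icc y0 y1) (hxm : x ∈ Set.Icc x0 x1) (hym : y ∈ Set.Icc y0 y1)
    (hX : ∀ s ∈ Set.Icc x0 x1, ∀ t ∈ Set.Icc y0 y1, |α - wGx xa σx ya σy p q r (s, t)| ≤ BX)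
    (hY : ∀ s ∈ Set.Icc x0 x1, ∀ t ∈ Set.Icc y0 y1, |γ - wGy xa σx ya σy p q r (s, t)| ≤ BY) :
    |wG xa σx ya σy p q r (a, b) + (x - a) * α + (y - b) * γ - wG xa σx ya σy p q r (x, y)|
      ≤ (x1 - x0) * BX + (y1 - y0) * BY := by
  -- The error vanishes at the vertex `(a, b)`. It is followed horizontally to `(x, b)` and then
  -- vertically to `(x, y)`; this path may leave the triangle but not the cell, where the derivative
  -- bounds hold.
  have h1 := abs_sub_le_of_hasDerivAt (f := fun s => α * s - wG xa σx ya σy p q r (s, b))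
    (fun s => (((hasDerivAt_id s).const_mul α).sub
      (hasDerivAt_wG_fst xa σx ya σy p q r s b)).congr_deriv (by rw [mul_one])) (fun s hs => hX s hs b hb) hxm ha
  have h2 := abs_sub_le_of_hasDerivAt (f := fun s => γ * s - wG xa σx ya σy p q r (x, s))
    (fun s => (((hasDerivAt_id s).const_mul γ).sub
      (hasDerivAt_wG_snd xa σx ya σy p q r x s)).congr_deriv (by rw [mul_one])) (fun s hs => hY x hxm s hs) hym hb
  refine le_trans (le_of_eq ?_) ((abs_add_le _ _).trans (add_le_add h1 h2))
  congr 1; ring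

end Cell

/-! ### The elementwise inequalities between the bounds and the energy -/

/-- Weighted Young inequality with the condition `c ≤ m √(αβ)` squared, so that no roots of mesh
parameters appear. It absorbs the mixed products below; `m` carries the smallness. -/
lemma young_le {c u v α β m : ℝ} (hc0 : 0 ≤ c) (hu : 0 ≤ u) (hv : 0 ≤ v) (hα : 0 ≤ α)
    (hβ : 0 ≤ β) (hm : 0 ≤ m) (hc : c ^ 2 ≤ m ^ 2 * (α * β)) :
    c * u * v ≤ m * (α * u ^ 2 + β * v ^ 2) := by
  rw [← sq_le_sq₀ (by positivity) (by positivity)]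
  have h1 : (c * u * v) ^ 2 ≤ m ^ 2 * (α * β) * (u ^ 2 * v ^ 2) := by
    have := mul_le_mul_of_nonneg_right hc (by positivity : 0 ≤ u ^ 2 * v ^ 2)
    linarith
  have h2 : 0 ≤ m ^ 2 * ((α * u ^ 2) ^ 2 + (α * u ^ 2) * (β * v ^ 2) + (β * v ^ 2) ^ 2) := by
    positivity
  linarith

/-- The relations between the mesh sizes, the parameters of the weight, the weights on a cell and
the size of an affine function on this cell. -/
structure CellParams (κ n ε e hx hy ux uy W V g q r : ℝ) : Prop where
  κ0 : 0 ≤ κ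
  κ5 : 5 * κ ≤ 1
  n0 : 0 ≤ n
  n1 : n ≤ 1
  e0 : 0 ≤ e
  he : e * e = ε
  hx0 : 0 ≤ hx
  hy0 : 0 ≤ hy
  ux0 : 0 ≤ ux
  uy0 : 0 ≤ uy
  W0 : 0 ≤ W
  V0 : 0 ≤ V
  g0 : 0 ≤ g
  q0 : 0 ≤ q
  r0 : 0 ≤ r
  hxn : hx ≤ 2 * n
  hyn : hy ≤ 3 * n
  nux : n * ux ≤ κ
  εux : ε * ux ≤ κ
  euy : e * uy ≤ κ
  nuy : n * uy ≤ κ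
  nuy4 : n ^ 3 * uy ^ 4 ≤ κ ^ 4
  alt : n * uy ^ 2 ≤ κ ^ 2 ∨ n ^ 3 * uy ^ 2 ≤ κ ^ 2 * ε
  VW : V ≤ W * ux
  hxq : hx * q ≤ g
  hyr : hy * r ≤ g

namespace CellParams

variable {κ n ε e hx hy ux uy W V g q r : ℝ} (h : CellParams κ n ε e hx hy ux uy W V g q r)

include h

lemma eps_nonneg : 0 ≤ ε := by rw [← h.he]; exact mul_self_nonneg e

lemma hx_ux : hx * ux ≤ 2 * κ := by
  have := mul_le_mul_of_nonneg_right h.hxn h.ux0; linarith [h.nux]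

lemma hx_uy : hx * uy ≤ 2 * κ := by
  have := mul_le_mul_of_nonneg_right h.hxn h.uy0; linarith [h.nuy]

lemma hy_uy : hy * uy ≤ 3 * κ := by
  have := mul_le_mul_of_nonneg_right h.hyn h.uy0; linarith [h.nuy]

lemma hx_V : hx * V ≤ hx * ux * W := by
  have := mul_le_mul_of_nonneg_left h.VW h.hx0; linarith

lemma hx_V' : hx * V ≤ 2 * κ * W := by
  have := mul_le_mul_of_nonneg_right h.hx_ux h.W0; linarith [h.hx_V]

lemma hy_V : hy * V ≤ 3 * κ * W := by
  have h1 := mul_le_mul_of_nonneg_left h.VW h.hy0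
  have h2 := mul_le_mul_of_nonneg_right h.hyn (mul_nonneg h.ux0 h.W0)
  have h3 := mul_le_mul_of_nonneg_right h.nux h.W0
  linarith

/-- The coefficient `n V` is dominated by the geometric mean of `V` and `n W`. -/
lemma n_V_sq : (n * V) ^ 2 ≤ κ * (V * (n * W)) := by
  have h1 := mul_le_mul_of_nonneg_left h.VW (mul_nonneg (mul_nonneg h.n0 h.n0) h.V0)
  have h2 := mul_le_mul_of_nonneg_right h.nux
    (mul_nonneg (mul_nonneg h.n0 h.V0) h.W0)
  linarith

lemma eps_V_sq : (ε * V) ^ 2 ≤ κ * (V * (ε * W)) := by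
  have h1 := mul_le_mul_of_nonneg_left h.VW (mul_nonneg (mul_nonneg h.eps_nonneg h.eps_nonneg) h.V0)
  have h2 := mul_le_mul_of_nonneg_right h.εux
    (mul_nonneg (mul_nonneg h.eps_nonneg h.V0) h.W0)
  linarith

/-- Each term contains a ratio of a mesh step to a scale, hence a factor `κ`. The price is a term in
`r`, harmless when multiplied by `ε`. -/
lemma bX_le_kappa_mul : bX hx hy ux uy W V g q r ≤ 63 * κ * (V * g + W * q + W * r) := by
  obtain ⟨-, -, -, -, -, -, a1, a2, a3, a4, W0, V0, g0, q0, r0, -⟩ := id h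
  have e1 := mul_le_mul_of_nonneg_right (add_le_add h.hx_ux h.hy_uy) (mul_nonneg V0 g0)
  have e2 := mul_le_mul_of_nonneg_right h.hx_V' q0
  have e3 := mul_le_mul_of_nonneg_right h.hy_V r0
  have e4 := mul_le_mul_of_nonneg_right h.hy_uy (mul_nonneg W0 q0)
  have e5 := mul_nonneg h.κ0 (mul_nonneg V0 g0)
  have e6 := mul_nonneg h.κ0 (mul_nonneg W0 r0)
  unfold bX
  linarith

/-- Version for the streamline terms, where the norm offers only `ε` for `r`: the bound `hyr` trades
`r` for `g`. The coefficient of `V g` is not small; smallness comes later from `n_V_sq`. -/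
lemma bX_le : bX hx hy ux uy W V g q r ≤ 63 * (V * g + κ * (W * q)) := by
  obtain ⟨-, -, -, -, -, -, a1, a2, a3, a4, W0, V0, g0, q0, r0, -⟩ := id h
  have e1 := mul_le_mul_of_nonneg_right (add_le_add h.hx_ux h.hy_uy) (mul_nonneg V0 g0)
  have e1' := mul_le_mul_of_nonneg_right h.κ5 (mul_nonneg V0 g0)
  have e2 := mul_le_mul_of_nonneg_right h.hx_V' q0
  have e3 := mul_le_mul_of_nonneg_right h.hyr V0
  have e3' := mul_le_mul_of_nonneg_right h.hxq V0
  have e4 := mul_le_mul_of_nonneg_right h.hy_uy (mul_nonneg W0 q0)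
  have e5 := mul_nonneg h.κ0 (mul_nonneg W0 q0)
  have e6 := mul_nonneg V0 g0
  unfold bX
  linarith

lemma bY_le_kappa_mul : bY hx hy uy W V g q r ≤ 72 * κ * (W * uy * g + W * q + W * r) := by
  obtain ⟨-, -, -, -, -, -, a1, a2, a3, a4, W0, V0, g0, q0, r0, -⟩ := id h
  have e1 := mul_le_mul_of_nonneg_right (add_le_add h.hx_V' (mul_le_mul_of_nonneg_right h.hy_uy W0))
    (mul_nonneg a4 g0)
  have e2 := mul_le_mul_of_nonneg_right h.hx_uy (mul_nonneg W0 q0)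
  have e3 := mul_le_mul_of_nonneg_right h.hy_uy (mul_nonneg W0 r0)
  have e4 := mul_le_mul_of_nonneg_right h.hx_V' r0
  have e5 := mul_nonneg h.κ0 (mul_nonneg W0 q0)
  have e6 := mul_nonneg h.κ0 (mul_nonneg W0 (mul_nonneg a4 g0))
  unfold bY
  linarith

/-- The inverse estimates `hxq` and `hyr` reduce everything to `W g`. The step-to-scale ratio stays
explicit because in the layer it is multiplied by the layer width. -/
lemma bE_le : hx * bX hx hy ux uy W V g q r + hy * bY hx hy uy W V g q r
    ≤ 45 * (hx * ux + hy * uy) * (W * g) := by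
  obtain ⟨-, -, -, -, -, -, a1, a2, a3, a4, W0, V0, g0, q0, r0, -⟩ := id h
  obtain ⟨s, hs⟩ : ∃ s, s = hx * ux := ⟨_, rfl⟩
  obtain ⟨t, ht⟩ : ∃ t, t = hy * uy := ⟨_, rfl⟩
  have s0 : 0 ≤ s := hs ▸ mul_nonneg a1 a3
  have t0 : 0 ≤ t := ht ▸ mul_nonneg a2 a4
  have st : s + t ≤ 1 := by rw [hs, ht]; linarith [h.hx_ux, h.hy_uy, h.κ5]
  have hV : hx * V ≤ s * W := by rw [hs]; exact h.hx_V
  have X : hx * bX hx hy ux uy W V g q r ≤ (36 * s + 9 * t) * (W * g) := by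
    have e0 : hx * bX hx hy ux uy W V g q r = 9 * (hx * V) * ((s + t) * g)
        + 9 * (hx * V) * (hx * q + hy * r) + 9 * (hx * q) * (hx * V + t * W) := by
      rw [hs, ht, bX]; ring
    have e1 := mul_le_mul hV (mul_le_mul_of_nonneg_right st g0) (by positivity) (by positivity)
    have e2 := mul_le_mul hV (add_le_add h.hxq h.hyr) (by positivity) (by positivity)
    have e3 := mul_le_mul h.hxq (add_le_add_left hV (t * W)) (by positivity) (by positivity)
    rw [e0]; linarith
  have Y : hy * bY hx hy uy W V g q r ≤ (9 * s + 36 * t) * (W * g) := by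
    have e0 : hy * bY hx hy uy W V g q r = 9 * (hx * V + t * W) * (t * g)
        + 9 * (W * t) * (hx * q + hy * r) + 9 * (hy * r) * (hx * V + t * W) := by
      rw [ht, bY]; ring
    have e1 := mul_le_mul_of_nonneg_right (add_le_add_left hV (t * W)) (mul_nonneg t0 g0)
    have e1' := mul_le_mul_of_nonneg_right st (mul_nonneg W0 (mul_nonneg t0 g0))
    have e2 := mul_le_mul_of_nonneg_left (add_le_add h.hxq h.hyr) (mul_nonneg W0 t0)
    have e3 := mul_le_mul h.hyr (add_le_add_left hV (t * W)) (by positivity) (by positivity)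
    rw [e0]; linarith
  rw [← hs, ← ht]; linarith

lemma bE_le_kappa_mul : hx * bX hx hy ux uy W V g q r + hy * bY hx hy uy W V g q r
    ≤ 225 * κ * (W * g) := by
  have := mul_le_mul_of_nonneg_right (add_le_add h.hx_ux h.hy_uy) (mul_nonneg h.W0 h.g0)
  linarith [h.bE_le]

/-- With `hy uy` only to first order in front of `W g`, the product with `q` could not always be
absorbed by `W g²` and `n W q²`. Here `g` gets the square of `hy uy`, and the first-order remainder
keeps the slope `r`. -/
lemma bE_le' : hx * bX hx hy ux uy W V g q r + hy * bY hx hy uy W V g q r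
    ≤ 81 * (hx * V * g) + 180 * κ * (n * W * q) + 9 * ((hy * uy) ^ 2 * W * g)
      + 18 * (hy * uy * hy * W * r) := by
  obtain ⟨κ0, -, n0, -, -, -, a1, a2, a3, a4, W0, V0, g0, q0, r0, -⟩ := id h
  obtain ⟨t, ht⟩ : ∃ t, t = hy * uy := ⟨_, rfl⟩
  have t0 : 0 ≤ t := ht ▸ mul_nonneg a2 a4
  have t1 : t ≤ 1 := by rw [ht]; linarith [h.hy_uy, h.κ5]
  have t3 : t ≤ 3 * κ := ht ▸ h.hy_uy
  have X := mul_le_mul_of_nonneg_left h.bX_le a1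
  have X1 := mul_le_mul_of_nonneg_right h.hxn (mul_nonneg κ0 (mul_nonneg W0 q0))
  have e0 : hy * bY hx hy uy W V g q r = 9 * (t * (hx * V * g)) + 9 * (t ^ 2 * W * g)
      + 9 * (W * (t * (hx * q))) + 18 * (t * hy * W * r) + 9 * (hy * r * (hx * V)) := by
    rw [ht, bY]; ring
  have e1 := mul_le_mul_of_nonneg_right t1 (mul_nonneg (mul_nonneg a1 V0) g0)
  have e2 := mul_le_mul_of_nonneg_left (mul_le_mul t3 (mul_le_mul_of_nonneg_right h.hxn q0)
    (by positivity) (by positivity)) W0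
  have e3 := mul_le_mul_of_nonneg_right h.hyr (mul_nonneg a1 V0)
  rw [← ht, e0]; linarith

/-- Diffusion in `x`: the mixed term `ε V g q` is controlled through `ε ux ≤ κ`. -/
lemma eps_bX_mul_le : ε * bX hx hy ux uy W V g q r * q
    ≤ 400 * κ * (ε * W * q ^ 2 + ε * W * r ^ 2 + V * g ^ 2 + W * g ^ 2) := by
  obtain ⟨κ0, -, n0, -, -, -, a1, a2, a3, a4, W0, V0, g0, q0, r0, -⟩ := id h
  have ε0 := h.eps_nonneg
  have κ1 : κ ≤ 1 := by linarith [h.κ5]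
  have X := mul_le_mul_of_nonneg_left h.bX_le_kappa_mul (mul_nonneg ε0 q0)
  have y1 : ε * V * g * q ≤ 1 * (V * g ^ 2 + ε * W * q ^ 2) := by
    refine young_le (by positivity) g0 q0 V0 (by positivity) zero_le_one ?_
    have := mul_le_mul_of_nonneg_right κ1 (by positivity : 0 ≤ V * (ε * W))
    linarith [h.eps_V_sq]
  have y2 : ε * W * q * r ≤ 1 * (ε * W * q ^ 2 + ε * W * r ^ 2) := by
    refine young_le (by positivity) q0 r0 (by positivity) (by positivity) zero_le_one ?_
    linarith
  have z1 := mul_le_mul_of_nonneg_left y1 κ0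
  have z2 := mul_le_mul_of_nonneg_left y2 κ0
  have p1 : 0 ≤ κ * (ε * W * q ^ 2) := by positivity
  have p2 : 0 ≤ κ * (ε * W * r ^ 2) := by positivity
  have p3 : 0 ≤ κ * (V * g ^ 2) := by positivity
  have p4 : 0 ≤ κ * (W * g ^ 2) := by positivity
  linarith

/-- Diffusion in `y`: here `√ε uy ≤ κ` is the decisive relation. -/
lemma eps_bY_mul_le : ε * bY hx hy uy W V g q r * r
    ≤ 400 * κ * (ε * W * q ^ 2 + ε * W * r ^ 2 + V * g ^ 2 + W * g ^ 2) := by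
  obtain ⟨κ0, -, n0, -, e0, he, a1, a2, a3, a4, W0, V0, g0, q0, r0, -⟩ := id h
  have ε0 := h.eps_nonneg
  have κ1 : κ ≤ 1 := by linarith [h.κ5]
  have X := mul_le_mul_of_nonneg_left h.bY_le_kappa_mul (mul_nonneg ε0 r0)
  have y1 : ε * uy * W * g * r ≤ 1 * (W * g ^ 2 + ε * W * r ^ 2) := by
    refine young_le (by positivity) g0 r0 W0 (by positivity) zero_le_one ?_
    have k1 : (e * uy) ^ 2 ≤ 1 := by
      have := h.euy
      have : 0 ≤ e * uy := by positivity
      exact pow_le_one₀ this (by linarith)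
    have := mul_le_mul_of_nonneg_right k1 (by positivity : 0 ≤ ε * (W * W))
    rw [← he] at this ⊢
    linarith
  have y2 : ε * W * q * r ≤ 1 * (ε * W * q ^ 2 + ε * W * r ^ 2) := by
    refine young_le (by positivity) q0 r0 (by positivity) (by positivity) zero_le_one ?_
    linarith
  have z1 := mul_le_mul_of_nonneg_left y1 κ0
  have z2 := mul_le_mul_of_nonneg_left y2 κ0
  have p1 : 0 ≤ κ * (ε * W * q ^ 2) := by positivity
  have p2 : 0 ≤ κ * (ε * W * r ^ 2) := by positivity
  have p3 : 0 ≤ κ * (V * g ^ 2) := by positivity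
  have p4 : 0 ≤ κ * (W * g ^ 2) := by positivity
  linarith

lemma bE_mul_g_le : (hx * bX hx hy ux uy W V g q r + hy * bY hx hy uy W V g q r) * g
    ≤ 400 * κ * (ε * W * q ^ 2 + ε * W * r ^ 2 + V * g ^ 2 + W * g ^ 2) := by
  obtain ⟨κ0, -, n0, -, e0, he, a1, a2, a3, a4, W0, V0, g0, q0, r0, -⟩ := id h
  have ε0 := h.eps_nonneg
  have X := mul_le_mul_of_nonneg_right h.bE_le_kappa_mul g0
  have p1 : 0 ≤ κ * (ε * W * q ^ 2) := by positivity
  have p2 : 0 ≤ κ * (ε * W * r ^ 2) := by positivity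
  have p3 : 0 ≤ κ * (V * g ^ 2) := by positivity
  have p4 : 0 ≤ κ * (W * g ^ 2) := by positivity
  linarith

/-! ### Terms tested with the streamline derivative, small like the square root of `κ` -/

variable {θ : ℝ} (hθ0 : 0 ≤ θ) (hθ : κ = θ ^ 2)

include hθ0 hθ

lemma theta_le_one : θ ≤ 1 := by
  have := h.κ5
  nlinarith

lemma kappa_le_theta : κ ≤ θ := by
  have := h.theta_le_one hθ0 hθ
  nlinarith

/-- The convection term on stabilized triangles. For `hx V g q`, the inequality `(nV)² ≤ κ V (nW)`
allows only the factor `√κ`. The quadratic `y`-part uses `nuy4`, and the part with `r` the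
alternative `alt`. -/
lemma bE_mul_q_le : (hx * bX hx hy ux uy W V g q r + hy * bY hx hy uy W V g q r) * q
    ≤ 600 * θ * (ε * W * q ^ 2 + ε * W * r ^ 2 + V * g ^ 2 + W * g ^ 2 + n * W * q ^ 2) := by
  obtain ⟨κ0, -, n0, n1, e0, he, a1, a2, a3, a4, W0, V0, g0, q0, r0, -⟩ := id h
  have ε0 := h.eps_nonneg
  have κθ := h.kappa_le_theta hθ0 hθ
  have κ1 : κ ≤ 1 := by linarith [h.κ5]
  have X := mul_le_mul_of_nonneg_right h.bE_le' q0
  have y1 : hx * V * g * q ≤ 2 * θ * (V * g ^ 2 + n * W * q ^ 2) := by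
    refine young_le (by positivity) g0 q0 V0 (by positivity) (by positivity) ?_
    have h1 := pow_le_pow_left₀ (by positivity) (mul_le_mul_of_nonneg_right h.hxn V0) 2
    have h2 := h.n_V_sq
    rw [hθ] at h2
    linarith
  -- One of the four powers of `n` from `hy ≤ 3n` is left over; it pays for the weight `n W q²`.
  have hyuy4 : ((hy * uy) ^ 2) ^ 2 ≤ 81 * (n * κ ^ 4) := by
    have h1 := pow_le_pow_left₀ a2 h.hyn 4
    have h2 := mul_le_mul_of_nonneg_right h1 (by positivity : 0 ≤ uy ^ 4)
    have h3 := mul_le_mul_of_nonneg_left h.nuy4 n0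
    linarith
  have κ4 : κ ^ 4 ≤ κ ^ 2 := pow_le_pow_of_le_one κ0 κ1 (by norm_num)
  have y2 : (hy * uy) ^ 2 * W * g * q ≤ 9 * κ * (W * g ^ 2 + n * W * q ^ 2) := by
    refine young_le (by positivity) g0 q0 W0 (by positivity) (by positivity) ?_
    have h1 := mul_le_mul_of_nonneg_right hyuy4 (by positivity : 0 ≤ W * W)
    have h2 := mul_le_mul_of_nonneg_right κ4 (by positivity : 0 ≤ n * (W * W))
    linarith
  have y3 : hy * uy * hy * W * r * q
      ≤ 9 * κ * (ε * W * r ^ 2 + W * g ^ 2 + n * W * q ^ 2) := by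
    have p1 : 0 ≤ κ * (ε * W * r ^ 2) := by positivity
    have p2 : 0 ≤ κ * (W * g ^ 2) := by positivity
    have hy2 := pow_le_pow_left₀ a2 h.hyn 2
    have hy4 := pow_le_pow_left₀ a2 h.hyn 4
    -- If `n uy² ≤ κ²`, then `hy r ≤ g` is used and one power of `hy uy` suffices. Otherwise `n³ uy²
    -- ≤ κ² ε`, and the term is absorbed by `ε W r²`.
    rcases h.alt with hA | hA
    · have : hy * uy * W * g * q ≤ 9 * κ * (W * g ^ 2 + n * W * q ^ 2) := by
        refine young_le (by positivity) g0 q0 W0 (by positivity) (by positivity) ?_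
        have h1 := mul_le_mul_of_nonneg_right hy2 (by positivity : 0 ≤ uy ^ 2 * (W * W))
        have h2 := mul_le_mul_of_nonneg_right hA (by positivity : 0 ≤ n * (W * W))
        have h3 : 0 ≤ κ ^ 2 * (n * (W * W)) := by positivity
        linarith
      have h3 := mul_le_mul_of_nonneg_right h.hyr (by positivity : 0 ≤ hy * uy * W * q)
      linarith
    · have : hy * uy * hy * W * r * q ≤ 9 * κ * (ε * W * r ^ 2 + n * W * q ^ 2) := by
        refine young_le (by positivity) r0 q0 (by positivity) (by positivity) (by positivity) ?_
        have h1 := mul_le_mul_of_nonneg_right hy4 (by positivity : 0 ≤ uy ^ 2 * (W * W))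
        have h2 := mul_le_mul_of_nonneg_right hA (by positivity : 0 ≤ n * (W * W))
        linarith
      linarith
  have p1 : 0 ≤ ε * W * q ^ 2 := by positivity
  have p2 : 0 ≤ ε * W * r ^ 2 := by positivity
  have p3 : 0 ≤ V * g ^ 2 := by positivity
  have p4 : 0 ≤ W * g ^ 2 := by positivity
  have p5 : 0 ≤ n * W * q ^ 2 := by positivity
  have z2 := mul_le_mul_of_nonneg_right κθ (add_nonneg p4 p5)
  have z3 := mul_le_mul_of_nonneg_right κθ (add_nonneg (add_nonneg p2 p4) p5)
  have z4 := mul_le_mul_of_nonneg_right κθ p5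
  have q1 := mul_nonneg hθ0 p1
  have q2 := mul_nonneg hθ0 p2
  have q3 := mul_nonneg hθ0 p3
  have q4 := mul_nonneg hθ0 p4
  have q5 := mul_nonneg hθ0 p5
  linarith

/-- Stabilization against the Laplacian: one factor `ε` compensates both derivatives of the weight
through `ε ux ≤ κ` and `ε uy² ≤ κ`, and `√ε uy ≤ κ` leaves a factor `√ε` for `r`. -/
lemma n_bL_mul_le : n * q * (ε * bL ux uy W V g q r)
    ≤ 600 * θ * (ε * W * q ^ 2 + ε * W * r ^ 2 + V * g ^ 2 + W * g ^ 2 + n * W * q ^ 2) := by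
  obtain ⟨κ0, -, n0, n1, e0, he, a1, a2, a3, a4, W0, V0, g0, q0, r0, -⟩ := id h
  have ε0 := h.eps_nonneg
  have κθ := h.kappa_le_theta hθ0 hθ
  have κ1 : κ ≤ 1 := by linarith [h.κ5]
  have y1 : n * V * g * q ≤ 1 * (V * g ^ 2 + n * W * q ^ 2) := by
    refine young_le (by positivity) g0 q0 V0 (by positivity) zero_le_one ?_
    have := mul_le_mul_of_nonneg_right κ1 (by positivity : 0 ≤ V * (n * W))
    linarith [h.n_V_sq]
  have y2 : n * W * g * q ≤ 1 * (W * g ^ 2 + n * W * q ^ 2) := by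
    refine young_le (by positivity) g0 q0 W0 (by positivity) zero_le_one ?_
    have := mul_le_mul_of_nonneg_right n1 (by positivity : 0 ≤ n * (W * W))
    linarith
  have y3 : n * e * W * r * q ≤ 1 * (ε * W * r ^ 2 + n * W * q ^ 2) := by
    refine young_le (by positivity) r0 q0 (by positivity) (by positivity) zero_le_one ?_
    have := mul_le_mul_of_nonneg_right n1 (by positivity : 0 ≤ n * ε * (W * W))
    rw [← he] at this ⊢
    linarith
  have x1 := mul_le_mul_of_nonneg_right h.εux (by positivity : 0 ≤ n * V * g * q)
  have hu : ε * uy * uy ≤ κ := by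
    have := mul_le_mul h.euy h.euy (by positivity) κ0
    rw [← he]; nlinarith
  have x2 := mul_le_mul_of_nonneg_right hu (by positivity : 0 ≤ n * W * g * q)
  have x3 : n * ε * V * q ^ 2 ≤ κ * (n * W * q ^ 2) := by
    have h1 := mul_le_mul_of_nonneg_right h.VW (by positivity : 0 ≤ n * ε * q ^ 2)
    have h2 := mul_le_mul_of_nonneg_right h.εux (by positivity : 0 ≤ n * W * q ^ 2)
    linarith
  have x4 : n * ε * uy * W * r * q ≤ κ * (n * e * W * r * q) := by
    have h1 := mul_le_mul_of_nonneg_right h.euy (by positivity : 0 ≤ n * e * W * r * q)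
    rw [← he]; linarith
  have z1 := mul_le_mul_of_nonneg_left y1 κ0
  have z2 := mul_le_mul_of_nonneg_left y2 κ0
  have z3 := mul_le_mul_of_nonneg_left y3 κ0
  have p1 : 0 ≤ ε * W * q ^ 2 := by positivity
  have p2 : 0 ≤ ε * W * r ^ 2 := by positivity
  have p3 : 0 ≤ V * g ^ 2 := by positivity
  have p4 : 0 ≤ W * g ^ 2 := by positivity
  have p5 : 0 ≤ n * W * q ^ 2 := by positivity
  have q0 := mul_le_mul_of_nonneg_right κθ
    (add_nonneg (add_nonneg (add_nonneg (add_nonneg p1 p2) p3) p4) p5)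
  have q1 := mul_nonneg κ0 p1
  have q2 := mul_nonneg κ0 p2
  have q3 := mul_nonneg κ0 p3
  have q4 := mul_nonneg κ0 p4
  have q5 := mul_nonneg κ0 p5
  unfold bL
  linarith

lemma n_bX_mul_le : n * q * bX hx hy ux uy W V g q r
    ≤ 600 * θ * (ε * W * q ^ 2 + ε * W * r ^ 2 + V * g ^ 2 + W * g ^ 2 + n * W * q ^ 2) := by
  obtain ⟨κ0, -, n0, n1, e0, he, a1, a2, a3, a4, W0, V0, g0, q0, r0, -⟩ := id h
  have ε0 := h.eps_nonneg
  have κθ := h.kappa_le_theta hθ0 hθ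
  have X := mul_le_mul_of_nonneg_left h.bX_le (mul_nonneg n0 q0)
  have y1 : n * V * g * q ≤ θ * (V * g ^ 2 + n * W * q ^ 2) := by
    refine young_le (by positivity) g0 q0 V0 (by positivity) hθ0 ?_
    have := h.n_V_sq
    rwa [← hθ]
  have p1 : 0 ≤ ε * W * q ^ 2 := by positivity
  have p2 : 0 ≤ ε * W * r ^ 2 := by positivity
  have p3 : 0 ≤ V * g ^ 2 := by positivity
  have p4 : 0 ≤ W * g ^ 2 := by positivity
  have p5 : 0 ≤ n * W * q ^ 2 := by positivity
  have z4 := mul_le_mul_of_nonneg_right κθ p5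
  have q1 := mul_nonneg hθ0 p1
  have q2 := mul_nonneg hθ0 p2
  have q3 := mul_nonneg hθ0 p3
  have q4 := mul_nonneg hθ0 p4
  have q5 := mul_nonneg hθ0 p5
  linarith

/-- The factor `n` from the stabilization parameter makes the crude first-order bound of the error
sufficient here. -/
lemma n_bE_mul_le : n * q * (hx * bX hx hy ux uy W V g q r + hy * bY hx hy uy W V g q r)
    ≤ 600 * θ * (ε * W * q ^ 2 + ε * W * r ^ 2 + V * g ^ 2 + W * g ^ 2 + n * W * q ^ 2) := by
  obtain ⟨κ0, -, n0, n1, e0, he, a1, a2, a3, a4, W0, V0, g0, q0, r0, -⟩ := id h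
  have ε0 := h.eps_nonneg
  have κθ := h.kappa_le_theta hθ0 hθ
  have X := mul_le_mul_of_nonneg_left h.bE_le_kappa_mul (mul_nonneg n0 q0)
  have y2 : n * W * g * q ≤ 1 * (W * g ^ 2 + n * W * q ^ 2) := by
    refine young_le (by positivity) g0 q0 W0 (by positivity) zero_le_one ?_
    have := mul_le_mul_of_nonneg_right n1 (by positivity : 0 ≤ n * (W * W))
    linarith
  have z2 := mul_le_mul_of_nonneg_left y2 κ0
  have p1 : 0 ≤ ε * W * q ^ 2 := by positivity
  have p2 : 0 ≤ ε * W * r ^ 2 := by positivity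
  have p3 : 0 ≤ V * g ^ 2 := by positivity
  have p4 : 0 ≤ W * g ^ 2 := by positivity
  have p5 : 0 ≤ n * W * q ^ 2 := by positivity
  have z4 := mul_le_mul_of_nonneg_right κθ (add_nonneg p4 p5)
  have q1 := mul_nonneg hθ0 p1
  have q2 := mul_nonneg hθ0 p2
  have q3 := mul_nonneg hθ0 p3
  have q4 := mul_nonneg hθ0 p4
  have q5 := mul_nonneg hθ0 p5
  linarith

end CellParams

/-! ### The Shishkin mesh and the parameters of the weight -/

section MeshFacts

variable {β ε : ℝ} {N : ℕ}

lemma meshX_zero : meshX β ε N 0 = 0 := by simp [meshX]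

lemma meshY_zero : meshY ε N 0 = 0 := by simp [meshY]

lemma meshX_last (hN : 0 < N) : meshX β ε N N = 1 := by
  have h : ¬ 2 * N ≤ N := by omega
  have hN' : (N : ℝ) ≠ 0 := by positivity
  rw [meshX, if_neg h]; field_simp; ring

lemma meshY_last (hN : 0 < N) : meshY ε N N = 1 := by
  have h : ¬ 3 * N ≤ N := by omega
  have h' : ¬ 3 * N ≤ 2 * N := by omega
  have hN' : (N : ℝ) ≠ 0 := by positivity
  rw [meshY, if_neg h, if_neg h']; field_simp; ring

lemma meshX_half (h2 : 2 ∣ N) (hN : 0 < N) : meshX β ε N (N / 2) = 1 - lambdaX β ε N := by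
  obtain ⟨m, rfl⟩ := h2
  have hm : (m : ℝ) ≠ 0 := by
    have : 0 < m := by omega
    positivity
  have h : 2 * (2 * m / 2) ≤ 2 * m := by omega
  have e : 2 * m / 2 = m := by omega
  rw [meshX, if_pos h, e]; push_cast; field_simp

lemma meshX_step_coarse {i : ℕ} (h2 : 2 ∣ N) (hi : 2 * i < N) :
    meshX β ε N (i + 1) - meshX β ε N i = 2 * (1 - lambdaX β ε N) * (N : ℝ)⁻¹ := by
  have h : 2 * (i + 1) ≤ N := by omega
  have hN' : (N : ℝ) ≠ 0 := by
    have : 0 < N := by omega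
    positivity
  rw [meshX, meshX, if_pos h, if_pos hi.le]; push_cast; field_simp; ring

lemma meshX_step_fine {i : ℕ} (hN : 0 < N) (hi : N ≤ 2 * i) :
    meshX β ε N (i + 1) - meshX β ε N i = 2 * lambdaX β ε N * (N : ℝ)⁻¹ := by
  have h : ¬ 2 * (i + 1) ≤ N := by omega
  have hN' : (N : ℝ) ≠ 0 := by positivity
  -- At the transition index the left endpoint is computed by the first branch of the definition;
  -- the branches agree there.
  rcases hi.eq_or_lt with hi' | hi'
  · have e : (N : ℝ) = 2 * i := by exact_mod_cast hi'
    rw [meshX, meshX, if_neg h, if_pos hi'.ge]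
    have hi0 : (i : ℝ) ≠ 0 := by
      intro h0; exact hN' (by rw [e, h0, mul_zero])
    push_cast; rw [e]; field_simp; ring
  · rw [meshX, meshX, if_neg h, if_neg (by omega)]; push_cast; field_simp; ring

lemma meshX_strictMono (hN : 0 < N) (h2 : 2 ∣ N) (h0 : 0 < lambdaX β ε N) :
    StrictMono (meshX β ε N) := by
  have h1 : lambdaX β ε N ≤ 1 / 2 := min_le_left _ _
  have hn : 0 < (N : ℝ)⁻¹ := by positivity
  refine strictMono_nat_of_lt_succ fun i => ?_
  rw [← sub_pos]
  rcases lt_or_ge (2 * i) N with h | h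
  · rw [meshX_step_coarse h2 h]; exact mul_pos (by linarith) hn
  · rw [meshX_step_fine hN h]; exact mul_pos (by linarith) hn

lemma meshX_step_le (hN : 0 < N) (h2 : 2 ∣ N) (h0 : 0 < lambdaX β ε N) (i : ℕ) :
    meshX β ε N (i + 1) - meshX β ε N i ≤ 2 * (N : ℝ)⁻¹ := by
  have h1 : lambdaX β ε N ≤ 1 / 2 := min_le_left _ _
  have hn : 0 < (N : ℝ)⁻¹ := by positivity
  rcases lt_or_ge (2 * i) N with h | h
  · rw [meshX_step_coarse h2 h]; exact mul_le_mul_of_nonneg_right (by linarith) hn.le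
  · rw [meshX_step_fine hN h]; exact mul_le_mul_of_nonneg_right (by linarith) hn.le

lemma meshY_step (hN : 0 < N) (h3 : 3 ∣ N) (j : ℕ) :
    meshY ε N (j + 1) - meshY ε N j = 3 * lambdaY ε N * (N : ℝ)⁻¹ ∨
    meshY ε N (j + 1) - meshY ε N j = 3 * (1 - 2 * lambdaY ε N) * (N : ℝ)⁻¹ := by
  have hN' : (N : ℝ) ≠ 0 := by positivity
  rcases lt_or_ge (3 * j) N with h | h
  · left
    have h' : 3 * (j + 1) ≤ N := by omega
    rw [meshY, meshY, if_pos h', if_pos h.le]; push_cast; field_simp; ring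
  · rcases lt_or_ge (3 * j) (2 * N) with h' | h'
    · right
      have h1 : ¬ 3 * (j + 1) ≤ N := by omega
      have h2 : 3 * (j + 1) ≤ 2 * N := by omega
      rcases h.eq_or_lt with he | he
      · have e : (N : ℝ) = 3 * j := by exact_mod_cast he
        rw [meshY, meshY, if_neg h1, if_pos h2, if_pos he.ge]
        have hj0 : (j : ℝ) ≠ 0 := by
          intro h0; exact hN' (by rw [e, h0, mul_zero])
        push_cast; rw [e]; field_simp; ring
      · rw [meshY, meshY, if_neg h1, if_pos h2, if_neg (by omega), if_pos h'.le]
        push_cast; field_simp; ring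
    · left
      have h1 : ¬ 3 * (j + 1) ≤ N := by omega
      have h2 : ¬ 3 * (j + 1) ≤ 2 * N := by omega
      have h4 : ¬ 3 * j ≤ N := by omega
      rcases h'.eq_or_lt with he | he
      · have e : 2 * (N : ℝ) = 3 * j := by exact_mod_cast he
        have e' : (j : ℝ) = 2 * N / 3 := by linarith
        rw [meshY, meshY, if_neg h1, if_neg h2, if_neg h4, if_pos he.ge]
        push_cast; rw [e']; field_simp; ring
      · rw [meshY, meshY, if_neg h1, if_neg h2, if_neg h4, if_neg (by omega)]
        push_cast; field_simp; ring

lemma meshY_strictMono (hN : 0 < N) (h3 : 3 ∣ N) (h0 : 0 < lambdaY ε N) :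
    StrictMono (meshY ε N) := by
  have h1 : lambdaY ε N ≤ 1 / 3 := min_le_left _ _
  have hn : 0 < (N : ℝ)⁻¹ := by positivity
  refine strictMono_nat_of_lt_succ fun j => ?_
  rw [← sub_pos]
  rcases meshY_step (ε := ε) hN h3 j with h | h <;> rw [h] <;> exact mul_pos (by linarith) hn

lemma meshY_step_le (hN : 0 < N) (h3 : 3 ∣ N) (h0 : 0 < lambdaY ε N) (j : ℕ) :
    meshY ε N (j + 1) - meshY ε N j ≤ 3 * (N : ℝ)⁻¹ := by
  have h1 : lambdaY ε N ≤ 1 / 3 := min_le_left _ _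
  have hn : 0 < (N : ℝ)⁻¹ := by positivity
  rcases meshY_step (ε := ε) hN h3 j with h | h <;> rw [h] <;>
    exact mul_le_mul_of_nonneg_right (by linarith) hn.le

lemma one_le_log (hN : 6 ≤ N) : 1 ≤ Real.log N := by
  have h : (6 : ℝ) ≤ N := by exact_mod_cast hN
  rw [Real.le_log_iff_exp_le (by linarith)]
  linarith [Real.exp_one_lt_d9]

/-- The exponent 1/4 matches the decay of `N⁻¹/σ_y` that follows from `n_uy4`. -/
lemma log_mul_rpow_le (hN : 0 < N) : Real.log N * ((N : ℝ)⁻¹) ^ (1 / 4 : ℝ) ≤ 4 := by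
  have hN' : (0 : ℝ) < N := by exact_mod_cast hN
  have h := Real.log_le_rpow_div hN'.le (show (0 : ℝ) < 1 / 4 by norm_num)
  have hp : 0 < (N : ℝ) ^ (1 / 4 : ℝ) := Real.rpow_pos_of_pos hN' _
  rw [Real.inv_rpow hN'.le, ← div_eq_mul_inv, div_le_iff₀ hp]
  linarith

end MeshFacts

/-! ### Lower bounds for the scales of the weight -/

section Sigma

variable {k ε : ℝ} {N : ℕ}

/-- The bound by `k ε` uses `ln N ≥ 1`. The one with the squared logarithm is kept for the layer,
where `λ_x²` produces the same square. -/
lemma sigmaX_bounds (hk : 0 < k) (hN : 6 ≤ N) (hε : 0 < ε) :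
    0 < sigmaX k ε N ∧ k * (N : ℝ)⁻¹ ≤ sigmaX k ε N ∧ k * ε ≤ sigmaX k ε N ∧
      k * (ε * Real.log N ^ 2) ≤ sigmaX k ε N := by
  have hn : 0 < (N : ℝ)⁻¹ := by
    have : 0 < N := by omega
    positivity
  have h1 : k * (N : ℝ)⁻¹ ≤ sigmaX k ε N := by
    rw [sigmaX, Real.rpow_neg_one]
    exact mul_le_mul_of_nonneg_left (le_max_left _ _) hk.le
  have h2 : k * (ε * Real.log N ^ 2) ≤ sigmaX k ε N :=
    mul_le_mul_of_nonneg_left (le_max_right _ _) hk.le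
  refine ⟨(mul_pos hk hn).trans_le h1, h1, le_trans ?_ h2, h2⟩
  have := one_le_pow₀ (n := 2) (one_le_log hN)
  nlinarith [mul_pos hk hε]

/-- For `ε ≤ N⁻²` one has `(σ_y/k)² = N⁻¹`, which gives the first alternative. Otherwise `σ_y/k` is
the maximum of `A` and `√ε` with `A² ε = N⁻³`: this gives the second alternative, and the fourth
power is at least `A² · ε`. -/
lemma sigmaY_bounds (hk : 0 < k) (hN : 0 < N) (hε : 0 < ε) :
    0 < sigmaY k ε N ∧ k * √ε ≤ sigmaY k ε N ∧ k * (N : ℝ)⁻¹ ≤ sigmaY k ε N ∧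
      k ^ 4 * ((N : ℝ)⁻¹) ^ 3 ≤ sigmaY k ε N ^ 4 ∧
      (k ^ 2 * (N : ℝ)⁻¹ ≤ sigmaY k ε N ^ 2 ∨
        k ^ 2 * ((N : ℝ)⁻¹) ^ 3 ≤ sigmaY k ε N ^ 2 * ε) := by
  have hN' : (0 : ℝ) < N := by exact_mod_cast hN
  have hN1 : (1 : ℝ) ≤ N := by exact_mod_cast hN
  obtain ⟨n, hn⟩ : ∃ n, n = (N : ℝ)⁻¹ := ⟨_, rfl⟩
  have n0 : 0 < n := hn ▸ inv_pos.2 hN'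
  have n1 : n ≤ 1 := hn ▸ inv_le_one_of_one_le₀ hN1
  have e2 : (N : ℝ) ^ (-2 : ℝ) = n ^ 2 := by
    rw [Real.rpow_neg hN'.le, hn, inv_pow]; norm_cast
  rw [← hn]
  have hsq := Real.sq_sqrt hε.le
  have hs0 := Real.sqrt_pos.2 hε
  by_cases h : ε ≤ (N : ℝ) ^ (-2 : ℝ)
  · rw [sigmaY, if_pos h]
    rw [e2] at h
    obtain ⟨s, hs⟩ : ∃ s, s = (N : ℝ) ^ (-(1 / 2) : ℝ) := ⟨_, rfl⟩
    have s0 : 0 < s := hs ▸ Real.rpow_pos_of_pos hN' _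
    have s2 : s ^ 2 = n := by
      rw [hs, ← Real.rpow_natCast, ← Real.rpow_mul hN'.le, hn, ← Real.rpow_neg_one]
      norm_num
    rw [← hs]
    have hεn : √ε ≤ n := (Real.sqrt_le_left n0.le).2 h
    have hns : n ≤ s := by nlinarith
    refine ⟨by positivity, mul_le_mul_of_nonneg_left (hεn.trans hns) hk.le,
      mul_le_mul_of_nonneg_left hns hk.le, ?_, Or.inl (by rw [mul_pow, s2])⟩
    rw [mul_pow, show s ^ 4 = (s ^ 2) ^ 2 by ring, s2]
    exact mul_le_mul_of_nonneg_left (pow_le_pow_of_le_one n0.le n1 (by norm_num)) (by positivity)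
  · rw [sigmaY, if_neg h]
    rw [e2] at h
    have hB : ε ^ (1 / 2 : ℝ) = √ε := (Real.sqrt_eq_rpow ε).symm
    obtain ⟨A, hA⟩ : ∃ A, A = (N : ℝ) ^ (-(3 / 2) : ℝ) * ε ^ (-(1 / 2) : ℝ) := ⟨_, rfl⟩
    have A0 : 0 < A := hA ▸ mul_pos (Real.rpow_pos_of_pos hN' _) (Real.rpow_pos_of_pos hε _)
    have A2 : A ^ 2 * ε = n ^ 3 := by
      have a1 : ((N : ℝ) ^ (-(3 / 2) : ℝ)) ^ 2 = n ^ 3 := by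
        rw [← Real.rpow_natCast, ← Real.rpow_mul hN'.le, hn, inv_pow, ← Real.rpow_natCast,
          ← Real.rpow_neg hN'.le]
        norm_num
      have a2 : (ε ^ (-(1 / 2) : ℝ)) ^ 2 * ε = 1 := by
        rw [← Real.rpow_natCast, ← Real.rpow_mul hε.le]
        norm_num
        rw [Real.rpow_neg_one, inv_mul_cancel₀ hε.ne']
      rw [hA, mul_pow, a1, mul_assoc, a2, mul_one]
    rw [← hA, hB]
    have hnε : n ≤ √ε := Real.le_sqrt_of_sq_le (not_le.1 h).le
    obtain ⟨M, hM⟩ : ∃ M, M = max A √ε := ⟨_, rfl⟩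
    rw [← hM]
    have M1 : A ≤ M := hM ▸ le_max_left _ _
    have M2 : √ε ≤ M := hM ▸ le_max_right _ _
    have M0 : 0 < M := A0.trans_le M1
    have A2' := pow_le_pow_left₀ A0.le M1 2
    have ε2' : ε ≤ M ^ 2 := by
      have := pow_le_pow_left₀ hs0.le M2 2
      rwa [hsq] at this
    refine ⟨by positivity, mul_le_mul_of_nonneg_left M2 hk.le,
      mul_le_mul_of_nonneg_left (hnε.trans M2) hk.le, ?_, Or.inr ?_⟩
    · rw [mul_pow, ← A2, show M ^ 4 = M ^ 2 * M ^ 2 by ring]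
      exact mul_le_mul_of_nonneg_left (mul_le_mul A2' ε2' hε.le (by positivity)) (by positivity)
    · rw [mul_pow, ← A2, mul_assoc]
      exact mul_le_mul_of_nonneg_left (mul_le_mul_of_nonneg_right A2' hε.le) (by positivity)

end Sigma

/-- The inequalities between the mesh parameters and the parameters of the weight that hold when
`k ≥ 5`. -/
structure MeshParams (β ε k : ℝ) (N : ℕ) : Prop where
  N6 : 6 ≤ N
  N2 : 2 ∣ N
  N3 : 3 ∣ N
  β0 : 0 < β
  ε0 : 0 < ε
  εn : ε ≤ (N : ℝ)⁻¹
  k5 : 5 ≤ k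
  lx : lambdaX β ε N = rho * (ε / β) * Real.log N
  ly : lambdaY ε N = rho * √ε * Real.log N

namespace MeshParams

variable {β ε k : ℝ} {N : ℕ} (h : MeshParams β ε k N)

include h

lemma N0 : 0 < N := by have := h.N6; omega

lemma n_pos : 0 < (N : ℝ)⁻¹ := by have := h.N0; positivity

lemma k_pos : 0 < k := by linarith [h.k5]

lemma lambdaX_pos : 0 < lambdaX β ε N := by
  rw [h.lx, rho]
  have := one_le_log h.N6
  have := h.β0
  have := h.ε0
  positivity

lemma lambdaY_pos : 0 < lambdaY ε N := by
  rw [h.ly, rho]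
  have := one_le_log h.N6
  have := Real.sqrt_pos.2 h.ε0
  positivity

lemma strictMonoX : StrictMono (meshX β ε N) := meshX_strictMono h.N0 h.N2 h.lambdaX_pos

lemma strictMonoY : StrictMono (meshY ε N) := meshY_strictMono h.N0 h.N3 h.lambdaY_pos

lemma sigmaX_pos : 0 < sigmaX k ε N := (sigmaX_bounds h.k_pos h.N6 h.ε0).1

lemma sigmaY_pos : 0 < sigmaY k ε N := (sigmaY_bounds h.k_pos h.N0 h.ε0).1

lemma inv_sigmaX_mul_le {a : ℝ} (ha : k * a ≤ sigmaX k ε N) : a * (sigmaX k ε N)⁻¹ ≤ k⁻¹ := by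
  have h1 := h.k_pos
  have h2 := h.sigmaX_pos
  rw [← div_eq_mul_inv, div_le_iff₀ h2, ← div_eq_inv_mul, le_div_iff₀ h1]
  linarith

lemma inv_sigmaY_mul_le {a : ℝ} (ha : k * a ≤ sigmaY k ε N) : a * (sigmaY k ε N)⁻¹ ≤ k⁻¹ := by
  have h1 := h.k_pos
  have h2 := h.sigmaY_pos
  rw [← div_eq_mul_inv, div_le_iff₀ h2, ← div_eq_inv_mul, le_div_iff₀ h1]
  linarith

lemma n_uy4 : ((N : ℝ)⁻¹) ^ 3 * (sigmaY k ε N)⁻¹ ^ 4 ≤ k⁻¹ ^ 4 := by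
  have h1 := h.k_pos
  have h2 := h.sigmaY_pos
  rw [inv_pow (sigmaY k ε N), inv_pow k, ← div_eq_mul_inv, div_le_iff₀ (by positivity),
    ← div_eq_inv_mul, le_div_iff₀ (by positivity)]
  linarith [(sigmaY_bounds h.k_pos h.N0 h.ε0).2.2.2.1]

lemma stepX_le (i : ℕ) : meshX β ε N (i + 1) - meshX β ε N i ≤ 2 * (N : ℝ)⁻¹ :=
  meshX_step_le h.N0 h.N2 h.lambdaX_pos i

lemma stepY_le (j : ℕ) : meshY ε N (j + 1) - meshY ε N j ≤ 3 * (N : ℝ)⁻¹ :=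
  meshY_step_le h.N0 h.N3 h.lambdaY_pos j

lemma stepX_pos (i : ℕ) : 0 < meshX β ε N (i + 1) - meshX β ε N i :=
  sub_pos.2 (h.strictMonoX i.lt_succ_self)

lemma stepY_pos (j : ℕ) : 0 < meshY ε N (j + 1) - meshY ε N j :=
  sub_pos.2 (h.strictMonoY j.lt_succ_self)

lemma stepX_le_sigmaX (i : ℕ) : meshX β ε N (i + 1) - meshX β ε N i ≤ sigmaX k ε N := by
  have h1 := h.stepX_le i
  have h2 := (sigmaX_bounds h.k_pos h.N6 h.ε0).2.1
  have h3 := mul_le_mul_of_nonneg_right h.k5 h.n_pos.le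
  linarith [h.n_pos]

lemma stepY_le_sigmaY (j : ℕ) : meshY ε N (j + 1) - meshY ε N j ≤ sigmaY k ε N := by
  have h1 := h.stepY_le j
  have h2 := (sigmaY_bounds h.k_pos h.N0 h.ε0).2.2.1
  have h3 := mul_le_mul_of_nonneg_right h.k5 h.n_pos.le
  linarith [h.n_pos]

lemma cellParams (xa ya p q r : ℝ) (i j : ℕ) :
    CellParams k⁻¹ (N : ℝ)⁻¹ ε √ε (meshX β ε N (i + 1) - meshX β ε N i)
      (meshY ε N (j + 1) - meshY ε N j) (sigmaX k ε N)⁻¹ (sigmaY k ε N)⁻¹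
      (wP xa (sigmaX k ε N) (meshX β ε N i) * wQ ya (sigmaY k ε N) (meshY ε N j))
      (wP1 xa (sigmaX k ε N) (meshX β ε N i) * wQ ya (sigmaY k ε N) (meshY ε N j))
      (|p + q * meshX β ε N i + r * meshY ε N j| + |q| * (meshX β ε N (i + 1) - meshX β ε N i)
        + |r| * (meshY ε N (j + 1) - meshY ε N j)) |q| |r| := by
  have hk := h.k_pos
  have hn := h.n_pos
  have hx := h.stepX_pos i
  have hy := h.stepY_pos j
  have sx := sigmaX_bounds h.k_pos h.N6 h.ε0
  have sy := sigmaY_bounds h.k_pos h.N0 h.ε0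
  have hσx := sx.1
  have hσy := sy.1
  have hP := wP_pos xa (sigmaX k ε N) (meshX β ε N i)
  have hP1 := wP1_pos hσx xa (meshX β ε N i)
  have hQ := wQ_pos ya (sigmaY k ε N) (meshY ε N j)
  have hN1 : (1 : ℝ) ≤ N := by exact_mod_cast h.N0
  refine ⟨by positivity, ?_, by positivity, inv_le_one_of_one_le₀ hN1, by positivity,
    Real.mul_self_sqrt h.ε0.le, by positivity, by positivity, by positivity, by positivity,
    by positivity, by positivity, by positivity, by positivity, by positivity, h.stepX_le i,
    h.stepY_le j, h.inv_sigmaX_mul_le sx.2.1, h.inv_sigmaX_mul_le sx.2.2.1,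
    h.inv_sigmaY_mul_le sy.2.1, h.inv_sigmaY_mul_le sy.2.2.1, h.n_uy4, ?_, ?_, ?_, ?_⟩
  · rw [← div_eq_mul_inv, div_le_one hk]; exact h.k5
  · have e : ∀ a b : ℝ, k ^ 2 * a ≤ sigmaY k ε N ^ 2 * b →
        a * (sigmaY k ε N)⁻¹ ^ 2 ≤ k⁻¹ ^ 2 * b := by
      intro a b hab
      rw [inv_pow, inv_pow k, ← div_eq_mul_inv, div_le_iff₀ (by positivity), mul_assoc,
        ← div_eq_inv_mul, le_div_iff₀ (by positivity)]
      linarith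
    rcases sy.2.2.2.2 with h' | h'
    · left
      simpa using e _ 1 (by simpa using h')
    · exact Or.inr (e _ _ h')
  · have := mul_le_mul_of_nonneg_right (wP1_le hσx xa (meshX β ε N i)) hQ.le
    linarith
  · have : 0 ≤ |r| * (meshY ε N (j + 1) - meshY ε N j) := by positivity
    linarith [abs_nonneg (p + q * meshX β ε N i + r * meshY ε N j)]
  · have : 0 ≤ |q| * (meshX β ε N (i + 1) - meshX β ε N i) := by positivity
    linarith [abs_nonneg (p + q * meshX β ε N i + r * meshY ε N j)]

/-- In the layer at `x = 1` the ratios of the mesh sizes and the weight parameters compensate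
the width of the layer. -/
lemma layer_ratio_le {i : ℕ} (hi : N ≤ 2 * i) (j : ℕ) :
    ((meshX β ε N (i + 1) - meshX β ε N i) * (sigmaX k ε N)⁻¹
      + (meshY ε N (j + 1) - meshY ε N j) * (sigmaY k ε N)⁻¹) * lambdaX β ε N
      ≤ (25 / 2 / β ^ 2 + 30 / β) * (k⁻¹ * ε) := by
  have hk := h.k_pos
  have hn := h.n_pos
  have hβ := h.β0
  have hε := h.ε0
  have hl := one_le_log h.N6
  have hl0 := h.lambdaX_pos
  have sx := sigmaX_bounds h.k_pos h.N6 h.ε0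
  have hux := inv_pos.2 h.sigmaX_pos
  have huy := inv_pos.2 h.sigmaY_pos
  have hN1 : (N : ℝ)⁻¹ ≤ 1 := inv_le_one_of_one_le₀ (by exact_mod_cast h.N0)
  have X : (meshX β ε N (i + 1) - meshX β ε N i) * (sigmaX k ε N)⁻¹ * lambdaX β ε N
      ≤ 25 / 2 / β ^ 2 * (k⁻¹ * ε) := by
    have h1 := h.inv_sigmaX_mul_le sx.2.2.2
    rw [meshX_step_fine h.N0 hi, h.lx, rho]
    -- The step is `2 λ_x/N`, so `λ_x` occurs squared and `ε ln² N` is cancelled by `σ_x`.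
    calc _ = 25 / 2 / β ^ 2 * ε * (N : ℝ)⁻¹ * (ε * Real.log N ^ 2 * (sigmaX k ε N)⁻¹) := by
          field_simp; ring
      _ ≤ 25 / 2 / β ^ 2 * ε * 1 * k⁻¹ := by gcongr
      _ = _ := by ring
  have Y : (meshY ε N (j + 1) - meshY ε N j) * (sigmaY k ε N)⁻¹ * lambdaX β ε N
      ≤ 30 / β * (k⁻¹ * ε) := by
    obtain ⟨m, hm⟩ : ∃ m, m = ((N : ℝ)⁻¹) ^ (1 / 4 : ℝ) := ⟨_, rfl⟩
    have m0 : 0 < m := hm ▸ Real.rpow_pos_of_pos hn _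
    have m4 : m ^ 4 = (N : ℝ)⁻¹ := by
      rw [hm, ← Real.rpow_natCast, ← Real.rpow_mul hn.le]; norm_num
    -- Fourth root of `n_uy4` multiplied by `N⁻¹`; the gain `m = N^(-1/4)` defeats the logarithm in
    -- `λ_x`.
    have h1 : (N : ℝ)⁻¹ * (sigmaY k ε N)⁻¹ ≤ k⁻¹ * m := by
      refine le_of_pow_le_pow_left₀ (n := 4) (by norm_num) (by positivity) ?_
      rw [mul_pow, mul_pow, m4]
      have := mul_le_mul_of_nonneg_right h.n_uy4 hn.le
      linarith
    have h2 := log_mul_rpow_le h.N0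
    rw [← hm] at h2
    rw [h.lx, rho]
    calc _ ≤ 3 * (N : ℝ)⁻¹ * (sigmaY k ε N)⁻¹ * (5 / 2 * (ε / β) * Real.log N) := by
          gcongr; exact h.stepY_le j
      _ = 15 / 2 * (ε / β) * Real.log N * ((N : ℝ)⁻¹ * (sigmaY k ε N)⁻¹) := by ring
      _ ≤ 15 / 2 * (ε / β) * Real.log N * (k⁻¹ * m) := by gcongr
      _ = 15 / 2 * (ε / β) * k⁻¹ * (Real.log N * m) := by ring
      _ ≤ 15 / 2 * (ε / β) * k⁻¹ * 4 := by gcongr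
      _ = _ := by ring
  linarith

end MeshParams

/-! ### Elementwise representation of the discrete function and of the interpolation error -/

/-- The parameters of the mesh and of the weight, together with the coefficients of a piecewise
affine function. -/
structure LocalRep where
  β : ℝ
  ε : ℝ
  k : ℝ
  N : ℕ
  xa : ℝ
  ya : ℝ
  p : ℕ → ℕ → Bool → ℝ
  q : ℕ → ℕ → Bool → ℝ
  r : ℕ → ℕ → Bool → ℝ

namespace LocalRep

variable (D : LocalRep)

/-- Mesh points in `x`. -/
abbrev xs : ℕ → ℝ := meshX D.β D.ε D.N

/-- Mesh points in `y`. -/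
abbrev ys : ℕ → ℝ := meshY D.ε D.N

/-- The scale of the weight in `x`. -/
abbrev σx : ℝ := sigmaX D.k D.ε D.N

/-- The scale of the weight in `y`. -/
abbrev σy : ℝ := sigmaY D.k D.ε D.N

/-- The inverse weight. -/
def F (z : ℝ × ℝ) : ℝ := wP D.xa D.σx z.1 * wQ D.ya D.σy z.2

/-- The `x`-derivative of the inverse weight. -/
def Fx (z : ℝ × ℝ) : ℝ := wP1 D.xa D.σx z.1 * wQ D.ya D.σy z.2

/-- The affine function on a triangle. -/
def G (i j : ℕ) (t : Bool) (z : ℝ × ℝ) : ℝ := D.p i j t + D.q i j t * z.1 + D.r i j t * z.2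

/-- The product of the inverse weight and the affine function on a triangle. -/
abbrev w (i j : ℕ) (t : Bool) : ℝ × ℝ → ℝ :=
  wG D.xa D.σx D.ya D.σy (D.p i j t) (D.q i j t) (D.r i j t)

/-- The `x`-derivative of `w`. -/
abbrev wx (i j : ℕ) (t : Bool) : ℝ × ℝ → ℝ :=
  wGx D.xa D.σx D.ya D.σy (D.p i j t) (D.q i j t) (D.r i j t)

/-- The `y`-derivative of `w`. -/
abbrev wy (i j : ℕ) (t : Bool) : ℝ × ℝ → ℝ :=
  wGy D.xa D.σx D.ya D.σy (D.p i j t) (D.q i j t) (D.r i j t)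

/-- The Laplacian of `w`. -/
abbrev wlap (i j : ℕ) (t : Bool) : ℝ × ℝ → ℝ :=
  wGlap D.xa D.σx D.ya D.σy (D.p i j t) (D.q i j t) (D.r i j t)

/-- The abscissa of the vertex with the right angle. -/
def cx (i : ℕ) (t : Bool) : ℝ := if t then D.xs (i + 1) else D.xs i

/-- The ordinate of the vertex with the right angle. -/
def cy (j : ℕ) (t : Bool) : ℝ := if t then D.ys (j + 1) else D.ys j

/-- The slope of the interpolant in `x`. -/
def sx (i j : ℕ) (t : Bool) : ℝ :=
  (D.w i j t (D.xs (i + 1), D.cy j t) - D.w i j t (D.xs i, D.cy j t)) / (D.xs (i + 1) - D.xs i)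

/-- The slope of the interpolant in `y`. -/
def sy (i j : ℕ) (t : Bool) : ℝ :=
  (D.w i j t (D.cx i t, D.ys (j + 1)) - D.w i j t (D.cx i t, D.ys j)) / (D.ys (j + 1) - D.ys j)

/-- The interpolation error. -/
def E (i j : ℕ) (t : Bool) (z : ℝ × ℝ) : ℝ :=
  D.w i j t (D.cx i t, D.cy j t) + (z.1 - D.cx i t) * D.sx i j t + (z.2 - D.cy j t) * D.sy i j t
    - D.w i j t z

/-- The `x`-derivative of the interpolation error. -/
def Ex (i j : ℕ) (t : Bool) (z : ℝ × ℝ) : ℝ := D.sx i j t - D.wx i j t z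

/-- The `y`-derivative of the interpolation error. -/
def Ey (i j : ℕ) (t : Bool) (z : ℝ × ℝ) : ℝ := D.sy i j t - D.wy i j t z

@[fun_prop] lemma continuous_F : Continuous D.F := by unfold F; fun_prop
@[fun_prop] lemma continuous_Fx : Continuous D.Fx := by unfold Fx; fun_prop
@[fun_prop] lemma continuous_G (i j : ℕ) (t : Bool) : Continuous (D.G i j t) := by
  unfold G; fun_prop
@[fun_prop] lemma continuous_E (i j : ℕ) (t : Bool) : Continuous (D.E i j t) := by
  unfold E; fun_prop
@[fun_prop] lemma continuous_Ex (i j : ℕ) (t : Bool) : Continuous (D.Ex i j t) := by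
  unfold Ex; fun_prop
@[fun_prop] lemma continuous_Ey (i j : ℕ) (t : Bool) : Continuous (D.Ey i j t) := by
  unfold Ey; fun_prop

lemma w_eq (i j : ℕ) (t : Bool) (z : ℝ × ℝ) : D.w i j t z = D.F z * D.G i j t z := rfl

lemma hasDerivAt_F (x y : ℝ) : HasDerivAt (fun s => D.F (s, y)) (D.Fx (x, y)) x :=
  (hasDerivAt_wP D.xa D.σx x).mul_const (wQ D.ya D.σy y)

lemma hasDerivAt_G_fst (i j : ℕ) (t : Bool) (x y : ℝ) :
    HasDerivAt (fun s => D.G i j t (s, y)) (D.q i j t) x :=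
  hasDerivAt_affine_fst _ _ _ x y

lemma hasDerivAt_G_snd (i j : ℕ) (t : Bool) (x y : ℝ) :
    HasDerivAt (fun s => D.G i j t (x, s)) (D.r i j t) y :=
  hasDerivAt_affine_snd _ _ _ x y

lemma hasDerivAt_E_fst (i j : ℕ) (t : Bool) (x y : ℝ) :
    HasDerivAt (fun s => D.E i j t (s, y)) (D.Ex i j t (x, y)) x := by
  have h1 := ((((hasDerivAt_id x).sub_const (D.cx i t)).mul_const (D.sx i j t)).const_add
    (D.w i j t (D.cx i t, D.cy j t))).add_const ((y - D.cy j t) * D.sy i j t)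
  exact (h1.sub (hasDerivAt_wG_fst _ _ _ _ _ _ _ x y)).congr_deriv (by rw [one_mul]; rfl)

lemma hasDerivAt_E_snd (i j : ℕ) (t : Bool) (x y : ℝ) :
    HasDerivAt (fun s => D.E i j t (x, s)) (D.Ey i j t (x, y)) y := by
  have h1 := ((((hasDerivAt_id y).sub_const (D.cy j t)).mul_const (D.sy i j t)).const_add
    (D.w i j t (D.cx i t, D.cy j t) + (x - D.cx i t) * D.sx i j t))
  exact (h1.sub (hasDerivAt_wG_snd _ _ _ _ _ _ _ x y)).congr_deriv (by rw [one_mul]; rfl)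

lemma dx_E (i j : ℕ) (t : Bool) : dx (D.E i j t) = D.Ex i j t :=
  funext fun z => (D.hasDerivAt_E_fst i j t z.1 z.2).deriv

lemma dy_E (i j : ℕ) (t : Bool) : dy (D.E i j t) = D.Ey i j t :=
  funext fun z => (D.hasDerivAt_E_snd i j t z.1 z.2).deriv

lemma dx_G (i j : ℕ) (t : Bool) : dx (D.G i j t) = fun _ => D.q i j t :=
  funext fun z => (D.hasDerivAt_G_fst i j t z.1 z.2).deriv

lemma dy_G (i j : ℕ) (t : Bool) : dy (D.G i j t) = fun _ => D.r i j t :=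
  funext fun z => (D.hasDerivAt_G_snd i j t z.1 z.2).deriv

lemma dx_F : dx D.F = D.Fx := funext fun z => (D.hasDerivAt_F z.1 z.2).deriv

lemma laplacian_E (i j : ℕ) (t : Bool) (z : ℝ × ℝ) :
    dx (D.Ex i j t) z + dy (D.Ey i j t) z = -D.wlap i j t z := by
  have h1 : dx (D.Ex i j t) z = _ :=
    ((hasDerivAt_wGx_fst D.xa D.σx D.ya D.σy (D.p i j t) (D.q i j t) (D.r i j t) z.1 z.2).const_sub
      (D.sx i j t)).deriv
  have h2 : dy (D.Ey i j t) z = _ :=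
    ((hasDerivAt_wGy_snd D.xa D.σx D.ya D.σy (D.p i j t) (D.q i j t) (D.r i j t) z.1 z.2).const_sub
      (D.sy i j t)).deriv
  rw [h1, h2, wlap, wGlap]; ring

lemma F_pos (z : ℝ × ℝ) : 0 < D.F z := mul_pos (wP_pos _ _ _) (wQ_pos _ _ _)

/-- The function `u` is represented by the coefficients of `D`. -/
structure Represents (u : ℝ × ℝ → ℝ) : Prop where
  eq : ∀ i < D.N, ∀ j < D.N, ∀ t, ∀ z ∈ closedTri D.xs D.ys i j t, u z = D.G i j t z
  zero : ∀ z ∈ frontier Omega, u z = 0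

/-! ### Continuity across edges, and the identities obtained by integrating in `x` -/

section Traces

variable {D} (h : MeshParams D.β D.ε D.k D.N) {u : ℝ × ℝ → ℝ} (hu : D.Represents u)

include h

lemma Fx_nonneg (z : ℝ × ℝ) : 0 ≤ D.Fx z :=
  mul_nonneg (wP1_pos h.sigmaX_pos _ _).le (wQ_pos _ _ _).le

lemma vertex_mem_closedTri (i j : ℕ) :
    (D.xs i, D.ys j) ∈ closedTri D.xs D.ys i j false ∧
    (D.xs (i + 1), D.ys j) ∈ closedTri D.xs D.ys i j false ∧
    (D.xs i, D.ys (j + 1)) ∈ closedTri D.xs D.ys i j false ∧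
    (D.xs i, D.ys (j + 1)) ∈ closedTri D.xs D.ys i j true ∧
    (D.xs (i + 1), D.ys j) ∈ closedTri D.xs D.ys i j true ∧
    (D.xs (i + 1), D.ys (j + 1)) ∈ closedTri D.xs D.ys i j true := by
  have h1 := (h.strictMonoX i.lt_succ_self).le
  have h2 := (h.strictMonoY j.lt_succ_self).le
  simp only [Nat.succ_eq_add_one] at h1 h2
  simp [closedTri, leftEdge, rightEdge, diag_left h.strictMonoY, diag_right, h1, h2]

lemma edge_mem_closedTri (i j : ℕ) {y : ℝ} (hy : y ∈ Set.Ioo (D.ys j) (D.ys (j + 1))) :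
    (D.xs i, y) ∈ closedTri D.xs D.ys i j false ∧
    (diag D.xs D.ys i j y, y) ∈ closedTri D.xs D.ys i j false ∧
    (diag D.xs D.ys i j y, y) ∈ closedTri D.xs D.ys i j true ∧
    (D.xs (i + 1), y) ∈ closedTri D.xs D.ys i j true := by
  have h1 := le_diag h.strictMonoX h.strictMonoY (i := i) hy.2.le
  have h2 := diag_le h.strictMonoX h.strictMonoY (i := i) hy.1.le
  simp [closedTri, leftEdge, rightEdge, h1, h2, hy.1.le, hy.2.le]

lemma boundary_mem_frontier_Omega {j : ℕ} (hj : j < D.N) {y : ℝ} (hy : y ∈ Set.Icc (D.ys j) (D.ys (j + 1))) :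
    ((0 : ℝ), y) ∈ frontier Omega ∧ ((1 : ℝ), y) ∈ frontier Omega := by
  have h0 : D.ys 0 ≤ D.ys j := h.strictMonoY.monotone (Nat.zero_le _)
  have h1 : D.ys (j + 1) ≤ D.ys D.N := h.strictMonoY.monotone hj
  rw [show D.ys 0 = 0 from meshY_zero] at h0
  rw [show D.ys D.N = 1 from meshY_last h.N0] at h1
  have hy' : y ∈ Set.Icc (0 : ℝ) 1 := ⟨h0.trans hy.1, hy.2.trans h1⟩
  rw [Omega, frontier_prod_eq, closure_Ioo (by norm_num), frontier_Ioo (by norm_num)]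
  simp [hy'.1, hy'.2]

include hu

omit h in
lemma Represents.w_eq {i j : ℕ} (hi : i < D.N) (hj : j < D.N) {t : Bool} {z : ℝ × ℝ}
    (hz : z ∈ closedTri D.xs D.ys i j t) : D.w i j t z = D.F z * u z := by
  rw [D.w_eq, hu.eq i hi j hj t z hz]

/-- The trace of the interpolation error on a vertical edge. -/
lemma E_left {i j : ℕ} (hi : i < D.N) (hj : j < D.N) {y : ℝ}
    (hy : y ∈ Set.Ioo (D.ys j) (D.ys (j + 1))) :
    D.E i j false (D.xs i, y) = D.F (D.xs i, D.ys j) * u (D.xs i, D.ys j)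
      + (y - D.ys j) / (D.ys (j + 1) - D.ys j) * (D.F (D.xs i, D.ys (j + 1)) *
        u (D.xs i, D.ys (j + 1)) - D.F (D.xs i, D.ys j) * u (D.xs i, D.ys j))
      - D.F (D.xs i, y) * u (D.xs i, y) := by
  have V := vertex_mem_closedTri h (D := D) i j
  have e := edge_mem_closedTri h (D := D) i j hy
  simp only [E, sy, cx, cy, Bool.false_eq_true, if_false]
  rw [hu.w_eq hi hj V.1, hu.w_eq hi hj V.2.2.1, hu.w_eq hi hj e.1]
  ring

/-- The interpolant is anchored at the upper vertex here, but its trace is rewritten from the lower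
one so that it matches the form of `E_left` in the next cell. -/
lemma E_right {i j : ℕ} (hi : i < D.N) (hj : j < D.N) {y : ℝ}
    (hy : y ∈ Set.Ioo (D.ys j) (D.ys (j + 1))) :
    D.E i j true (D.xs (i + 1), y) = D.F (D.xs (i + 1), D.ys j) * u (D.xs (i + 1), D.ys j)
      + (y - D.ys j) / (D.ys (j + 1) - D.ys j) * (D.F (D.xs (i + 1), D.ys (j + 1)) *
        u (D.xs (i + 1), D.ys (j + 1)) - D.F (D.xs (i + 1), D.ys j) * u (D.xs (i + 1), D.ys j))
      - D.F (D.xs (i + 1), y) * u (D.xs (i + 1), y) := by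
  have V := vertex_mem_closedTri h (D := D) i j
  have e := edge_mem_closedTri h (D := D) i j hy
  have hn : D.ys (j + 1) - D.ys j ≠ 0 := (h.stepY_pos j).ne'
  simp only [E, sy, cx, cy, if_true]
  rw [hu.w_eq hi hj V.2.2.2.2.1, hu.w_eq hi hj V.2.2.2.2.2, hu.w_eq hi hj e.2.2.2]
  field_simp
  ring

/-- Along the diagonal both interpolants are affine with the same values at its endpoints, and both
local formulas for the discrete function give the values of `u`. -/
lemma E_diag {i j : ℕ} (hi : i < D.N) (hj : j < D.N) {y : ℝ}
    (hy : y ∈ Set.Ioo (D.ys j) (D.ys (j + 1))) :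
    D.E i j false (diag D.xs D.ys i j y, y) = D.E i j true (diag D.xs D.ys i j y, y) := by
  have V := vertex_mem_closedTri h (D := D) i j
  have e := edge_mem_closedTri h (D := D) i j hy
  have hn : D.ys (j + 1) - D.ys j ≠ 0 := (h.stepY_pos j).ne'
  have hm : D.xs (i + 1) - D.xs i ≠ 0 := (h.stepX_pos i).ne'
  have hd : diag D.xs D.ys i j y = D.xs i
      + (D.xs (i + 1) - D.xs i) * ((D.ys (j + 1) - y) / (D.ys (j + 1) - D.ys j)) := rfl
  simp only [E, sx, sy, cx, cy, Bool.false_eq_true, if_false, if_true]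
  rw [hu.w_eq hi hj V.1, hu.w_eq hi hj V.2.1, hu.w_eq hi hj V.2.2.1,
    hu.w_eq hi hj V.2.2.2.1, hu.w_eq hi hj V.2.2.2.2.1, hu.w_eq hi hj V.2.2.2.2.2,
    hu.w_eq hi hj e.2.1, hu.w_eq hi hj e.2.2.1]
  congr 1
  rw [hd]
  field_simp
  ring

/-- Integration by parts in `x` for the product of the interpolation error and the discrete
function. -/
lemma sum_integral_E_mul_G :
    ∑ K : Elt D.N, ∫ z in openTri D.xs D.ys K.1 K.2.1 K.2.2,
      (D.Ex K.1 K.2.1 K.2.2 z * D.G K.1 K.2.1 K.2.2 z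
        + D.E K.1 K.2.1 K.2.2 z * D.q K.1 K.2.1 K.2.2) = 0 := by
  refine sum_setIntegral_deriv_eq_zero h.strictMonoX h.strictMonoY
    (Φ := fun i j t z => D.E i j t z * D.G i j t z)
    (Φ' := fun i j t z => D.Ex i j t z * D.G i j t z + D.E i j t z * D.q i j t)
    (τ := fun i j y => (D.F (D.xs i, D.ys j) * u (D.xs i, D.ys j)
      + (y - D.ys j) / (D.ys (j + 1) - D.ys j) * (D.F (D.xs i, D.ys (j + 1)) *
        u (D.xs i, D.ys (j + 1)) - D.F (D.xs i, D.ys j) * u (D.xs i, D.ys j))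
      - D.F (D.xs i, y) * u (D.xs i, y)) * u (D.xs i, y))
    (fun i j t => by fun_prop) (fun i j t => by fun_prop)
    (fun i j t x y => (D.hasDerivAt_E_fst i j t x y).mul (D.hasDerivAt_G_fst i j t x y))
    ?_ ?_ ?_ ?_ ?_
  · intro i hi j hj y hy
    have e := edge_mem_closedTri h (D := D) i j hy
    rw [E_diag h hu hi hj hy, ← hu.eq i hi j hj _ _ e.2.1, ← hu.eq i hi j hj _ _ e.2.2.1]
  · intro i hi j hj y hy
    have e := edge_mem_closedTri h (D := D) i j hy
    rw [E_left h hu hi hj hy, ← hu.eq i hi j hj _ _ e.1]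
  · intro i hi j hj y hy
    have e := edge_mem_closedTri h (D := D) i j hy
    rw [E_right h hu hi hj hy, ← hu.eq i hi j hj _ _ e.2.2.2]
  · intro j hj y hy
    have := hu.zero _ (boundary_mem_frontier_Omega h hj (Set.Ioo_subset_Icc_self hy)).1
    simp only [show D.xs 0 = 0 from meshX_zero, this, mul_zero]
  · intro j hj y hy
    have := hu.zero _ (boundary_mem_frontier_Omega h hj (Set.Ioo_subset_Icc_self hy)).2
    simp only [show D.xs D.N = 1 from meshX_last h.N0, this, mul_zero]

/-- A weighted Poincaré inequality in the layer at `x = 1`. -/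
lemma poincare_layer :
    ∑ K : Elt D.N, (if D.N ≤ 2 * (K.1 : ℕ) then
        ∫ z in openTri D.xs D.ys K.1 K.2.1 K.2.2, D.F z * D.G K.1 K.2.1 K.2.2 z ^ 2 else 0)
      ≤ 4 * lambdaX D.β D.ε D.N ^ 2 * ∑ K : Elt D.N, (if D.N ≤ 2 * (K.1 : ℕ) then
        ∫ z in openTri D.xs D.ys K.1 K.2.1 K.2.2, D.F z * D.q K.1 K.2.1 K.2.2 ^ 2 else 0) := by
  obtain ⟨l, hl⟩ : ∃ l, l = lambdaX D.β D.ε D.N := ⟨_, rfl⟩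
  have hl0 : 0 < l := hl ▸ h.lambdaX_pos
  have hhalf : D.xs (D.N / 2) = 1 - l := by rw [hl]; exact meshX_half h.N2 h.N0
  -- The function `(x - (1-λ_x)) ω⁻¹ G²`, extended by zero to the left of the layer, vanishes at
  -- both ends of the layer.
  have key := sum_setIntegral_deriv_eq_zero h.strictMonoX h.strictMonoY (N := D.N)
    (Φ := fun i j t z => if D.N ≤ 2 * i then (z.1 - (1 - l)) * (D.F z * D.G i j t z ^ 2) else 0)
    (Φ' := fun i j t z => if D.N ≤ 2 * i then D.F z * D.G i j t z ^ 2
      + (z.1 - (1 - l)) * (D.Fx z * D.G i j t z ^ 2 + D.F z * (2 * D.G i j t z * D.q i j t)) else 0)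
    (τ := fun i j y => if D.N ≤ 2 * i then
      (D.xs i - (1 - l)) * (D.F (D.xs i, y) * u (D.xs i, y) ^ 2) else 0)
    (fun i j t => by split_ifs <;> fun_prop) (fun i j t => by split_ifs <;> fun_prop)
    (fun i j t x y => by
      split_ifs
      · refine HasDerivAt.congr_deriv (((hasDerivAt_id x).sub_const (1 - l)).mul
          ((D.hasDerivAt_F x y).mul ((D.hasDerivAt_G_fst i j t x y).pow 2))) ?_
        simp
      · exact hasDerivAt_const _ _)
    (by
      intro i hi j hj y hy
      have e := edge_mem_closedTri h (D := D) i j hy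
      simp only
      rw [← hu.eq i hi j hj _ _ e.2.1, ← hu.eq i hi j hj _ _ e.2.2.1])
    (by
      intro i hi j hj y hy
      have e := edge_mem_closedTri h (D := D) i j hy
      simp only
      rw [← hu.eq i hi j hj _ _ e.1])
    (by
      intro i hi j hj y hy
      have e := edge_mem_closedTri h (D := D) i j hy
      simp only
      rw [← hu.eq i hi j hj _ _ e.2.2.2]
      by_cases h1 : D.N ≤ 2 * i
      · rw [if_pos h1, if_pos (by omega)]
      · rw [if_neg h1]
        -- At the interface `i + 1 = N/2` the left cell contributes zero and the right one has the
        -- vanishing factor `x - (1-λ_x)`, so the traces agree.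
        by_cases h2 : D.N ≤ 2 * (i + 1)
        · have h3 : i + 1 = D.N / 2 := by have := h.N2; omega
          rw [if_pos h2, h3, hhalf, sub_self, zero_mul]
        · rw [if_neg h2])
    (by
      intro j hj y hy
      have := h.N0
      rw [if_neg (by omega)])
    (by
      intro j hj y hy
      have := hu.zero _ (boundary_mem_frontier_Omega h hj (Set.Ioo_subset_Icc_self hy)).2
      simp only [show D.xs D.N = 1 from meshX_last h.N0, this]
      simp)
  have each : ∀ K : Elt D.N,
      1 / 2 * (if D.N ≤ 2 * (K.1 : ℕ) then
        ∫ z in openTri D.xs D.ys K.1 K.2.1 K.2.2, D.F z * D.G K.1 K.2.1 K.2.2 z ^ 2 else 0)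
      - 2 * l ^ 2 * (if D.N ≤ 2 * (K.1 : ℕ) then
        ∫ z in openTri D.xs D.ys K.1 K.2.1 K.2.2, D.F z * D.q K.1 K.2.1 K.2.2 ^ 2 else 0)
      ≤ ∫ z in openTri D.xs D.ys K.1 K.2.1 K.2.2, (if D.N ≤ 2 * (K.1 : ℕ) then
        D.F z * D.G K.1 K.2.1 K.2.2 z ^ 2 + (z.1 - (1 - l)) * (D.Fx z * D.G K.1 K.2.1 K.2.2 z ^ 2
          + D.F z * (2 * D.G K.1 K.2.1 K.2.2 z * D.q K.1 K.2.1 K.2.2)) else 0) := by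
    rintro ⟨⟨i, hi⟩, ⟨j, hj⟩, t⟩
    by_cases h1 : D.N ≤ 2 * i
    · simp only [if_pos h1]
      have I : ∀ f : ℝ × ℝ → ℝ, Continuous f → IntegrableOn f (openTri D.xs D.ys i j t) :=
        fun f hf => integrableOn_openTri h.strictMonoX h.strictMonoY hf i j t
      rw [← integral_const_mul, ← integral_const_mul,
        ← integral_sub (I _ (by fun_prop)) (I _ (by fun_prop))]
      refine setIntegral_mono_on (I _ (by fun_prop)) (I _ (by fun_prop))
        (isOpen_openTri _ _ _ _ _).measurableSet fun z hz => ?_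
      have hc := openTri_subset_cell h.strictMonoX h.strictMonoY _ _ _ hz
      have z1 : 1 - l ≤ z.1 := by
        have h2 : D.xs (D.N / 2) ≤ D.xs i := h.strictMonoX.monotone (by omega)
        rw [hhalf] at h2
        exact h2.trans hc.1.1.le
      have z2 : z.1 ≤ 1 := by
        have h2 : D.xs (i + 1) ≤ D.xs D.N := h.strictMonoX.monotone hi
        rw [show D.xs D.N = 1 from meshX_last h.N0] at h2
        exact hc.1.2.le.trans h2
      obtain ⟨s, hs⟩ : ∃ s, s = z.1 - (1 - l) := ⟨_, rfl⟩
      have s0 : 0 ≤ s := by linarith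
      have s1 : s ≤ l := by linarith
      rw [← hs]
      have hF := (D.F_pos z).le
      have hFx : 0 ≤ D.Fx z := Fx_nonneg h z
      obtain ⟨g, hg⟩ : ∃ g, g = D.G i j t z := ⟨_, rfl⟩
      obtain ⟨q, hq⟩ : ∃ q, q = D.q i j t := ⟨_, rfl⟩
      rw [← hg, ← hq]
      -- The weight increases in `x`, so its derivative contributes with the favourable sign; the
      -- mixed term is removed by completing a square.
      have a1 : 0 ≤ s * (D.Fx z * g ^ 2) := by positivity
      have a2 : 0 ≤ 1 / 2 * D.F z * (g + 2 * s * q) ^ 2 := by positivity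
      have a3 : s ^ 2 ≤ l ^ 2 := pow_le_pow_left₀ s0 s1 2
      have a4 := mul_le_mul_of_nonneg_right a3 (by positivity : 0 ≤ D.F z * q ^ 2)
      linarith
    · simp only [if_neg h1]
      simp
  have S := Finset.sum_le_sum fun K (_ : K ∈ Finset.univ) => each K
  rw [key, Finset.sum_sub_distrib, ← Finset.mul_sum, ← Finset.mul_sum] at S
  rw [← hl]
  linarith

end Traces

end LocalRep

/-! ### Elementwise estimates -/

/-- The terms are, in order, diffusion in `x` and `y`, convection, reaction, and the three
stabilization products. `S'` is `S` plus the streamline term `n W q²`. -/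
lemma combine_bounds {b c s θ κ S S' T₁ T₂ T₃ T₄ T₅ T₆ T₇ : ℝ} (hb : 0 ≤ b) (hc : 0 ≤ c)
    (hs : 0 ≤ s) (hθ : 0 ≤ θ) (hκ : κ ≤ θ) (hS : 0 ≤ S) (hS' : S ≤ S')
    (h₁ : T₁ ≤ 400 * κ * S) (h₂ : T₂ ≤ 400 * κ * S) (h₃ : T₃ ≤ 600 * θ * S')
    (h₄ : T₄ ≤ 400 * κ * S) (h₅ : T₅ ≤ 600 * θ * S') (h₆ : T₆ ≤ 600 * θ * S')
    (h₇ : T₇ ≤ 600 * θ * S') :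
    T₁ + T₂ + b * T₃ + c * T₄ + s * b * (T₅ + b * T₆ + c * T₇)
      ≤ θ * (600 * (2 + b + c + s * b * (1 + b + c))) * S' := by
  have hκS : 400 * κ * S ≤ 600 * θ * S' := by
    have h1 := mul_le_mul_of_nonneg_right hκ hS
    have h2 := mul_le_mul_of_nonneg_left hS' hθ
    have h3 := mul_nonneg hθ (hS.trans hS')
    linarith
  have x3 := mul_le_mul_of_nonneg_left h₃ hb
  have x4 := mul_le_mul_of_nonneg_left (h₄.trans hκS) hc
  have x6 := mul_le_mul_of_nonneg_left h₆ hb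
  have x7 := mul_le_mul_of_nonneg_left h₇ hc
  have x8 := mul_le_mul_of_nonneg_left (add_le_add (add_le_add h₅ x6) x7) (mul_nonneg hs hb)
  linarith

namespace LocalRep

variable (D : LocalRep)

/-- The integrand of the bilinear form after integration by parts. -/
def formDensity (b c δ : ℝ) (i j : ℕ) (t : Bool) (z : ℝ × ℝ) : ℝ :=
  D.ε * (D.Ex i j t z * D.q i j t + D.Ey i j t z * D.r i j t) - b * (D.E i j t z * D.q i j t)
    + c * (D.E i j t z * D.G i j t z)
    + δ * b * (D.q i j t * (D.ε * D.wlap i j t z) + b * (D.q i j t * D.Ex i j t z)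
      + c * (D.q i j t * D.E i j t z))

/-- The integrand of the squared weighted energy norm. -/
def normDensity (b c δ : ℝ) (i j : ℕ) (t : Bool) (z : ℝ × ℝ) : ℝ :=
  D.ε * (D.F z * D.q i j t ^ 2) + D.ε * (D.F z * D.r i j t ^ 2)
    + b / 2 * (D.Fx z * D.G i j t z ^ 2) + c * (D.F z * D.G i j t z ^ 2)
    + b ^ 2 * δ * (D.F z * D.q i j t ^ 2)

@[fun_prop] lemma continuous_formDensity (b c δ : ℝ) (i j : ℕ) (t : Bool) :
    Continuous (D.formDensity b c δ i j t) := by unfold formDensity; fun_prop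

@[fun_prop] lemma continuous_normDensity (b c δ : ℝ) (i j : ℕ) (t : Bool) :
    Continuous (D.normDensity b c δ i j t) := by unfold normDensity; fun_prop

/-- The mesh size in `x`. -/
abbrev hx (i : ℕ) : ℝ := D.xs (i + 1) - D.xs i

/-- The mesh size in `y`. -/
abbrev hy (j : ℕ) : ℝ := D.ys (j + 1) - D.ys j

/-- The inverse weight at a vertex of the cell. -/
abbrev W (i j : ℕ) : ℝ := wP D.xa D.σx (D.xs i) * wQ D.ya D.σy (D.ys j)

/-- The `x`-derivative of the inverse weight at a vertex of the cell. -/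
abbrev V (i j : ℕ) : ℝ := wP1 D.xa D.σx (D.xs i) * wQ D.ya D.σy (D.ys j)

/-- A bound for the affine function on the cell. -/
abbrev gmax (i j : ℕ) (t : Bool) : ℝ :=
  |D.p i j t + D.q i j t * D.xs i + D.r i j t * D.ys j| + |D.q i j t| * D.hx i
    + |D.r i j t| * D.hy j

/-- The bound for the `x`-derivative of the interpolation error on the cell. -/
abbrev BX (i j : ℕ) (t : Bool) : ℝ :=
  bX (D.hx i) (D.hy j) D.σx⁻¹ D.σy⁻¹ (D.W i j) (D.V i j) (D.gmax i j t) |D.q i j t| |D.r i j t|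

/-- The bound for the `y`-derivative of the interpolation error on the cell. -/
abbrev BY (i j : ℕ) (t : Bool) : ℝ :=
  bY (D.hx i) (D.hy j) D.σy⁻¹ (D.W i j) (D.V i j) (D.gmax i j t) |D.q i j t| |D.r i j t|

/-- The bound for the Laplacian of the interpolation error on the cell. -/
abbrev BL (i j : ℕ) (t : Bool) : ℝ :=
  bL D.σx⁻¹ D.σy⁻¹ (D.W i j) (D.V i j) (D.gmax i j t) |D.q i j t| |D.r i j t|

/-- The bound for the interpolation error on the cell. -/
abbrev BE (i j : ℕ) (t : Bool) : ℝ := D.hx i * D.BX i j t + D.hy j * D.BY i j t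

section Bounds

variable {D} (h : MeshParams D.β D.ε D.k D.N)

include h

lemma cellParams' (i j : ℕ) (t : Bool) :
    CellParams D.k⁻¹ (D.N : ℝ)⁻¹ D.ε √D.ε (D.hx i) (D.hy j) D.σx⁻¹ D.σy⁻¹ (D.W i j) (D.V i j)
      (D.gmax i j t) |D.q i j t| |D.r i j t| :=
  h.cellParams D.xa D.ya (D.p i j t) (D.q i j t) (D.r i j t) i j

lemma cx_mem (i : ℕ) (t : Bool) : D.cx i t ∈ Set.Icc (D.xs i) (D.xs (i + 1)) := by
  have := h.stepX_pos i
  cases t <;> simp [cx] <;> linarith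

lemma cy_mem (j : ℕ) (t : Bool) : D.cy j t ∈ Set.Icc (D.ys j) (D.ys (j + 1)) := by
  have := h.stepY_pos j
  cases t <;> simp [cy] <;> linarith

lemma error_bounds (i j : ℕ) (t : Bool) {z : ℝ × ℝ}
    (hz : z ∈ Set.Icc (D.xs i) (D.xs (i + 1)) ×ˢ Set.Icc (D.ys j) (D.ys (j + 1))) :
    |D.Ex i j t z| ≤ D.BX i j t ∧ |D.Ey i j t z| ≤ D.BY i j t ∧ |D.E i j t z| ≤ D.BE i j t ∧
      |D.wlap i j t z| ≤ D.BL i j t ∧ |D.G i j t z| ≤ D.gmax i j t := by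
  have hX : ∀ s ∈ Set.Icc (D.xs i) (D.xs (i + 1)), ∀ y ∈ Set.Icc (D.ys j) (D.ys (j + 1)),
      |D.sx i j t - D.wx i j t (s, y)| ≤ D.BX i j t := fun s hs y hy =>
    abs_slope_sub_wGx_le h.sigmaX_pos h.sigmaY_pos (sub_pos.1 (h.stepX_pos i))
      (h.stepX_le_sigmaX i) (h.stepY_le_sigmaY j) hs hy (cy_mem h j t)
  have hY : ∀ s ∈ Set.Icc (D.xs i) (D.xs (i + 1)), ∀ y ∈ Set.Icc (D.ys j) (D.ys (j + 1)),
      |D.sy i j t - D.wy i j t (s, y)| ≤ D.BY i j t := fun s hs y hy =>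
    abs_slope_sub_wGy_le h.sigmaX_pos h.sigmaY_pos (sub_pos.1 (h.stepY_pos j))
      (h.stepX_le_sigmaX i) (h.stepY_le_sigmaY j) hs hy (cx_mem h i t)
  exact ⟨hX _ hz.1 _ hz.2, hY _ hz.1 _ hz.2,
    abs_interp_error_le (cx_mem h i t) (cy_mem h j t) hz.1 hz.2 hX hY,
    abs_wGlap_le h.sigmaX_pos h.sigmaY_pos (h.stepX_le_sigmaX i) (h.stepY_le_sigmaY j) hz.1 hz.2,
    cell_affine_bound hz.1 hz.2⟩

lemma abs_formDensity_le {b c δ : ℝ} (hb : 0 ≤ b) (hc : 0 ≤ c) (hδ : 0 ≤ δ) (i j : ℕ) (t : Bool)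
    {z : ℝ × ℝ} (hz : z ∈ Set.Icc (D.xs i) (D.xs (i + 1)) ×ˢ Set.Icc (D.ys j) (D.ys (j + 1))) :
    |D.formDensity b c δ i j t z| ≤ D.ε * D.BX i j t * |D.q i j t| + D.ε * D.BY i j t * |D.r i j t|
      + b * (D.BE i j t * |D.q i j t|) + c * (D.BE i j t * D.gmax i j t)
      + δ * b * (|D.q i j t| * (D.ε * D.BL i j t) + b * (|D.q i j t| * D.BX i j t)
        + c * (|D.q i j t| * D.BE i j t)) := by
  obtain ⟨e1, e2, e3, e4, e5⟩ := error_bounds h i j t hz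
  have aε : |D.ε| ≤ D.ε := (abs_of_pos h.ε0).le
  have ab : |b| ≤ b := (abs_of_nonneg hb).le
  have ac : |c| ≤ c := (abs_of_nonneg hc).le
  have aδ : |δ| ≤ δ := (abs_of_nonneg hδ).le
  have T1 := abs_mul_le_mul aε ((abs_add_le _ _).trans (add_le_add
    (abs_mul_le_mul e1 (le_refl |D.q i j t|)) (abs_mul_le_mul e2 (le_refl |D.r i j t|))))
  have T2 := abs_mul_le_mul ab (abs_mul_le_mul e3 (le_refl |D.q i j t|))
  have T3 := abs_mul_le_mul ac (abs_mul_le_mul e3 e5)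
  have T4 := abs_mul_le_mul (abs_mul_le_mul aδ ab) ((abs_add_three _ _ _).trans
    (add_le_add (add_le_add (abs_mul_le_mul (le_refl |D.q i j t|) (abs_mul_le_mul aε e4))
      (abs_mul_le_mul ab (abs_mul_le_mul (le_refl |D.q i j t|) e1)))
      (abs_mul_le_mul ac (abs_mul_le_mul (le_refl |D.q i j t|) e3))))
  unfold formDensity
  refine (abs_add_le _ _).trans ((add_le_add ((abs_add_le _ _).trans (add_le_add
    ((abs_sub _ _).trans (add_le_add T1 T2)) T3)) T4).trans (le_of_eq ?_))
  ring

/-- On a rectangle of comparable size the weights and the affine function are bounded below. -/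
lemma exists_rectangle_lower_bounds (i j : ℕ) (t : Bool) :
    ∃ u v : ℝ, Set.Icc u (u + D.hx i / 16) ×ˢ Set.Icc v (v + D.hy j / 16)
        ⊆ openTri D.xs D.ys i j t ∧
      ∀ z ∈ Set.Icc u (u + D.hx i / 16) ×ˢ Set.Icc v (v + D.hy j / 16),
        D.W i j ≤ 9 * D.F z ∧ D.V i j ≤ 9 * D.Fx z ∧ D.gmax i j t ^ 2 ≤ 400 * D.G i j t z ^ 2 := by
  obtain ⟨u, v, hsub, hg⟩ := exists_rectangle_affine_large h.strictMonoX h.strictMonoY i j t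
    (D.p i j t) (D.q i j t) (D.r i j t)
  refine ⟨u, v, hsub, fun z hz => ?_⟩
  have hc := closedTri_subset_cell h.strictMonoX h.strictMonoY i j t
    (openTri_subset_closedTri _ _ _ (hsub hz))
  obtain ⟨⟨-, B1⟩, ⟨-, B2⟩, -, B3⟩ := cell_weight_bounds (xa := D.xa) (ya := D.ya) h.sigmaX_pos
    h.sigmaY_pos (h.stepX_le_sigmaX i) (h.stepY_le_sigmaY j) hc.1 hc.2
  have hP := wP_pos D.xa D.σx z.1
  have hP1 := wP1_pos h.sigmaX_pos D.xa z.1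
  have hQ := wQ_pos D.ya D.σy (D.ys j)
  -- Each of the two weight factors costs 3, and `400 = 20²` comes from the rectangle lemma.
  refine ⟨?_, ?_, ?_⟩
  · have := mul_le_mul B1 B3 hQ.le (by positivity)
    unfold F; linarith
  · have := mul_le_mul B2 B3 hQ.le (by positivity)
    unfold Fx; linarith
  · have h0 : 0 ≤ D.gmax i j t := (cellParams' h i j t).g0
    have := pow_le_pow_left₀ h0 (hg z hz) 2
    rw [mul_pow, sq_abs] at this
    unfold G; linarith

/-- The density is nonnegative and large on the rectangle. The constant is `256 · 3600`: area ratio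
`16²`, weights 9, affine function 400. -/
lemma le_integral_normDensity {b c δ : ℝ} (hb : 0 ≤ b) (hc : 0 ≤ c) (hδ : 0 ≤ δ) (i j : ℕ)
    (t : Bool) :
    D.hx i * D.hy j * (D.ε * D.W i j * |D.q i j t| ^ 2 + D.ε * D.W i j * |D.r i j t| ^ 2
      + b / 2 * (D.V i j * D.gmax i j t ^ 2) + c * (D.W i j * D.gmax i j t ^ 2)
      + b ^ 2 * δ * (D.W i j * |D.q i j t| ^ 2))
      ≤ 921600 * ∫ z in openTri D.xs D.ys i j t, D.normDensity b c δ i j t z := by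
  obtain ⟨u, v, hsub, hm⟩ := exists_rectangle_lower_bounds h i j t
  have hε := h.ε0.le
  have hF := fun z => (D.F_pos z).le
  have hFx := Fx_nonneg h
  have L := le_setIntegral_openTri h.strictMonoX h.strictMonoY
    (D.continuous_normDensity b c δ i j t) hsub
    (fun z _ => by have := hF z; have := hFx z; unfold normDensity; positivity)
    (m := (D.ε * D.W i j * |D.q i j t| ^ 2 + D.ε * D.W i j * |D.r i j t| ^ 2
      + b / 2 * (D.V i j * D.gmax i j t ^ 2) + c * (D.W i j * D.gmax i j t ^ 2)
      + b ^ 2 * δ * (D.W i j * |D.q i j t| ^ 2)) / 3600) (fun z hz => by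
    obtain ⟨a1, a2, a3⟩ := hm z hz
    rw [sq_abs, sq_abs]
    have p := hF z
    have p' := hFx z
    have c1 := mul_le_mul a1 a3 (by positivity) (by positivity)
    have c2 := mul_le_mul a2 a3 (by positivity) (by positivity)
    have d1 := mul_le_mul_of_nonneg_right a1 (by positivity : 0 ≤ D.ε * D.q i j t ^ 2)
    have d2 := mul_le_mul_of_nonneg_right a1 (by positivity : 0 ≤ D.ε * D.r i j t ^ 2)
    have d3 := mul_le_mul_of_nonneg_left c2 (by positivity : 0 ≤ b / 2)
    have d4 := mul_le_mul_of_nonneg_left c1 hc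
    have d5 := mul_le_mul_of_nonneg_right a1 (by positivity : 0 ≤ b ^ 2 * δ * D.q i j t ^ 2)
    have f1 : 0 ≤ D.ε * (D.F z * D.q i j t ^ 2) := by positivity
    have f2 : 0 ≤ D.ε * (D.F z * D.r i j t ^ 2) := by positivity
    have f5 : 0 ≤ b ^ 2 * δ * (D.F z * D.q i j t ^ 2) := by positivity
    unfold normDensity
    linarith)
  linarith

lemma le_integral_F_mul_sq (i j : ℕ) (t : Bool) :
    D.hx i * D.hy j * (D.W i j * D.gmax i j t ^ 2)
      ≤ 921600 * ∫ z in openTri D.xs D.ys i j t, D.F z * D.G i j t z ^ 2 := by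
  obtain ⟨u, v, hsub, hm⟩ := exists_rectangle_lower_bounds h i j t
  have hF := fun z => (D.F_pos z).le
  have L := le_setIntegral_openTri h.strictMonoX h.strictMonoY
    (f := fun z => D.F z * D.G i j t z ^ 2) (by fun_prop) hsub
    (fun z _ => by have := hF z; positivity)
    (m := (D.W i j * D.gmax i j t ^ 2) / 3600) (fun z hz => by
    obtain ⟨a1, a2, a3⟩ := hm z hz
    have p := hF z
    have c1 := mul_le_mul a1 a3 (by positivity) (by positivity)
    linarith)
  linarith

lemma integral_normDensity_nonneg {b c δ : ℝ} (hb : 0 ≤ b) (hc : 0 ≤ c) (hδ : 0 ≤ δ) (i j : ℕ)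
    (t : Bool) : 0 ≤ ∫ z in openTri D.xs D.ys i j t, D.normDensity b c δ i j t z := by
  have hε := h.ε0.le
  refine setIntegral_nonneg (isOpen_openTri _ _ _ _ _).measurableSet fun z _ => ?_
  have := (D.F_pos z).le
  have : 0 ≤ D.Fx z := Fx_nonneg h z
  unfold normDensity
  positivity

/-- The estimate on a triangle with stabilization. -/
lemma integral_formDensity_le_coarse {b c Cs μ : ℝ} (hb : 0 < b) (hc : 0 < c) (hCs : 0 < Cs)
    (hμ : 0 < μ) (hμ1 : μ ≤ 1) (hμb : μ ≤ b / 2) (hμc : μ ≤ c) (hμs : μ ≤ b ^ 2 * Cs)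
    (i j : ℕ) (t : Bool) :
    ∫ z in openTri D.xs D.ys i j t, D.formDensity b c (Cs / D.N) i j t z
      ≤ √D.k⁻¹ * (552960000 * (2 + b + c + Cs * b * (1 + b + c)) / μ)
        * ∫ z in openTri D.xs D.ys i j t, D.normDensity b c (Cs / D.N) i j t z := by
  have P := cellParams' h i j t
  have hθ0 : 0 ≤ √D.k⁻¹ := Real.sqrt_nonneg _
  have hθ : D.k⁻¹ = √D.k⁻¹ ^ 2 := (Real.sq_sqrt P.κ0).symm
  have κθ := P.kappa_le_theta hθ0 hθ
  have hε := P.eps_nonneg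
  have hn := P.n0
  have hW := P.W0
  have hV := P.V0
  have hA : 0 ≤ D.hx i * D.hy j := mul_nonneg P.hx0 P.hy0
  have hδ : Cs / (D.N : ℝ) = Cs * (D.N : ℝ)⁻¹ := div_eq_mul_inv _ _
  have hδ0 : 0 ≤ Cs / (D.N : ℝ) := by rw [hδ]; positivity
  have low := le_integral_normDensity h hb.le hc.le hδ0 i j t
  have comb := combine_bounds hb.le hc.le hCs.le hθ0 κθ (by positivity) (by
      have : 0 ≤ (D.N : ℝ)⁻¹ * D.W i j * |D.q i j t| ^ 2 := by positivity
      linarith) P.eps_bX_mul_le P.eps_bY_mul_le (P.bE_mul_q_le hθ0 hθ) P.bE_mul_g_le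
    (P.n_bL_mul_le hθ0 hθ) (P.n_bX_mul_le hθ0 hθ) (P.n_bE_mul_le hθ0 hθ)
  obtain ⟨M, hM⟩ : ∃ M, M = 600 * (2 + b + c + Cs * b * (1 + b + c)) := ⟨_, rfl⟩
  have hM0 : 0 ≤ M := by rw [hM]; positivity
  obtain ⟨S, hS⟩ : ∃ S, S = D.ε * D.W i j * |D.q i j t| ^ 2 + D.ε * D.W i j * |D.r i j t| ^ 2
      + D.V i j * D.gmax i j t ^ 2 + D.W i j * D.gmax i j t ^ 2
      + (D.N : ℝ)⁻¹ * D.W i j * |D.q i j t| ^ 2 := ⟨_, rfl⟩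
  have hS0 : 0 ≤ S := by rw [hS]; positivity
  have up := setIntegral_openTri_le h.strictMonoX h.strictMonoY (i := i) (j := j) (t := t)
    (f := D.formDensity b c (Cs / D.N) i j t) (B := √D.k⁻¹ * M * S) (by positivity)
    (fun z hz => by
      refine (abs_formDensity_le h hb.le hc.le hδ0 i j t hz).trans (le_trans (le_of_eq ?_)
        (comb.trans (le_of_eq ?_)))
      · rw [hδ]; ring
      · rw [hM, hS])
  -- The constant `μ` bounds all coefficients of the norm from below, so the normalized sum `S` is
  -- comparable to the energy.
  have hlow : μ * S ≤ D.ε * D.W i j * |D.q i j t| ^ 2 + D.ε * D.W i j * |D.r i j t| ^ 2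
      + b / 2 * (D.V i j * D.gmax i j t ^ 2) + c * (D.W i j * D.gmax i j t ^ 2)
      + b ^ 2 * (Cs / D.N) * (D.W i j * |D.q i j t| ^ 2) := by
    have d1 := mul_le_mul_of_nonneg_right hμ1 (by positivity : 0 ≤ D.ε * D.W i j * |D.q i j t| ^ 2)
    have d2 := mul_le_mul_of_nonneg_right hμ1 (by positivity : 0 ≤ D.ε * D.W i j * |D.r i j t| ^ 2)
    have d3 := mul_le_mul_of_nonneg_right hμb (by positivity : 0 ≤ D.V i j * D.gmax i j t ^ 2)
    have d4 := mul_le_mul_of_nonneg_right hμc (by positivity : 0 ≤ D.W i j * D.gmax i j t ^ 2)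
    have d5 := mul_le_mul_of_nonneg_right hμs
      (by positivity : 0 ≤ (D.N : ℝ)⁻¹ * D.W i j * |D.q i j t| ^ 2)
    rw [hS, hδ]
    linarith
  obtain ⟨I, hI⟩ : ∃ I, I = ∫ z in openTri D.xs D.ys i j t, D.normDensity b c (Cs / D.N) i j t z :=
    ⟨_, rfl⟩
  rw [← hI] at low ⊢
  have l2 : D.hx i * D.hy j * S ≤ 921600 * I / μ := by
    rw [le_div_iff₀ hμ]
    have := mul_le_mul_of_nonneg_left hlow hA
    linarith
  calc _ ≤ D.hx i * D.hy j * (√D.k⁻¹ * M * S) := up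
    _ = √D.k⁻¹ * M * (D.hx i * D.hy j * S) := by ring
    _ ≤ √D.k⁻¹ * M * (921600 * I / μ) := mul_le_mul_of_nonneg_left l2 (by positivity)
    -- The constant is `552960000 = 600 · 921600`.
    _ = _ := by rw [hM]; ring

/-- The estimate on a triangle in the layer at `x = 1`. -/
lemma integral_formDensity_le_fine {b c μ : ℝ} (hb : 0 < b) (hc : 0 < c)
    (hμ : 0 < μ) (hμ1 : μ ≤ 1) (hμb : μ ≤ b / 2) (hμc : μ ≤ c)
    {i : ℕ} (hi : D.N ≤ 2 * i) (j : ℕ) (t : Bool) :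
    ∫ z in openTri D.xs D.ys i j t, D.formDensity b c 0 i j t z
      ≤ √D.k⁻¹ * (921600 * (400 * (2 + c) + 45 * b * (25 / 2 / D.β ^ 2 + 30 / D.β)) / μ)
        * (∫ z in openTri D.xs D.ys i j t, D.normDensity b c 0 i j t z)
      + 921600 * (45 * b * (25 / 2 / D.β ^ 2 + 30 / D.β)) * D.k⁻¹
        * (D.ε / lambdaX D.β D.ε D.N ^ 2)
        * ∫ z in openTri D.xs D.ys i j t, D.F z * D.G i j t z ^ 2 := by
  have P := cellParams' h i j t
  have hθ0 : 0 ≤ √D.k⁻¹ := Real.sqrt_nonneg _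
  have hθ : D.k⁻¹ = √D.k⁻¹ ^ 2 := (Real.sq_sqrt P.κ0).symm
  have κθ := P.kappa_le_theta hθ0 hθ
  have hε := P.eps_nonneg
  have hW := P.W0
  have hV := P.V0
  have hg0 := P.g0
  have κ0 := P.κ0
  have hβ := h.β0
  have hA : 0 ≤ D.hx i * D.hy j := mul_nonneg P.hx0 P.hy0
  have low := le_integral_normDensity h hb.le hc.le le_rfl i j t
  have low' := le_integral_F_mul_sq h i j t
  have t1 := P.eps_bX_mul_le
  have t2 := P.eps_bY_mul_le
  have t4 := P.bE_mul_g_le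
  obtain ⟨Cβ, hCβ⟩ : ∃ C, C = 25 / 2 / D.β ^ 2 + 30 / D.β := ⟨_, rfl⟩
  have hCβ0 : 0 ≤ Cβ := by rw [hCβ]; positivity
  obtain ⟨l, hl⟩ : ∃ l, l = lambdaX D.β D.ε D.N := ⟨_, rfl⟩
  have hl0 : 0 < l := hl ▸ h.lambdaX_pos
  -- Without a streamline term in the norm, the convection term is split by a Young inequality
  -- scaled with the layer width. The part with `ε/λ_x²` is left for the Poincaré inequality, which
  -- holds only after summation over the layer.
  have t3 : D.BE i j t * |D.q i j t| ≤ 45 * Cβ * D.k⁻¹ *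
      (D.ε / l ^ 2 * (D.W i j * D.gmax i j t ^ 2) + D.ε * D.W i j * |D.q i j t| ^ 2) := by
    obtain ⟨s, hs⟩ : ∃ s, s = D.hx i * D.σx⁻¹ + D.hy j * D.σy⁻¹ := ⟨_, rfl⟩
    have hs0 : 0 ≤ s := by
      rw [hs]; exact add_nonneg (mul_nonneg P.hx0 P.ux0) (mul_nonneg P.hy0 P.uy0)
    have s1 : s * l ≤ Cβ * (D.k⁻¹ * D.ε) := by
      rw [hs, hl, hCβ]; exact h.layer_ratio_le hi j
    have a1 := mul_le_mul_of_nonneg_right P.bE_le (abs_nonneg (D.q i j t))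
    rw [← hs] at a1
    have a2 : D.gmax i j t * |D.q i j t| ≤ l * (D.gmax i j t ^ 2 / l ^ 2 + |D.q i j t| ^ 2) := by
      have : 0 ≤ (D.gmax i j t / l - |D.q i j t|) ^ 2 + (D.gmax i j t / l) ^ 2
        + |D.q i j t| ^ 2 := by positivity
      have e : D.gmax i j t * |D.q i j t| = l * (D.gmax i j t / l * |D.q i j t|) := by
        field_simp
      rw [e]
      refine mul_le_mul_of_nonneg_left ?_ hl0.le
      rw [← div_pow]; linarith
    have a3 := mul_le_mul_of_nonneg_left a2 (mul_nonneg hs0 hW)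
    have a4 := mul_le_mul_of_nonneg_right s1
      (by positivity : 0 ≤ D.W i j * (D.gmax i j t ^ 2 / l ^ 2 + |D.q i j t| ^ 2))
    have e : D.ε / l ^ 2 * (D.W i j * D.gmax i j t ^ 2)
        = D.ε * D.W i j * (D.gmax i j t ^ 2 / l ^ 2) := by ring
    rw [e]
    linarith
  obtain ⟨S, hS⟩ : ∃ S, S = D.ε * D.W i j * |D.q i j t| ^ 2 + D.ε * D.W i j * |D.r i j t| ^ 2
      + D.V i j * D.gmax i j t ^ 2 + D.W i j * D.gmax i j t ^ 2 := ⟨_, rfl⟩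
  have hS0 : 0 ≤ S := by rw [hS]; positivity
  obtain ⟨Z, hZ⟩ : ∃ Z, Z = D.ε / l ^ 2 * (D.W i j * D.gmax i j t ^ 2) := ⟨_, rfl⟩
  have hZ0 : 0 ≤ Z := by rw [hZ]; positivity
  have hqS : D.ε * D.W i j * |D.q i j t| ^ 2 ≤ S := by
    have : 0 ≤ D.ε * D.W i j * |D.r i j t| ^ 2 + D.V i j * D.gmax i j t ^ 2
      + D.W i j * D.gmax i j t ^ 2 := by positivity
    rw [hS]; linarith
  rw [← hS] at t1 t2 t4
  rw [← hZ] at t3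
  have up := setIntegral_openTri_le h.strictMonoX h.strictMonoY (i := i) (j := j) (t := t)
    (f := D.formDensity b c 0 i j t)
    (B := √D.k⁻¹ * (400 * (2 + c) + 45 * b * Cβ) * S + 45 * b * Cβ * D.k⁻¹ * Z) (by positivity)
    (fun z hz => by
      refine (abs_formDensity_le h hb.le hc.le le_rfl i j t hz).trans ?_
      have κS := mul_le_mul_of_nonneg_right κθ hS0
      have x3 := mul_le_mul_of_nonneg_left t3 hb.le
      have x4 := mul_le_mul_of_nonneg_left t4 hc.le
      have x5 := mul_le_mul_of_nonneg_left κS hc.le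
      have x6 := mul_le_mul_of_nonneg_left hqS (by positivity : 0 ≤ 45 * b * Cβ * D.k⁻¹)
      have x7 := mul_le_mul_of_nonneg_left κS (by positivity : 0 ≤ 45 * b * Cβ)
      linarith)
  have hlow : μ * S ≤ D.ε * D.W i j * |D.q i j t| ^ 2 + D.ε * D.W i j * |D.r i j t| ^ 2
      + b / 2 * (D.V i j * D.gmax i j t ^ 2) + c * (D.W i j * D.gmax i j t ^ 2)
      + b ^ 2 * 0 * (D.W i j * |D.q i j t| ^ 2) := by
    have d1 := mul_le_mul_of_nonneg_right hμ1 (by positivity : 0 ≤ D.ε * D.W i j * |D.q i j t| ^ 2)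
    have d2 := mul_le_mul_of_nonneg_right hμ1 (by positivity : 0 ≤ D.ε * D.W i j * |D.r i j t| ^ 2)
    have d3 := mul_le_mul_of_nonneg_right hμb (by positivity : 0 ≤ D.V i j * D.gmax i j t ^ 2)
    have d4 := mul_le_mul_of_nonneg_right hμc (by positivity : 0 ≤ D.W i j * D.gmax i j t ^ 2)
    rw [hS]
    linarith
  obtain ⟨I, hI⟩ : ∃ I, I = ∫ z in openTri D.xs D.ys i j t, D.normDensity b c 0 i j t z :=
    ⟨_, rfl⟩
  obtain ⟨J, hJ⟩ : ∃ J, J = ∫ z in openTri D.xs D.ys i j t, D.F z * D.G i j t z ^ 2 := ⟨_, rfl⟩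
  rw [← hI] at low ⊢
  rw [← hJ] at low' ⊢
  have l2 : D.hx i * D.hy j * S ≤ 921600 * I / μ := by
    rw [le_div_iff₀ hμ]
    have := mul_le_mul_of_nonneg_left hlow hA
    linarith
  have l3 : D.hx i * D.hy j * Z ≤ D.ε / l ^ 2 * (921600 * J) := by
    have := mul_le_mul_of_nonneg_left low' (by positivity : 0 ≤ D.ε / l ^ 2)
    rw [hZ]; linarith
  rw [← hCβ, ← hl]
  calc _ ≤ _ := up
    _ = √D.k⁻¹ * (400 * (2 + c) + 45 * b * Cβ) * (D.hx i * D.hy j * S)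
        + 45 * b * Cβ * D.k⁻¹ * (D.hx i * D.hy j * Z) := by ring
    _ ≤ √D.k⁻¹ * (400 * (2 + c) + 45 * b * Cβ) * (921600 * I / μ)
        + 45 * b * Cβ * D.k⁻¹ * (D.ε / l ^ 2 * (921600 * J)) :=
      add_le_add (mul_le_mul_of_nonneg_left l2 (by positivity))
        (mul_le_mul_of_nonneg_left l3 (by positivity))
    _ = _ := by ring

end Bounds

end LocalRep

/-! ### Elementwise form of the bilinear form and of the norm -/

/-- The product of the two opposite `y`-factors becomes a sum because their exponentials are
reciprocal. -/
lemma omega_inv (k ε : ℝ) (N : ℕ) (a z : ℝ × ℝ) :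
    (omega k ε N a z)⁻¹ = wP a.1 (sigmaX k ε N) z.1 * wQ a.2 (sigmaY k ε N) z.2 := by
  rw [omega, g, g, g, wP, wQ]
  have e : Real.exp ((z.2 - a.2) / sigmaY k ε N) * Real.exp (-((z.2 - a.2) / sigmaY k ε N)) = 1 := by
    rw [← Real.exp_add, add_neg_cancel, Real.exp_zero]
  have h1 := Real.exp_pos ((z.1 - a.1) / sigmaX k ε N)
  have h2 := Real.exp_pos ((z.2 - a.2) / sigmaY k ε N)
  have h3 := Real.exp_pos (-((z.2 - a.2) / sigmaY k ε N))
  generalize Real.exp ((z.1 - a.1) / sigmaX k ε N) = A at *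
  generalize Real.exp ((z.2 - a.2) / sigmaY k ε N) = B at *
  generalize Real.exp (-((z.2 - a.2) / sigmaY k ε N)) = B' at *
  have e' : (1 + B) * (1 + B') = 2 + B + B' := by linarith
  rw [← e']
  field_simp
  norm_num

lemma tri_eq_closedTri {β ε : ℝ} {N : ℕ} (hx : StrictMono (meshX β ε N))
    (hy : StrictMono (meshY ε N)) (K : Elt N) :
    tri β ε N K = closedTri (meshX β ε N) (meshY ε N) K.1 K.2.1 K.2.2 := by
  obtain ⟨i, j, t⟩ := K
  rw [← hullTri_eq_closedTri hx hy]
  cases t <;> rfl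

/-- An interior point belongs to no other triangle, so the choice in `interp` is forced. -/
lemma interp_eq_localInterp {β ε : ℝ} {N : ℕ} (hx : StrictMono (meshX β ε N))
    (hy : StrictMono (meshY ε N)) (w : ℝ × ℝ → ℝ) (K : Elt N) {z : ℝ × ℝ}
    (hz : z ∈ openTri (meshX β ε N) (meshY ε N) K.1 K.2.1 K.2.2) :
    interp β ε N w z = localInterp β ε N w K z := by
  have hex : ∃ K : Elt N, z ∈ tri β ε N K :=
    ⟨K, by rw [tri_eq_closedTri hx hy]; exact openTri_subset_closedTri _ _ _ hz⟩
  rw [interp, dif_pos hex]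
  have hc := hex.choose_spec
  rw [tri_eq_closedTri hx hy] at hc
  obtain ⟨h1, h2, h3⟩ := openTri_unique hx hy hz hc
  congr 1
  exact (Prod.ext (Fin.ext h1) (Prod.ext (Fin.ext h2) h3)).symm

lemma MemVN.exists_coefficients {β ε : ℝ} {N : ℕ} {u : ℝ × ℝ → ℝ} (hu : MemVN β ε N u)
    (hx : StrictMono (meshX β ε N)) (hy : StrictMono (meshY ε N)) (k xa ya : ℝ) :
    ∃ p q r, LocalRep.Represents ⟨β, ε, k, N, xa, ya, p, q, r⟩ u := by
  have : ∀ (i j : ℕ) (t : Bool), ∃ p q r : ℝ, i < N → j < N →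
      ∀ z ∈ closedTri (meshX β ε N) (meshY ε N) i j t, u z = p + q * z.1 + r * z.2 := by
    intro i j t
    by_cases h : i < N ∧ j < N
    · obtain ⟨p, q, r, hpqr⟩ := hu.affine (⟨i, h.1⟩, ⟨j, h.2⟩, t)
      rw [tri_eq_closedTri hx hy] at hpqr
      exact ⟨p, q, r, fun _ _ => hpqr⟩
    -- Indices outside the mesh receive zero coefficients, so that they can be plain natural
    -- numbers.
    · exact ⟨0, 0, 0, fun h1 h2 => absurd ⟨h1, h2⟩ h⟩
  choose p q r hpqr using this
  exact ⟨p, q, r, fun i hi j hj t z hz => hpqr i j t hi hj z hz, hu.boundary⟩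

namespace LocalRep

section Identities

variable {D : LocalRep} (h : MeshParams D.β D.ε D.k D.N) {u : ℝ × ℝ → ℝ} (hu : D.Represents u)

lemma omega_inv_eq_F (z : ℝ × ℝ) : (omega D.k D.ε D.N (D.xa, D.ya) z)⁻¹ = D.F z :=
  omega_inv _ _ _ _ _

include h hu

lemma interpolationError_eqOn (K : Elt D.N) :
    Set.EqOn (fun z => interp D.β D.ε D.N
        (fun z' => (omega D.k D.ε D.N (D.xa, D.ya) z')⁻¹ * u z') z
        - (omega D.k D.ε D.N (D.xa, D.ya) z)⁻¹ * u z)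
      (D.E K.1 K.2.1 K.2.2) (openTri D.xs D.ys K.1 K.2.1 K.2.2) := by
  intro z hz
  simp only [omega_inv_eq_F]
  rw [interp_eq_localInterp h.strictMonoX h.strictMonoY _ K hz]
  have hc := openTri_subset_closedTri _ _ _ hz
  obtain ⟨⟨i, hi⟩, ⟨j, hj⟩, t⟩ := K
  have V := vertex_mem_closedTri h (D := D) i j
  simp only at hc
  rw [← hu.w_eq hi hj hc]
  cases t
  · simp only [localInterp, E, sx, sy, cx, cy, Bool.false_eq_true, if_false]
    rw [hu.w_eq hi hj V.1, hu.w_eq hi hj V.2.1, hu.w_eq hi hj V.2.2.1]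
    simp only [node]
    ring
  · simp only [localInterp, E, sx, sy, cx, cy, if_true]
    rw [hu.w_eq hi hj V.2.2.2.1, hu.w_eq hi hj V.2.2.2.2.1, hu.w_eq hi hj V.2.2.2.2.2]
    simp only [node]
    ring

omit h in
lemma represents_eqOn (K : Elt D.N) :
    Set.EqOn u (D.G K.1 K.2.1 K.2.2) (openTri D.xs D.ys K.1 K.2.1 K.2.2) := fun z hz =>
  hu.eq K.1 K.1.2 K.2.1 K.2.1.2 K.2.2 z (openTri_subset_closedTri _ _ _ hz)

omit h in
lemma dx_eqOn (K : Elt D.N) :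
    Set.EqOn (dx u) (fun _ => D.q K.1 K.2.1 K.2.2) (openTri D.xs D.ys K.1 K.2.1 K.2.2) := by
  rw [← dx_G]
  exact dx_congr_of_isOpen (isOpen_openTri _ _ _ _ _) (represents_eqOn hu K)

omit h in
lemma dy_eqOn (K : Elt D.N) :
    Set.EqOn (dy u) (fun _ => D.r K.1 K.2.1 K.2.2) (openTri D.xs D.ys K.1 K.2.1 K.2.2) := by
  rw [← dy_G]
  exact dy_congr_of_isOpen (isOpen_openTri _ _ _ _ _) (represents_eqOn hu K)

/-- The bilinear form of a function that is elementwise the interpolation error. -/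
lemma aSD_eq_sum (b c Cs : ℝ) {e : ℝ × ℝ → ℝ}
    (he : ∀ K : Elt D.N, Set.EqOn e (D.E K.1 K.2.1 K.2.2) (openTri D.xs D.ys K.1 K.2.1 K.2.2)) :
    aSD b c D.β Cs D.ε D.N e u = ∑ K : Elt D.N, ∫ z in openTri D.xs D.ys K.1 K.2.1 K.2.2,
      D.formDensity b c (delta Cs D.N K) K.1 K.2.1 K.2.2 z := by
  have ho := fun K : Elt D.N => isOpen_openTri D.xs D.ys K.1 K.2.1 K.2.2
  have hex : ∀ K : Elt D.N, Set.EqOn (dx e) (D.Ex K.1 K.2.1 K.2.2)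
      (openTri D.xs D.ys K.1 K.2.1 K.2.2) := fun K => by
    rw [← dx_E]; exact dx_congr_of_isOpen (ho K) (he K)
  have hey : ∀ K : Elt D.N, Set.EqOn (dy e) (D.Ey K.1 K.2.1 K.2.2)
      (openTri D.xs D.ys K.1 K.2.1 K.2.2) := fun K => by
    rw [← dy_E]; exact dy_congr_of_isOpen (ho K) (he K)
  have hlap : ∀ K : Elt D.N, Set.EqOn (fun z => dx (dx e) z + dy (dy e) z)
      (fun z => -D.wlap K.1 K.2.1 K.2.2 z) (openTri D.xs D.ys K.1 K.2.1 K.2.2) := fun K z hz => by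
    simp only
    rw [← laplacian_E, dx_congr_of_isOpen (ho K) (hex K) hz, dy_congr_of_isOpen (ho K) (hey K) hz]
  have hux := fun K => dx_eqOn hu K
  have huy := fun K => dy_eqOn hu K
  have huu := fun K => represents_eqOn hu K
  have dec := fun (f : ℝ × ℝ → ℝ) (F : Elt D.N → ℝ × ℝ → ℝ) (hF : ∀ K, Continuous (F K)) hf =>
    setIntegral_Omega_eq_sum (f := f) h.strictMonoX h.strictMonoY (N := D.N) meshX_zero
      (meshX_last h.N0) meshY_zero (meshY_last h.N0) hF hf
  have s1 := dec (fun z => dx e z * dx u z) (fun K z => D.Ex K.1 K.2.1 K.2.2 z * D.q K.1 K.2.1 K.2.2)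
    (fun K => by fun_prop) (fun K z hz => by simp only [hex K hz, hux K hz])
  have s2 := dec (fun z => dy e z * dy u z) (fun K z => D.Ey K.1 K.2.1 K.2.2 z * D.r K.1 K.2.1 K.2.2)
    (fun K => by fun_prop) (fun K z hz => by simp only [hey K hz, huy K hz])
  have s3 := dec (fun z => (b * dx e z + c * e z) * u z)
    (fun K z => (b * D.Ex K.1 K.2.1 K.2.2 z + c * D.E K.1 K.2.1 K.2.2 z) * D.G K.1 K.2.1 K.2.2 z)
    (fun K => by fun_prop) (fun K z hz => by simp only [hex K hz, he K hz, huu K hz])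
  have s4 : ∀ K : Elt D.N, ∫ z in tri D.β D.ε D.N K,
      (-D.ε * (dx (dx e) z + dy (dy e) z) + b * dx e z + c * e z)
        * (delta Cs D.N K * b * dx u z)
      = ∫ z in openTri D.xs D.ys K.1 K.2.1 K.2.2,
        (-D.ε * (-D.wlap K.1 K.2.1 K.2.2 z) + b * D.Ex K.1 K.2.1 K.2.2 z
          + c * D.E K.1 K.2.1 K.2.2 z) * (delta Cs D.N K * b * D.q K.1 K.2.1 K.2.2) := fun K => by
    rw [tri_eq_closedTri h.strictMonoX h.strictMonoY]
    refine setIntegral_closedTri_eq fun z hz => ?_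
    have := hlap K hz
    simp only at this
    simp only [this, hex K hz, he K hz, hux K hz]
  have ibp := sum_integral_E_mul_G h hu
  simp only [aSD, aGal, aStab, ip]
  rw [s1, s2, s3, Finset.sum_congr rfl fun K _ => s4 K, ← Finset.sum_add_distrib, Finset.mul_sum,
    ← Finset.sum_add_distrib, ← Finset.sum_add_distrib]
  -- Subtracting `b` times the vanishing integral of `(E G)_x` replaces `b E_x G` by `-b E G_x`.
  rw [← sub_zero (Finset.sum _ _), ← mul_zero b, ← ibp, Finset.mul_sum, ← Finset.sum_sub_distrib]
  refine Finset.sum_congr rfl fun K _ => ?_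
  obtain ⟨i, j, t⟩ := K
  have I : ∀ f : ℝ × ℝ → ℝ, Continuous f → Integrable f
      (volume.restrict (openTri D.xs D.ys i j t)) :=
    fun f hf => integrableOn_openTri h.strictMonoX h.strictMonoY hf i j t
  simp only
  rw [← integral_add (I _ (by fun_prop)) (I _ (by fun_prop)), ← integral_const_mul,
    ← integral_const_mul, ← integral_add (I _ (by fun_prop)) (I _ (by fun_prop)),
    ← integral_add (I _ (by fun_prop)) (I _ (by fun_prop)),
    ← integral_sub (I _ (by fun_prop)) (I _ (by fun_prop))]
  congr 1
  ext z
  simp only [formDensity]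
  ring

/-- The weighted norm as a sum over the triangles. -/
lemma wNormSq_eq_sum (b c Cs : ℝ) :
    wNormSq b c D.β Cs D.ε D.N (omega D.k D.ε D.N (D.xa, D.ya)) u
      = ∑ K : Elt D.N, ∫ z in openTri D.xs D.ys K.1 K.2.1 K.2.2,
        D.normDensity b c (delta Cs D.N K) K.1 K.2.1 K.2.2 z := by
  have hux := fun K => dx_eqOn hu K
  have huy := fun K => dy_eqOn hu K
  have huu := fun K => represents_eqOn hu K
  have hF : ∀ (z : ℝ × ℝ) (a : ℝ), (√(D.F z) * a) ^ 2 = D.F z * a ^ 2 := fun z a => by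
    rw [mul_pow, Real.sq_sqrt (D.F_pos z).le]
  have hFx : ∀ (z : ℝ × ℝ) (a : ℝ), (√(D.Fx z) * a) ^ 2 = D.Fx z * a ^ 2 := fun z a => by
    rw [mul_pow, Real.sq_sqrt (Fx_nonneg h z)]
  have dec := fun (f : ℝ × ℝ → ℝ) (F : Elt D.N → ℝ × ℝ → ℝ) (hF : ∀ K, Continuous (F K)) hf =>
    setIntegral_Omega_eq_sum (f := f) h.strictMonoX h.strictMonoY (N := D.N) meshX_zero
      (meshX_last h.N0) meshY_zero (meshY_last h.N0) hF hf
  have s1 := dec (fun z => D.F z * dx u z ^ 2) (fun K z => D.F z * D.q K.1 K.2.1 K.2.2 ^ 2)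
    (fun K => by fun_prop) (fun K z hz => by simp only [hux K hz])
  have s2 := dec (fun z => D.F z * dy u z ^ 2) (fun K z => D.F z * D.r K.1 K.2.1 K.2.2 ^ 2)
    (fun K => by fun_prop) (fun K z hz => by simp only [huy K hz])
  have s3 := dec (fun z => D.Fx z * u z ^ 2) (fun K z => D.Fx z * D.G K.1 K.2.1 K.2.2 z ^ 2)
    (fun K => by fun_prop) (fun K z hz => by simp only [huu K hz])
  have s4 := dec (fun z => D.F z * u z ^ 2) (fun K z => D.F z * D.G K.1 K.2.1 K.2.2 z ^ 2)
    (fun K => by fun_prop) (fun K z hz => by simp only [huu K hz])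
  have s5 : ∀ K : Elt D.N, ∫ z in tri D.β D.ε D.N K, D.F z * dx u z ^ 2
      = ∫ z in openTri D.xs D.ys K.1 K.2.1 K.2.2, D.F z * D.q K.1 K.2.1 K.2.2 ^ 2 := fun K => by
    rw [tri_eq_closedTri h.strictMonoX h.strictMonoY]
    exact setIntegral_closedTri_eq fun z hz => by simp only [hux K hz]
  simp only [wNormSq, normSq, omega_inv_eq_F, dx_F, hF, hFx]
  rw [s1, s2, s3, s4, Finset.sum_congr rfl fun K _ => congrArg _ (s5 K)]
  simp only [Finset.mul_sum]
  rw [← Finset.sum_add_distrib, ← Finset.sum_add_distrib, ← Finset.sum_add_distrib,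
    ← Finset.sum_add_distrib]
  refine Finset.sum_congr rfl fun K _ => ?_
  obtain ⟨i, j, t⟩ := K
  have I : ∀ f : ℝ × ℝ → ℝ, Continuous f → Integrable f
      (volume.restrict (openTri D.xs D.ys i j t)) :=
    fun f hf => integrableOn_openTri h.strictMonoX h.strictMonoY hf i j t
  simp only
  rw [← integral_const_mul, ← integral_const_mul, ← integral_const_mul, ← integral_const_mul,
    ← integral_const_mul, ← integral_add (I _ (by fun_prop)) (I _ (by fun_prop)),
    ← integral_add (I _ (by fun_prop)) (I _ (by fun_prop)),
    ← integral_add (I _ (by fun_prop)) (I _ (by fun_prop)),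
    ← integral_add (I _ (by fun_prop)) (I _ (by fun_prop))]
  congr 1

/-- The bilinear form is dominated by the weighted norm with a factor that tends to zero as `k`
tends to infinity. -/
lemma aSD_le {b c Cs μ : ℝ} (hb : 0 < b) (hc : 0 < c) (hCs : 0 < Cs)
    (hμ : 0 < μ) (hμ1 : μ ≤ 1) (hμb : μ ≤ b / 2) (hμc : μ ≤ c) (hμs : μ ≤ b ^ 2 * Cs) :
    aSD b c D.β Cs D.ε D.N (fun z => interp D.β D.ε D.N
        (fun z' => (omega D.k D.ε D.N (D.xa, D.ya) z')⁻¹ * u z') z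
        - (omega D.k D.ε D.N (D.xa, D.ya) z)⁻¹ * u z) u
      ≤ √D.k⁻¹ * (552960000 * (2 + b + c + Cs * b * (1 + b + c)) / μ
        + 921600 * (400 * (2 + c) + 45 * b * (25 / 2 / D.β ^ 2 + 30 / D.β)) / μ
        + 4 * (921600 * (45 * b * (25 / 2 / D.β ^ 2 + 30 / D.β))))
        * wNormSq b c D.β Cs D.ε D.N (omega D.k D.ε D.N (D.xa, D.ya)) u := by
  rw [aSD_eq_sum h hu b c Cs (interpolationError_eqOn h hu), wNormSq_eq_sum h hu]
  have hβ := h.β0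
  have hk := h.k_pos
  have hε := h.ε0
  have hl0 := h.lambdaX_pos
  obtain ⟨A, hA⟩ : ∃ A, A = 552960000 * (2 + b + c + Cs * b * (1 + b + c)) / μ := ⟨_, rfl⟩
  obtain ⟨B, hB⟩ : ∃ B, B = 921600 * (400 * (2 + c)
    + 45 * b * (25 / 2 / D.β ^ 2 + 30 / D.β)) / μ := ⟨_, rfl⟩
  obtain ⟨M, hM⟩ : ∃ M, M = 921600 * (45 * b * (25 / 2 / D.β ^ 2 + 30 / D.β)) := ⟨_, rfl⟩
  obtain ⟨θ, hθ⟩ : ∃ θ, θ = √D.k⁻¹ := ⟨_, rfl⟩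
  have hA0 : 0 ≤ A := by rw [hA]; positivity
  have hB0 : 0 ≤ B := by rw [hB]; positivity
  have hM0 : 0 ≤ M := by rw [hM]; positivity
  have hθ0 : 0 ≤ θ := hθ ▸ Real.sqrt_nonneg _
  have κθ : D.k⁻¹ ≤ θ := by
    rw [hθ]
    exact (cellParams' h 0 0 false).kappa_le_theta (Real.sqrt_nonneg _)
      (Real.sq_sqrt (inv_pos.2 hk).le).symm
  have hδ0 : ∀ K : Elt D.N, 0 ≤ delta Cs D.N K := fun K => by
    unfold delta; split_ifs <;> positivity
  have nn := fun K : Elt D.N =>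
    integral_normDensity_nonneg h hb.le hc.le (hδ0 K) K.1 K.2.1 K.2.2
  -- One inequality for both kinds of triangles; only those in the layer contribute the extra term.
  have each : ∀ K : Elt D.N, (∫ z in openTri D.xs D.ys K.1 K.2.1 K.2.2,
      D.formDensity b c (delta Cs D.N K) K.1 K.2.1 K.2.2 z)
      ≤ θ * (A + B) * (∫ z in openTri D.xs D.ys K.1 K.2.1 K.2.2,
        D.normDensity b c (delta Cs D.N K) K.1 K.2.1 K.2.2 z)
      + M * D.k⁻¹ * (D.ε / lambdaX D.β D.ε D.N ^ 2) * (if D.N ≤ 2 * (K.1 : ℕ) then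
        ∫ z in openTri D.xs D.ys K.1 K.2.1 K.2.2, D.F z * D.G K.1 K.2.1 K.2.2 z ^ 2 else 0) := by
    intro K
    have n1 := nn K
    have p1 := mul_nonneg (mul_nonneg hθ0 hA0) n1
    have p2 := mul_nonneg (mul_nonneg hθ0 hB0) n1
    by_cases hi : D.N ≤ 2 * (K.1 : ℕ)
    · have hd : delta Cs D.N K = 0 := if_neg (not_lt.2 hi)
      have := integral_formDensity_le_fine h hb hc hμ hμ1 hμb hμc hi K.2.1 K.2.2
      rw [if_pos hi]
      rw [hd] at p1 p2 ⊢
      rw [← hB, ← hM, ← hθ] at this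
      linarith
    · have hd : delta Cs D.N K = Cs / D.N := if_pos (not_le.1 hi)
      have := integral_formDensity_le_coarse h hb hc hCs hμ hμ1 hμb hμc hμs K.1 K.2.1 K.2.2
      rw [if_neg hi]
      rw [hd] at p1 p2 ⊢
      rw [← hA, ← hθ] at this
      linarith
  have S := Finset.sum_le_sum fun K (_ : K ∈ Finset.univ) => each K
  rw [Finset.sum_add_distrib, ← Finset.mul_sum, ← Finset.mul_sum] at S
  have PC := poincare_layer h hu
  -- The right-hand side of the Poincaré inequality, times `ε`, is part of the diffusion energy.
  have last : D.ε * ∑ K : Elt D.N, (if D.N ≤ 2 * (K.1 : ℕ) then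
        ∫ z in openTri D.xs D.ys K.1 K.2.1 K.2.2, D.F z * D.q K.1 K.2.1 K.2.2 ^ 2 else 0)
      ≤ ∑ K : Elt D.N, ∫ z in openTri D.xs D.ys K.1 K.2.1 K.2.2,
        D.normDensity b c (delta Cs D.N K) K.1 K.2.1 K.2.2 z := by
    rw [Finset.mul_sum]
    refine Finset.sum_le_sum fun K _ => ?_
    split_ifs
    · rw [← integral_const_mul]
      refine setIntegral_mono_on (integrableOn_openTri h.strictMonoX h.strictMonoY (by fun_prop) _ _ _)
        (integrableOn_openTri h.strictMonoX h.strictMonoY (by fun_prop) _ _ _)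
        (isOpen_openTri _ _ _ _ _).measurableSet fun z _ => ?_
      have f1 := (D.F_pos z).le
      have f2 : 0 ≤ D.Fx z := Fx_nonneg h z
      have f3 := hδ0 K
      have f4 : 0 ≤ D.ε * (D.F z * D.r K.1 K.2.1 K.2.2 ^ 2)
        + b / 2 * (D.Fx z * D.G K.1 K.2.1 K.2.2 z ^ 2) + c * (D.F z * D.G K.1 K.2.1 K.2.2 z ^ 2)
        + b ^ 2 * delta Cs D.N K * (D.F z * D.q K.1 K.2.1 K.2.2 ^ 2) := by positivity
      unfold normDensity
      linarith
    · rw [mul_zero]; exact nn K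
  have total := Finset.sum_nonneg fun K (_ : K ∈ Finset.univ) => nn K
  rw [← hA, ← hB, ← hM, ← hθ]
  generalize (∑ K : Elt D.N, ∫ z in openTri D.xs D.ys K.1 K.2.1 K.2.2,
    D.normDensity b c (delta Cs D.N K) K.1 K.2.1 K.2.2 z) = R at *
  refine S.trans ?_
  have q1 := mul_le_mul_of_nonneg_left PC
    (by positivity : 0 ≤ M * D.k⁻¹ * (D.ε / lambdaX D.β D.ε D.N ^ 2))
  have q2 := mul_le_mul_of_nonneg_left last (by positivity : 0 ≤ 4 * (M * D.k⁻¹))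
  have q3 := mul_le_mul_of_nonneg_right κθ (by positivity : 0 ≤ 4 * (M * R))
  -- The factor `λ_x²` of the Poincaré inequality cancels the `ε/λ_x²` of the layer term, leaving
  -- `ε`.
  have e1 : ∀ s : ℝ, M * D.k⁻¹ * (D.ε / lambdaX D.β D.ε D.N ^ 2)
      * (4 * lambdaX D.β D.ε D.N ^ 2 * s) = 4 * (M * D.k⁻¹) * (D.ε * s) := fun s => by
    field_simp
  rw [e1] at q1
  linarith

end Identities

end LocalRep

end ShishkinSDFEM

end

/-! ### Choice of the threshold for `k` and conclusion -/

open ShishkinSDFEM in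
theorem mainTheorem2 (b c β Cs : ℝ) (hβ : 0 < β) (hb : β ≤ b) (hc : 0 < c) (hCs : 0 < Cs) :
    ∃ k₀ : ℝ, 1 < k₀ ∧ ∀ k : ℝ, k₀ ≤ k →
      ∀ (N : ℕ) (ε : ℝ), 0 < N → 6 ∣ N → 0 < ε → ε ≤ (N : ℝ)⁻¹ →
        lambdaX β ε N = rho * (ε / β) * Real.log N →
        lambdaY ε N = rho * √ε * Real.log N →
        ∀ i j : ℕ, i ≤ N → j ≤ N →
        ∀ G : ℝ × ℝ → ℝ, IsDiscreteGreen b c β Cs ε N (node β ε N i j) G →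
          aSD b c β Cs ε N
            (fun z =>
              interp β ε N (fun z' => (omega k ε N (node β ε N i j) z')⁻¹ * G z') z
                - (omega k ε N (node β ε N i j) z)⁻¹ * G z) G
            ≤ 1 / 16 * wNormSq b c β Cs ε N (omega k ε N (node β ε N i j)) G := by
  have hb0 : 0 < b := hβ.trans_le hb
  obtain ⟨μ, hμ⟩ : ∃ μ, μ = min (min 1 (b / 2)) (min c (b ^ 2 * Cs)) := ⟨_, rfl⟩
  have hμ0 : 0 < μ := by rw [hμ]; positivity
  have hμ1 : μ ≤ 1 := hμ ▸ (min_le_left _ _).trans (min_le_left _ _)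
  have hμb : μ ≤ b / 2 := hμ ▸ (min_le_left _ _).trans (min_le_right _ _)
  have hμc : μ ≤ c := hμ ▸ (min_le_right _ _).trans (min_le_left _ _)
  have hμs : μ ≤ b ^ 2 * Cs := hμ ▸ (min_le_right _ _).trans (min_le_right _ _)
  obtain ⟨C, hC⟩ : ∃ C, C = 552960000 * (2 + b + c + Cs * b * (1 + b + c)) / μ
      + 921600 * (400 * (2 + c) + 45 * b * (25 / 2 / β ^ 2 + 30 / β)) / μ
      + 4 * (921600 * (45 * b * (25 / 2 / β ^ 2 + 30 / β))) := ⟨_, rfl⟩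
  have hC0 : 0 < C := by rw [hC]; positivity
  -- The summand 5 yields `5/k ≤ 1`, assumed in the cell relations; the square yields `√k ≥ 16 C`,
  -- that is `C k^(-1/2) ≤ 1/16`.
  refine ⟨5 + (16 * C) ^ 2, by nlinarith [sq_nonneg (16 * C)], ?_⟩
  intro k hk N ε hN h6 hε hεN hlx hly i j _ _ G hG
  have h : MeshParams β ε k N := ⟨Nat.le_of_dvd hN h6, (by norm_num : 2 ∣ 6).trans h6,
    (by norm_num : 3 ∣ 6).trans h6, hβ, hε, hεN, by nlinarith [sq_nonneg (16 * C)], hlx, hly⟩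
  obtain ⟨p, q, r, hu⟩ := hG.1.exists_coefficients h.strictMonoX h.strictMonoY k
    (meshX β ε N i) (meshY ε N j)
  have main := LocalRep.aSD_le (D := ⟨β, ε, k, N, meshX β ε N i, meshY ε N j, p, q, r⟩) h hu
    hb0 hc hCs hμ0 hμ1 hμb hμc hμs
  have nn : 0 ≤ wNormSq b c β Cs ε N (omega k ε N (node β ε N i j)) G := by
    have hδ : ∀ K : Elt N, 0 ≤ delta Cs N K := fun K => by
      unfold delta; split_ifs <;> positivity
    have hI : ∀ (S : Set (ℝ × ℝ)) (f : ℝ × ℝ → ℝ), 0 ≤ normSq S f := fun S f =>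
      integral_nonneg fun z => sq_nonneg _
    unfold wNormSq
    have := Finset.sum_nonneg fun K (_ : K ∈ Finset.univ) =>
      mul_nonneg (mul_nonneg (sq_nonneg b) (hδ K)) (hI (tri β ε N K)
        (fun z => √((omega k ε N (node β ε N i j) z)⁻¹) * dx G z))
    have a1 := mul_nonneg hε.le (hI Omega
      (fun z => √((omega k ε N (node β ε N i j) z)⁻¹) * dx G z))
    have a2 := mul_nonneg hε.le (hI Omega
      (fun z => √((omega k ε N (node β ε N i j) z)⁻¹) * dy G z))
    have a3 := mul_nonneg (half_pos hb0).le (hI Omega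
      (fun z => √(dx (fun z' => (omega k ε N (node β ε N i j) z')⁻¹) z) * G z))
    have a4 := mul_nonneg hc.le (hI Omega
      (fun z => √((omega k ε N (node β ε N i j) z)⁻¹) * G z))
    linarith
  refine main.trans (mul_le_mul_of_nonneg_right ?_ nn)
  have hθ : √k⁻¹ * (16 * C) ≤ 1 := by
    have h1 : 16 * C ≤ √k := Real.le_sqrt_of_sq_le (by linarith)
    have hs : 0 < √k := Real.sqrt_pos.2 h.k_pos
    rw [Real.sqrt_inv, ← div_eq_inv_mul, div_le_one hs]
    exact h1
  simp only
  rw [← hC]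
  linarith
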